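/- Let $m\ge 0$, $N\ge 1$ be integers and $\alpha\ne 0$ a real number. Consider either periodic boundary conditions (site indices in $\mathbb Z/N\mathbb Z$, phase spaces $\mathbb R^{(m+1)N}$ with coordinates $b_k,a^{(1)}_k,\dots,a^{(m)}_k$, resp. $d_k,c^{(1)}_k,\dots,c^{(m)}_k$, $1\le k\le N$) or open-end boundary conditions (only $b_k,d_k$ with $1\le k\le N$ and $a^{(j)}_k,c^{(j)}_k$ with $1\le k\le N-j$ are present, all others are $0$). Put $a^{(0)}=b$, and $a^{(j)}=c^{(j)}=0$ for $j>m$. Brackets are given by their values on pairs of coordinates, extended by skew-symmetry and the Leibniz rule; values not listed are $0$, and if for a short periodic lattice several listed values refer to the same pair they are added. Let $\{\cdot,\cdot\}_1$ be the linear bracket of $\mathrm{RTL}^{(-)}_{m+1}(-\alpha)$ in the variables $(b,a)$, $$\{a^{(i)}_k,a^{(j)}_{k+i}\}_1=-a^{(i+j)}_k\ \ ((i,j)\neq(0,0)),\qquad \{a^{(i)}_k,a^{(j)}_{k+i+1}\}_1=-\alpha\, a^{(i+j+1)}_k\qquad (0\le i,j\le m),$$ and let $\{\cdot,\cdot\}_{2\alpha}$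 be the quadratic bracket in the variables $(d,c)$: for $1\le i,j\le m$, $$\{d_k,c^{(j)}_k\}_{2\alpha}=-c^{(j)}_k(1+\alpha d_k),\qquad \{c^{(j)}_k,d_{k+j}\}_{2\alpha}=-c^{(j)}_k(1+\alpha d_{k+j}),$$ $$\{c^{(i)}_k,c^{(j)}_{k+i}\}_{2\alpha}=-c^{(i+j)}_k-\alpha c^{(i)}_kc^{(j)}_{k+i},$$ $$\{c^{(i)}_k,c^{(j)}_{k+\ell}\}_{2\alpha}=-\alpha c^{(i)}_kc^{(j)}_{k+\ell}+\alpha c^{(j+\ell)}_kc^{(i-\ell)}_{k+\ell}\quad(\max(1,i-j+1)\le\ell\le i-1).$$ Let $\mathbf B(\alpha)$ be the change of variables $$d_k=\frac{b_k}{1-\alpha b_k},\qquad c^{(j)}_k=\frac{a^{(j)}_k}{\prod_{i=0}^{j}(1-\alpha b_{k+i})}.$$ The hierarchy $\mathrm{RTL}^{(+)}_{m+1}(\alpha)$ is defined on $\Omega_+=\{1+\alpha d_k\ne0\ \forall k\}$ as follows. Let $L=\sum_k(1+\alpha d_k)E_{kk}+\alpha\lambda\sum_kE_{k+1,k}$,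 $U=I-\alpha\sum_{j=1}^m\lambda^{-j}\sum_kc^{(j)}_kE_{k,k+j}$, $T_1=LU^{-1}$, $T_2=U^{-1}L$ (in the open-end case the entries of $gl(N)$-matrices are multiplied by $\lambda^{r-c}$, $r$ being the row and $c$ the column, so that the diagonal grading becomes the grading by powers of $\lambda$). Let $\pi_+$ be the projection on the non-negative powers of $\lambda$. The flows are given by the Lax triads $$\dot L=LB_2-B_1L,\qquad \dot U=UB_2-B_1U,\qquad B_i=\pi_+(f(T_i)),$$ with $f(T)=\mu^qT^n$ (expanded in powers of $\lambda^{-1}$) or $f(T)=\mu^qT^{-n}$ (expanded in powers of $\lambda$), where $n\ge0$ and $q$ are integers, $\mu=\lambda^N/\prod_k(1+\alpha d_k)$ is the $N$-th power of the normalized spectral parameter, and $q=0$ in the open-end case. The system $\mathrm{RTL}^{(+)}_{m+1}(\alpha)$ itself is, with $c^{(m+1)}=0$ and $1\le j\le m$, $$\dot d_k=(1+\alpha d_k)(c^{(1)}_k-c^{(1)}_{k-1}),$$ $$\dot c^{(j)}_k=c^{(j)}_k\bigl(d_{k+j}-d_k+\alpha c^{(1)}_{k+j}-\alpha c^{(1)}_{k-1}\bigr)+c^{(j+1)}_k-c^{(j+1)}_{k-1}.$$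 Theorem. The map $\mathbf B(\alpha)$ is a diffeomorphism of $\{1-\alpha b_k\ne0\ \forall k\}$ onto $\Omega_+$ with inverse $\mathbf B(-\alpha)$, and there is a bracket $\{\cdot,\cdot\}_{3\alpha}$ on the whole phase space of the variables $(d,c)$ such that: 1. (cubic) all brackets of coordinates are polynomials of degree at most $3$ in the coordinates; 2. (push-forward) on $\Omega_+$ it is the push-forward of $\{\cdot,\cdot\}_1$ under $\mathbf B(\alpha)$; 3. it is a Poisson bracket; 4. (invariance) the system $\mathrm{RTL}^{(+)}_{m+1}(\alpha)$ and every flow of its hierarchy given above are Hamiltonian with respect to it on $\Omega_+$: for each of them there is a smooth function $H$ on $\Omega_+$ such that the flow is $\dot x=\{H,x\}_{3\alpha}$; 5. (compatibility) $\{\cdot,\cdot\}_{2\alpha}$ and $\{\cdot,\cdot\}_{3\alpha}$ are Poisson brackets, all of whose linear combinations are Poisson brackets. -/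

import Mathlib

open scoped ContDiff

noncomputable section

open scoped Classical

/-! ## Phase spaces -/

/-- The two kinds of boundary conditions of the finite lattices. -/
inductive Boundary where
  | periodic
  | openEnd

/-- Two integers denote the same lattice site: congruence mod `N` in the periodic case, equality in
the open-end case. -/
def SameSite (bc : Boundary) (N : ℕ) (k l : ℤ) : Prop :=
  match bc with
  | .periodic => k ≡ l [ZMOD N]
  | .openEnd => k = l

/-- Labels `(j, k)` of the phase variables: `j = 0, …, m` numbers the field (`j = 0` stands for
`b`, resp. `d`, and `j ≥ 1` for `a⁽ʲ⁾`, resp. `c⁽ʲ⁾`), and `k = 0, …, N - 1` numbers the site (so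
sites are counted from `0`). In the open-end case the `j`-th field has only `N - j` variables. -/
abbrev Label (bc : Boundary) (m N : ℕ) : Type :=
  {p : Fin (m + 1) × Fin N // bc = Boundary.openEnd → (p.2 : ℕ) + (p.1 : ℕ) < N}

/-- The index `j` of the field. -/
def Label.fieldNo {bc : Boundary} {m N : ℕ} (p : Label bc m N) : ℕ := (p.1.1 : ℕ)

/-- The site `k`. -/
def Label.site {bc : Boundary} {m N : ℕ} (p : Label bc m N) : ℤ := ((p.1.2 : ℕ) : ℤ)

/-- The phase space; in the periodic case it is `ℝ^((m+1)N)`. -/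
abbrev Phase (bc : Boundary) (m N : ℕ) : Type := Label bc m N → ℝ

/-- `fld x j k` is the value of the `j`-th field at the site `k ∈ ℤ`: subscripts are taken mod `N`
in the periodic case; fields with `j > m`, and in the open-end case the variables outside of the
admissible range, are zero. (At most one summand is non-zero.) -/
def fld {bc : Boundary} {m N : ℕ} (x : Phase bc m N) (j : ℕ) (k : ℤ) : ℝ :=
  ∑ p : Label bc m N, if p.fieldNo = j ∧ SameSite bc N k p.site then x p else 0

/-! ## Poisson brackets on the phase space -/

/-- A bracket, given by the matrix of the brackets of the coordinate functions. -/
abbrev Bivector (bc : Boundary) (m N : ℕ) : Type :=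
  Phase bc m N → Label bc m N → Label bc m N → ℝ

/-- The bracket `{F, G}` of two functions. -/
def pb {bc : Boundary} {m N : ℕ} (P : Bivector bc m N) (F G : Phase bc m N → ℝ)
    (x : Phase bc m N) : ℝ :=
  ∑ p : Label bc m N, ∑ q : Label bc m N,
    P x p q * fderiv ℝ F x (Pi.single p 1) * fderiv ℝ G x (Pi.single q 1)

/-- `P` defines a Poisson bracket on the smooth functions on the phase space (the Leibniz rule holds
by the definition of `pb`). -/
structure IsPoisson {bc : Boundary} {m N : ℕ} (P : Bivector bc m N) : Prop where
  smooth : ∀ p q, ContDiff ℝ ∞ fun x => P x p q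
  skew : ∀ F G : Phase bc m N → ℝ, ContDiff ℝ ∞ F → ContDiff ℝ ∞ G →
    ∀ x, pb P F G x = -pb P G F x
  jacobi : ∀ F G H : Phase bc m N → ℝ, ContDiff ℝ ∞ F → ContDiff ℝ ∞ G → ContDiff ℝ ∞ H →
    ∀ x, pb P F (pb P G H) x + pb P G (pb P H F) x + pb P H (pb P F G) x = 0

/-- Two Poisson brackets are compatible: all their linear combinations are Poisson brackets. -/
def ArePoissonCompatible {bc : Boundary} {m N : ℕ} (P Q : Bivector bc m N) : Prop :=
  IsPoisson P ∧ IsPoisson Q ∧ ∀ s t : ℝ, IsPoisson (s • P + t • Q)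

/-- The Hamiltonian vector field `ẋ = {H, x}`. -/
def hamField {bc : Boundary} {m N : ℕ} (P : Bivector bc m N) (H : Phase bc m N → ℝ)
    (x : Phase bc m N) : Phase bc m N :=
  fun p => pb P H (fun y => y p) x

/-- The bracket whose coordinate brackets are given polynomials in the phase variables. -/
def polyBivector {bc : Boundary} {m N : ℕ}
    (Q : Label bc m N → Label bc m N → MvPolynomial (Label bc m N) ℝ) : Bivector bc m N :=
  fun x p q => MvPolynomial.eval x (Q p q)

/-- Brackets are written down by listing, for a left field `i` at the site `k` and a right field `j`
at the site `k + ℓ` (`ℓ ≥ 0`), the right-hand side `h i j k ℓ` of `{·⁽ⁱ⁾_k, ·⁽ʲ⁾_{k+ℓ}}`; the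
remaining brackets follow by skew-symmetry. If several `ℓ` lead to the same pair of variables (which
happens for short periodic lattices only) the contributions add up. -/
def bivectorOfList {bc : Boundary} {m N : ℕ}
    (h : Phase bc m N → ℕ → ℕ → ℤ → ℕ → ℝ) : Bivector bc m N :=
  fun x p q => ∑ ℓ ∈ Finset.range (m + 2),
    ((if SameSite bc N (p.site + ℓ) q.site then h x p.fieldNo q.fieldNo p.site ℓ else 0) -
      (if SameSite bc N (q.site + ℓ) p.site then h x q.fieldNo p.fieldNo q.site ℓ else 0))

/-- The linear bracket `{·,·}₁` of the hierarchy `RTL⁽⁻⁾_{m+1}(α)`. With `a⁽⁰⁾ = b`, and `a⁽ⁱ⁾ = 0`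
for `i > m`, it is given by `{a⁽ⁱ⁾_k, a⁽ʲ⁾_{k+i}} = -a⁽ⁱ⁺ʲ⁾_k` (for `(i, j) ≠ (0, 0)`; for
`i = j = 0` the entry cancels by skew-symmetry) and
`{a⁽ⁱ⁾_k, a⁽ʲ⁾_{k+i+1}} = α a⁽ⁱ⁺ʲ⁺¹⁾_k`. -/
def linearBracket (bc : Boundary) (m N : ℕ) (α : ℝ) : Bivector bc m N :=
  bivectorOfList fun x i j k ℓ =>
    (if ℓ = i then -fld x (i + j) k else 0) +
      (if ℓ = i + 1 then α * fld x (i + j + 1) k else 0)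

/-- The quadratic bracket `{·,·}_{2α}` of the hierarchy `RTL⁽⁺⁾_{m+1}(α)`:
`{d_k, c⁽ʲ⁾_k} = -c⁽ʲ⁾_k (1 + α d_k)`, `{c⁽ⁱ⁾_k, d_{k+i}} = -c⁽ⁱ⁾_k (1 + α d_{k+i})`,
`{c⁽ⁱ⁾_k, c⁽ʲ⁾_{k+i}} = -c⁽ⁱ⁺ʲ⁾_k - α c⁽ⁱ⁾_k c⁽ʲ⁾_{k+i}`, and
`{c⁽ⁱ⁾_k, c⁽ʲ⁾_{k+ℓ}} = -α c⁽ⁱ⁾_k c⁽ʲ⁾_{k+ℓ} + α c⁽ʲ⁺ˡ⁾_k c⁽ⁱ⁻ˡ⁾_{k+ℓ}` for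
`max(1, i - j + 1) ≤ ℓ ≤ i - 1`. -/
def quadraticBracket (bc : Boundary) (m N : ℕ) (α : ℝ) : Bivector bc m N :=
  bivectorOfList fun x i j k ℓ =>
    if i = 0 ∧ j = 0 then 0
    else if i = 0 then
      (if ℓ = 0 then -(fld x j k * (1 + α * fld x 0 k)) else 0)
    else if j = 0 then
      (if ℓ = i then -(fld x i k * (1 + α * fld x 0 (k + i))) else 0)
    else if ℓ = i then
      -fld x (i + j) k - α * (fld x i k * fld x j (k + i))
    else if 1 ≤ ℓ ∧ ℓ < i ∧ i < ℓ + j then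
      -(α * (fld x i k * fld x j (k + ℓ))) + α * (fld x (j + ℓ) k * fld x (i - ℓ) (k + ℓ))
    else 0

/-! ## The change of variables -/

/-- The map `B(α)`: `d_k = b_k / (1 - α b_k)`,
`c⁽ʲ⁾_k = a⁽ʲ⁾_k / ∏_{i=0}^{j} (1 - α b_{k+i})`. -/
def changeVars {bc : Boundary} {m N : ℕ} (α : ℝ) (x : Phase bc m N) : Phase bc m N :=
  fun p => x p / ∏ i ∈ Finset.range (p.fieldNo + 1), (1 - α * fld x 0 (p.site + i))

/-- The domain `1 - α b_k ≠ 0` (all `k`) of `B(α)`. -/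
def domMinus (bc : Boundary) (m N : ℕ) (α : ℝ) : Set (Phase bc m N) :=
  {x | ∀ k : Fin N, 1 - α * fld x 0 (k : ℕ) ≠ 0}

/-- The image `1 + α d_k ≠ 0` (all `k`) of `B(α)`. -/
def domPlus (bc : Boundary) (m N : ℕ) (α : ℝ) : Set (Phase bc m N) :=
  {y | ∀ k : Fin N, 1 + α * fld y 0 (k : ℕ) ≠ 0}

/-- `B(α)` is a diffeomorphism from `domMinus` onto `domPlus` with the inverse `B(-α)`. -/
structure IsChangeOfVariables (bc : Boundary) (m N : ℕ) (α : ℝ) : Prop where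
  mapsTo : Set.MapsTo (changeVars α) (domMinus bc m N α) (domPlus bc m N α)
  mapsTo_symm : Set.MapsTo (changeVars (-α)) (domPlus bc m N α) (domMinus bc m N α)
  invOn : Set.InvOn (changeVars (-α)) (changeVars α) (domMinus bc m N α) (domPlus bc m N α)
  smooth : ContDiffOn ℝ ∞ (changeVars α) (domMinus bc m N α)
  smooth_symm : ContDiffOn ℝ ∞ (changeVars (-α)) (domPlus bc m N α)

/-- The bracket `Q` (on `domPlus`) is the push-forward of the bracket `P` (on `domMinus`) under
`B(α)`. -/
def IsPushForward {bc : Boundary} {m N : ℕ} (α : ℝ) (P Q : Bivector bc m N) : Prop :=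
  ∀ F G : Phase bc m N → ℝ, ContDiffOn ℝ ∞ F (domPlus bc m N α) →
    ContDiffOn ℝ ∞ G (domPlus bc m N α) → ∀ x ∈ domMinus bc m N α,
      pb Q F G (changeVars α x) = pb P (F ∘ changeVars α) (G ∘ changeVars α) x

/-! ## The hierarchy `RTL⁽⁺⁾_{m+1}(α)` -/

/-- The point of the `λ`-sphere at which formal Laurent series are expanded. -/
inductive Expansion where
  | atInfinity
  | atZero

/-- Exponents of `λ` versus exponents of the local parameter (`λ⁻¹` at infinity, `λ` at zero). -/
def Expansion.sign : Expansion → ℤ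
  | .atInfinity => -1
  | .atZero => 1

/-- `c λᵖ` as a formal Laurent series in the local parameter. -/
def lamMono (e : Expansion) (p : ℤ) (c : ℝ) : LaurentSeries ℝ :=
  HahnSeries.single (e.sign * p) c

/-- The coefficient of `λᵖ`. -/
def lamCoeff (e : Expansion) (f : LaurentSeries ℝ) (p : ℤ) : ℝ := f.coeff (e.sign * p)

/-- The part of a series with non-negative powers of `λ`. -/
def lamNonneg (e : Expansion) (f : LaurentSeries ℝ) : LaurentSeries ℝ where
  coeff n := if 0 ≤ e.sign * n then f.coeff n else 0
  isPWO_support' := f.isPWO_support.mono fun n hn => by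
    by_contra h
    have h0 : f.coeff n = 0 := by simpa [HahnSeries.mem_support] using h
    exact hn (by simp [h0])

/-- Matrices depending on the spectral parameter. In the open-end case `gl(N)` is identified with the
matrices whose `(r, c)` entry is a multiple of `λ^(r-c)`; this turns the grading by `r - c` into
the grading by powers of `λ`, which is the one used in the periodic case. -/
abbrev LaxMatrix (N : ℕ) : Type := Matrix (Fin N) (Fin N) (LaurentSeries ℝ)

/-- The projection `π₊` onto the non-negative powers of `λ`. -/
def piPlus {N : ℕ} (e : Expansion) (X : LaxMatrix N) : LaxMatrix N := X.map (lamNonneg e)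

/-- `L = ∑ (1 + α d_k) E_{kk} + α λ ∑ E_{k+1,k}`. -/
def laxL {bc : Boundary} {m N : ℕ} (e : Expansion) (α : ℝ) (y : Phase bc m N) : LaxMatrix N :=
  fun r c =>
    (if r = c then lamMono e 0 (1 + α * fld y 0 (r : ℕ)) else 0) +
      (if SameSite bc N ((c : ℕ) + 1) (r : ℕ) then lamMono e 1 α else 0)

/-- `U = I - α ∑_{j=1}^{m} λ^{-j} ∑ c⁽ʲ⁾_k E_{k,k+j}`. -/
def laxU {bc : Boundary} {m N : ℕ} (e : Expansion) (α : ℝ) (y : Phase bc m N) : LaxMatrix N :=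
  fun r c =>
    (if r = c then 1 else 0) -
      ∑ j ∈ Finset.Icc 1 m,
        if SameSite bc N ((r : ℕ) + j) (c : ℕ) then lamMono e (-j) (α * fld y j (r : ℕ)) else 0

/-- `T₁ = L U⁻¹`. -/
def laxT₁ {bc : Boundary} {m N : ℕ} (e : Expansion) (α : ℝ) (y : Phase bc m N) : LaxMatrix N :=
  laxL e α y * (laxU e α y)⁻¹

/-- `T₂ = U⁻¹ L`. -/
def laxT₂ {bc : Boundary} {m N : ℕ} (e : Expansion) (α : ℝ) (y : Phase bc m N) : LaxMatrix N :=
  (laxU e α y)⁻¹ * laxL e α y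

/-- The basic Ad-covariant functions: `f(T) = (λᴺ / δᴺ)^q Tⁿ`, with series in `λ⁻¹`, and
`f(T) = (λᴺ / δᴺ)^q T⁻ⁿ`, with series in `λ`. Here `δᴺ = ∏ (1 + α d_k)` is the spectral
invariant which normalizes the spectral parameter. -/
def covFun {bc : Boundary} {m N : ℕ} (e : Expansion) (α : ℝ) (n : ℕ) (q : ℤ)
    (y : Phase bc m N) (T : LaxMatrix N) : LaxMatrix N :=
  lamMono e (N * q) ((∏ k : Fin N, (1 + α * fld y 0 (k : ℕ))) ^ (-q)) •
    (match e with
      | .atInfinity => T ^ n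
      | .atZero => T⁻¹ ^ n)

/-- `W` is the derivative of the matrix function `M` at `y` along the vector `v`, coefficient by
coefficient. -/
def HasMatrixDeriv {bc : Boundary} {m N : ℕ} (e : Expansion) (M : Phase bc m N → LaxMatrix N)
    (y v : Phase bc m N) (W : LaxMatrix N) : Prop :=
  ∀ (r c : Fin N) (p : ℤ),
    HasDerivAt (fun t : ℝ => lamCoeff e (M (y + t • v) r c) p) (lamCoeff e (W r c) p) 0

/-- The velocity `v` at the point `y` satisfies the Lax triads `L̇ = L B₂ - B₁ L`,
`U̇ = U B₂ - B₁ U` with `B_i = π₊(f(T_i))`, where `f` is the function `covFun e α n q`. -/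
def SatisfiesLaxTriads {bc : Boundary} {m N : ℕ} (e : Expansion) (α : ℝ) (n : ℕ) (q : ℤ)
    (y v : Phase bc m N) : Prop :=
  let L := laxL e α y
  let U := laxU e α y
  let B₁ := piPlus e (covFun e α n q y (laxT₁ e α y))
  let B₂ := piPlus e (covFun e α n q y (laxT₂ e α y))
  HasMatrixDeriv e (laxL e α) y v (L * B₂ - B₁ * L) ∧
    HasMatrixDeriv e (laxU e α) y v (U * B₂ - B₁ * U)

/-- The simplest (first) flow, the system `RTL⁽⁺⁾_{m+1}(α)` itself. -/
def rtlPlusField {bc : Boundary} {m N : ℕ} (α : ℝ) (y : Phase bc m N) : Phase bc m N :=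
  fun p =>
    let j := p.fieldNo
    let k := p.site
    if j = 0 then
      (1 + α * fld y 0 k) * (fld y 1 k - fld y 1 (k - 1))
    else
      fld y j k * (fld y 0 (k + j) - fld y 0 k + α * fld y 1 (k + j) - α * fld y 1 (k - 1)) +
        (fld y (j + 1) k - fld y (j + 1) (k - 1))

/-- The bracket `P` is invariant for `RTL⁽⁺⁾_{m+1}(α)`: the system itself and all flows of its
hierarchy are Hamiltonian with respect to `P` (where `1 + α d_k ≠ 0` for all `k`). Multiplication by
powers of `λᴺ` is available in the periodic case only. -/
def IsInvariantBracket {bc : Boundary} {m N : ℕ} (α : ℝ) (P : Bivector bc m N) : Prop :=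
  (∃ H : Phase bc m N → ℝ, ContDiffOn ℝ ∞ H (domPlus bc m N α) ∧
    ∀ y ∈ domPlus bc m N α, hamField P H y = rtlPlusField α y) ∧
  ∀ (e : Expansion) (n : ℕ) (q : ℤ), (bc = Boundary.openEnd → q = 0) →
    ∃ H : Phase bc m N → ℝ, ContDiffOn ℝ ∞ H (domPlus bc m N α) ∧
      ∀ y ∈ domPlus bc m N α, SatisfiesLaxTriads e α n q y (hamField P H y)

end

/-!
The idea of the proof is to work in a polynomial moving frame. At the image of a point, the Jacobi
matrix of `B(α)` is the product of the matrix `frame`, which is polynomial in the new variables, and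
of a diagonal matrix of products of factors `1 + α d_k` (`siteProd`). The diagonal matrix turns the
linear bracket into a polynomial matrix (`cubicList_changeVars`), so that the push-forward
`cubicBracket` is polynomial as well (`isPushForward_cubicBracket`, `polyDegLE_cubicBracket`).

**Poisson property and compatibility.** The entries of an infinite matrix carry a quadratic bracket
(`entryBracket`) whose Jacobi identity follows from the Yang–Baxter equation for the sign function
(`nestedEntryBracket_cyclic`). Matrices with one subdiagonal and finitely many superdiagonals form a
Poisson submanifold, on which the subdiagonal entries are Casimir functions; summation over the
shifts of the lattice yields brackets on the phase space (`isPoisson_bandBivector`). For the matrix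
`s U + t L` this bracket consists of `s²` times the bracket of the entries of `U`, which gives the
quadratic bracket (`quadraticBracket_eq_frameBivector`), and of `s t α` times the matrix of the
cubic bracket, both with respect to the moving frame (`bandBivector_bandPlus`). Rescaling by
`siteProd` is conjugation of `s U + t L` by a diagonal matrix and leads to a matrix with affine
entries in the old variables. For `s ≠ 0` the bracket `s {·,·}_{2α} + t {·,·}_{3α}` is therefore the
push-forward of a Poisson bracket (`isPushForward_pencil`). Its Jacobi identity extends from the
dense set where `B(-α)` is defined to the whole phase space (`isPoisson_of_pushForward`), and then to
`s = 0`, since it is polynomial in `s` (`arePoissonCompatible_of_ne_zero`).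

**Invariance.** If the derivatives of a function along the moving frame are the entries, on and below
the diagonal, of a matrix `X` with `L X U = U X L`, then its Hamiltonian vector field satisfies the
Lax triads with `B₁ = π₊(L X)` and `B₂ = π₊(X L)` (`satisfiesLaxTriads_of_fderiv`). Along the moving
frame, and up to a twist which has no effect on residues of traces, `L` and `U` change by `L E` and
`U E - Λ` with a diagonal matrix `E` and one matrix unit `Λ` (`labelDeriv_smoothL`,
`labelDeriv_smoothU`), so that the derivatives of spectral invariants are entries of matrices `X` of
this kind. With `μ = λᴺ / ∏ (1 + α d_k)`, the Hamiltonian functions are, up to constant factors,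
* the residues of the traces of `μ^q (U L⁻¹)ⁿ⁺¹` for `f(T) = μ^q T⁻ⁿ`,
* the residues of the traces of `μ^q (L U⁻¹)ⁿ⁻¹` for `f(T) = μ^q Tⁿ` with `n ≥ 2`,
* for `n = 1`, the logarithmic residue of `U` with the weight `μ^q` if `q ≠ 0`, and the logarithm of
  `∏ |1 + α d_k|` if `q = 0`; the latter also generates the system `RTL⁽⁺⁾_{m+1}(α)` itself,
* zero for `f(T) = μ^q`, where the flow is trivial.
-/

open scoped ContDiff

noncomputable section

open scoped Classical

/-! ### Sites, labels and fields -/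

section Sites

variable {bc : Boundary} {m N : ℕ}

theorem sameSite_iff_sub {k l : ℤ} : SameSite bc N k l ↔ SameSite bc N (k - l) 0 := by
  cases bc
  · simp only [SameSite]
    rw [Int.modEq_comm, Int.modEq_iff_dvd, Int.modEq_comm, Int.modEq_iff_dvd, sub_zero]
  · simp only [SameSite]; omega

@[simp] theorem sameSite_refl (k : ℤ) : SameSite bc N k k := by
  cases bc
  · exact Int.ModEq.refl _
  · exact rfl

theorem SameSite.symm {k l : ℤ} (h : SameSite bc N k l) : SameSite bc N l k := by
  cases bc
  · exact Int.ModEq.symm h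
  · exact Eq.symm h

theorem sameSite_comm {k l : ℤ} : SameSite bc N k l ↔ SameSite bc N l k :=
  ⟨SameSite.symm, SameSite.symm⟩

theorem SameSite.trans {k l n : ℤ} (h : SameSite bc N k l) (h' : SameSite bc N l n) :
    SameSite bc N k n := by
  cases bc
  · exact Int.ModEq.trans h h'
  · exact Eq.trans h h'

/-- Only the difference of two sites matters. -/
theorem sameSite_congr_sub {k l k' l' : ℤ} (h : k - l = k' - l') :
    SameSite bc N k l ↔ SameSite bc N k' l' := by
  rw [sameSite_iff_sub, h, ← sameSite_iff_sub]

theorem SameSite.add_right {k l : ℤ} (h : SameSite bc N k l) (n : ℤ) :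
    SameSite bc N (k + n) (l + n) :=
  (sameSite_congr_sub (by ring)).1 h

theorem sameSite_left_congr {k l n : ℤ} (h : SameSite bc N k l) :
    SameSite bc N k n ↔ SameSite bc N l n :=
  ⟨fun h' => h.symm.trans h', fun h' => h.trans h'⟩

theorem sameSite_right_congr {k l n : ℤ} (h : SameSite bc N k l) :
    SameSite bc N n k ↔ SameSite bc N n l :=
  ⟨fun h' => h'.trans h, fun h' => h'.trans h.symm⟩

theorem sameSite_natCast_iff {r c : Fin N} :
    SameSite bc N ((r : ℕ) : ℤ) ((c : ℕ) : ℤ) ↔ r = c := by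
  constructor
  · intro h
    cases bc
    · have h1 : ((r : ℕ) : ℤ) % N = ((c : ℕ) : ℤ) % N := h
      have hr := r.isLt
      have hc := c.isLt
      rw [Int.emod_eq_of_lt (by omega) (by omega), Int.emod_eq_of_lt (by omega) (by omega)] at h1
      ext; omega
    · have h1 : ((r : ℕ) : ℤ) = ((c : ℕ) : ℤ) := h
      ext; omega
  · rintro rfl; exact sameSite_refl _

/-- `k` denotes a site of the lattice. -/
def IsSite (bc : Boundary) (N : ℕ) (k : ℤ) : Prop := ∃ r : Fin N, SameSite bc N k (r : ℕ)

theorem isSite_congr {k l : ℤ} (h : SameSite bc N k l) : IsSite bc N k ↔ IsSite bc N l :=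
  exists_congr fun _ => sameSite_left_congr h

theorem isSite_fin (r : Fin N) : IsSite bc N (r : ℕ) := ⟨r, sameSite_refl _⟩

theorem isSite_periodic (hN : 0 < N) (k : ℤ) : IsSite .periodic N k := by
  have h0 : (0 : ℤ) < N := by exact_mod_cast hN
  have h1 := Int.emod_nonneg k h0.ne'
  have h2 := Int.emod_lt_of_pos k h0
  refine ⟨⟨(k % N).toNat, by omega⟩, ?_⟩
  change k ≡ (((k % N).toNat : ℕ) : ℤ) [ZMOD N]
  rw [Int.toNat_of_nonneg h1]
  exact (Int.mod_modEq k N).symm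

theorem isSite_openEnd {k : ℤ} : IsSite .openEnd N k ↔ 0 ≤ k ∧ k < N := by
  constructor
  · rintro ⟨r, hr⟩
    have h : k = ((r : ℕ) : ℤ) := hr
    have := r.isLt
    omega
  · rintro ⟨h0, h1⟩
    exact ⟨⟨k.toNat, by omega⟩, by change k = _; simp [h0]⟩

/-- There is a variable of the `j`-th field at the site `k`. -/
def HasLabel (bc : Boundary) (m N : ℕ) (j : ℕ) (k : ℤ) : Prop :=
  ∃ p : Label bc m N, p.fieldNo = j ∧ SameSite bc N k p.site

theorem Label.ext_of_sameSite {p q : Label bc m N} (hj : p.fieldNo = q.fieldNo)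
    (hk : SameSite bc N p.site q.site) : p = q := by
  have h1 := sameSite_natCast_iff.1 hk
  exact Subtype.ext (Prod.ext (Fin.ext hj) h1)

theorem Label.fieldNo_le (p : Label bc m N) : p.fieldNo ≤ m := Nat.lt_succ_iff.1 p.1.1.isLt

theorem Label.isSite_site (p : Label bc m N) : IsSite bc N p.site := isSite_fin p.1.2

theorem Label.isSite_site_add (p : Label bc m N) : IsSite bc N (p.site + p.fieldNo) := by
  cases bc
  · exact isSite_periodic (Nat.lt_of_le_of_lt (Nat.zero_le _) p.1.2.isLt) _
  · have h := p.2 rfl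
    rw [isSite_openEnd]
    simp only [Label.site, Label.fieldNo]
    omega

/-- In both cases a variable of the `j`-th field at `k` is given by an interval `[k, k + j]` the
end points of which are sites. -/
theorem hasLabel_iff {j : ℕ} {k : ℤ} :
    HasLabel bc m N j k ↔ j ≤ m ∧ IsSite bc N k ∧ IsSite bc N (k + j) := by
  constructor
  · rintro ⟨p, rfl, hk⟩
    exact ⟨p.fieldNo_le, (isSite_congr hk).2 p.isSite_site,
      (isSite_congr (hk.add_right _)).2 p.isSite_site_add⟩
  · rintro ⟨hj, ⟨r, hr⟩, hk⟩
    refine ⟨⟨(⟨j, Nat.lt_succ_of_le hj⟩, r), ?_⟩, rfl, hr⟩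
    rintro rfl
    have h : k = ((r : ℕ) : ℤ) := hr
    have := (isSite_openEnd.1 hk).2
    change (r : ℕ) + j < N
    omega

/-- The sum over all variables which represent the `j`-th field at the site `k` has at most one
non-zero summand. -/
theorem sum_label_ite {A : Type*} [AddCommMonoid A] (j : ℕ) (k : ℤ) (f : Label bc m N → A)
    (p : Label bc m N) (hj : p.fieldNo = j) (hk : SameSite bc N k p.site) :
    (∑ q : Label bc m N, if q.fieldNo = j ∧ SameSite bc N k q.site then f q else 0) = f p := by
  rw [Finset.sum_eq_single p]
  · rw [if_pos ⟨hj, hk⟩]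
  · intro q _ hq
    rw [if_neg]
    rintro ⟨h1, h2⟩
    exact hq (Label.ext_of_sameSite (h1.trans hj.symm) (h2.symm.trans hk))
  · exact fun h => absurd (Finset.mem_univ _) h

theorem sum_label_ite_of_not {A : Type*} [AddCommMonoid A] {j : ℕ} {k : ℤ}
    (f : Label bc m N → A) (h : ¬HasLabel bc m N j k) :
    (∑ q : Label bc m N, if q.fieldNo = j ∧ SameSite bc N k q.site then f q else 0) = 0 :=
  Finset.sum_eq_zero fun q _ => if_neg fun hq => h ⟨q, hq⟩

theorem fld_eq (x : Phase bc m N) {j : ℕ} {k : ℤ} (p : Label bc m N) (hj : p.fieldNo = j)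
    (hk : SameSite bc N k p.site) : fld x j k = x p :=
  sum_label_ite j k x p hj hk

theorem fld_label (x : Phase bc m N) (p : Label bc m N) : fld x p.fieldNo p.site = x p :=
  fld_eq x p rfl (sameSite_refl _)

theorem fld_of_not (x : Phase bc m N) {j : ℕ} {k : ℤ} (h : ¬HasLabel bc m N j k) :
    fld x j k = 0 :=
  sum_label_ite_of_not x h

theorem fld_of_lt (x : Phase bc m N) {j : ℕ} (k : ℤ) (h : m < j) : fld x j k = 0 :=
  fld_of_not x fun h' => absurd (hasLabel_iff.1 h').1 (by omega)

theorem fld_congr (x : Phase bc m N) (j : ℕ) {k l : ℤ} (h : SameSite bc N k l) :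
    fld x j k = fld x j l := by
  unfold fld
  simp only [sameSite_left_congr h]

theorem fld_add (x y : Phase bc m N) (j : ℕ) (k : ℤ) :
    fld (x + y) j k = fld x j k + fld y j k := by
  unfold fld
  rw [← Finset.sum_add_distrib]
  exact Finset.sum_congr rfl fun p _ => by split_ifs <;> simp

theorem fld_smul (t : ℝ) (x : Phase bc m N) (j : ℕ) (k : ℤ) :
    fld (t • x) j k = t * fld x j k := by
  unfold fld
  rw [Finset.mul_sum]
  exact Finset.sum_congr rfl fun p _ => by split_ifs <;> simp

/-- The value of a field as a continuous linear functional on the phase space. -/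
def fldL (bc : Boundary) (m N : ℕ) (j : ℕ) (k : ℤ) : Phase bc m N →L[ℝ] ℝ :=
  LinearMap.toContinuousLinearMap
    { toFun := fun x => fld x j k
      map_add' := fun x y => fld_add x y j k
      map_smul' := fun t x => fld_smul t x j k }

@[simp] theorem fldL_apply (j : ℕ) (k : ℤ) (x : Phase bc m N) : fldL bc m N j k x = fld x j k :=
  rfl

theorem hasFDerivAt_fld (j : ℕ) (k : ℤ) (x : Phase bc m N) :
    HasFDerivAt (fun y : Phase bc m N => fld y j k) (fldL bc m N j k) x :=
  (fldL bc m N j k).hasFDerivAt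

@[fun_prop]
theorem contDiff_fld (j : ℕ) (k : ℤ) : ContDiff ℝ ∞ fun y : Phase bc m N => fld y j k :=
  (fldL bc m N j k).contDiff

theorem fld_single (r : Label bc m N) (j : ℕ) (k : ℤ) :
    fld (Pi.single r 1 : Phase bc m N) j k =
      if r.fieldNo = j ∧ SameSite bc N k r.site then 1 else 0 := by
  unfold fld
  rw [Finset.sum_eq_single r]
  · simp
  · intro q _ hq; simp [Pi.single_eq_of_ne hq]
  · simp

/-- A sum over all variables, sorted by fields: `F` depends on the site only. -/
theorem sum_label_eq {A : Type*} [AddCommMonoid A] (F : Label bc m N → A) :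
    ∑ p : Label bc m N, F p =
      ∑ i ∈ Finset.range (m + 1), ∑ p : Label bc m N, if p.fieldNo = i then F p else 0 := by
  rw [Finset.sum_comm]
  refine Finset.sum_congr rfl fun p _ => ?_
  rw [Finset.sum_ite_eq, if_pos (Finset.mem_range.2 (Nat.lt_succ_of_le p.fieldNo_le))]

end Sites

/-! ### The change of variables and its Jacobi matrix -/

section ChangeOfVariables

variable {bc : Boundary} {m N : ℕ} {α : ℝ}

theorem mem_domMinus_iff {x : Phase bc m N} :
    x ∈ domMinus bc m N α ↔ ∀ k : ℤ, 1 - α * fld x 0 k ≠ 0 := by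
  refine ⟨fun h k => ?_, fun h k => h _⟩
  by_cases hk : IsSite bc N k
  · obtain ⟨r, hr⟩ := hk
    rw [fld_congr x 0 hr]
    exact h r
  · rw [fld_of_not x fun h' => hk (hasLabel_iff.1 h').2.1]
    simp

theorem domPlus_eq : domPlus bc m N α = domMinus bc m N (-α) := by
  ext y; simp [domPlus, domMinus]

theorem domMinus_eq : domMinus bc m N α = domPlus bc m N (-α) := by
  rw [domPlus_eq, neg_neg]

theorem mem_domPlus_iff {y : Phase bc m N} :
    y ∈ domPlus bc m N α ↔ ∀ k : ℤ, 1 + α * fld y 0 k ≠ 0 := by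
  rw [domPlus_eq, mem_domMinus_iff]; simp

theorem isOpen_domMinus : IsOpen (domMinus bc m N α) := by
  have : domMinus bc m N α = ⋂ k : Fin N, {x | 1 - α * fld x 0 (k : ℕ) ≠ 0} := by
    ext x; simp [domMinus]
  rw [this]
  refine isOpen_iInter_of_finite fun k => ?_
  have hc : Continuous fun x : Phase bc m N => 1 - α * fld x 0 (k : ℕ) :=
    continuous_const.sub (continuous_const.mul (contDiff_fld 0 _).continuous)
  exact isOpen_ne_fun hc continuous_const

theorem isOpen_domPlus : IsOpen (domPlus bc m N α) := by
  rw [domPlus_eq]; exact isOpen_domMinus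

/-- The formula for the change of variables holds at all integers `k`, in the open-end case also
outside of the lattice, where both sides vanish. -/
theorem fld_changeVars (x : Phase bc m N) (j : ℕ) (k : ℤ) :
    fld (changeVars α x) j k =
      fld x j k / ∏ i ∈ Finset.range (j + 1), (1 - α * fld x 0 (k + i)) := by
  by_cases h : HasLabel bc m N j k
  · obtain ⟨p, rfl, hk⟩ := h
    rw [fld_eq _ p rfl hk, fld_eq x p rfl hk, changeVars]
    congr 1
    exact Finset.prod_congr rfl fun i _ => by rw [fld_congr x 0 (hk.add_right i)]
  · rw [fld_of_not _ h, fld_of_not _ h, zero_div]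

theorem one_add_fld_changeVars {x : Phase bc m N} (hx : x ∈ domMinus bc m N α) (k : ℤ) :
    1 + α * fld (changeVars α x) 0 k = (1 - α * fld x 0 k)⁻¹ := by
  have h := mem_domMinus_iff.1 hx k
  rw [fld_changeVars]
  simp only [zero_add, Finset.range_one, Finset.prod_singleton, Nat.cast_zero, add_zero]
  field_simp
  ring

theorem mapsTo_changeVars :
    Set.MapsTo (changeVars α) (domMinus bc m N α) (domPlus bc m N α) := by
  intro x hx
  rw [mem_domPlus_iff]
  intro k
  rw [one_add_fld_changeVars hx]
  exact inv_ne_zero (mem_domMinus_iff.1 hx k)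

theorem leftInvOn_changeVars :
    Set.LeftInvOn (changeVars (-α)) (changeVars α) (domMinus bc m N α) := by
  intro x hx
  funext p
  have h : ∀ k, 1 - -α * fld (changeVars α x) 0 k = (1 - α * fld x 0 k)⁻¹ := fun k => by
    rw [← one_add_fld_changeVars hx]; ring
  change changeVars α x p / _ = x p
  simp only [h, Finset.prod_inv_distrib]
  rw [changeVars, div_inv_eq_mul, div_mul_cancel₀]
  exact Finset.prod_ne_zero_iff.2 fun i _ => mem_domMinus_iff.1 hx _

theorem contDiffOn_changeVars : ContDiffOn ℝ ∞ (changeVars α) (domMinus bc m N α) := by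
  rw [contDiffOn_pi]
  intro p
  refine ContDiffOn.div (contDiff_apply ℝ ℝ p).contDiffOn ?_ fun x hx =>
    Finset.prod_ne_zero_iff.2 fun i _ => mem_domMinus_iff.1 hx _
  exact (contDiff_prod fun i _ => contDiff_const.sub
    (contDiff_const.mul (contDiff_fld 0 _))).contDiffOn

theorem isChangeOfVariables : IsChangeOfVariables bc m N α where
  mapsTo := mapsTo_changeVars
  mapsTo_symm := by
    have h := mapsTo_changeVars (bc := bc) (m := m) (N := N) (α := -α)
    rwa [← domPlus_eq, ← domMinus_eq] at h
  invOn := by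
    refine ⟨leftInvOn_changeVars, ?_⟩
    have h := leftInvOn_changeVars (bc := bc) (m := m) (N := N) (α := -α)
    rw [neg_neg] at h
    rw [domPlus_eq]; exact h
  smooth := contDiffOn_changeVars
  smooth_symm := by rw [domPlus_eq]; exact contDiffOn_changeVars

/-- The product of the factors `1 + α d_k` over the sites `k, …, k + j` of a variable of the `j`-th
field. -/
def siteProd (α : ℝ) (y : Phase bc m N) (p : Label bc m N) : ℝ :=
  ∏ i ∈ Finset.range (p.fieldNo + 1), (1 + α * fld y 0 (p.site + i))

/-- The moving frame of the phase space: the matrix whose columns are the vectors which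
the Jacobi matrix of the change of variables produces from the coordinate vectors divided by
`siteProd`. Unlike the Jacobi matrix it is polynomial in the new variables. The sum counts how often
a site is among the sites of the variable `p`. -/
def frame (α : ℝ) (y : Phase bc m N) (p r : Label bc m N) : ℝ :=
  (if p = r then 1 else 0) + α * y p *
    ∑ i ∈ Finset.range (p.fieldNo + 1),
      if r.fieldNo = 0 ∧ SameSite bc N (p.site + i) r.site then 1 else 0

/-- The vector with the components `u` in the moving frame. -/
theorem sum_frame_mul (y u : Phase bc m N) (p : Label bc m N) :
    ∑ r, frame α y p r * u r =
      u p + α * y p * ∑ i ∈ Finset.range (p.fieldNo + 1), fld u 0 (p.site + i) := by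
  simp only [frame, add_mul, Finset.sum_add_distrib, ite_mul, one_mul, zero_mul,
    Finset.sum_ite_eq, Finset.mem_univ, if_true]
  congr 1
  simp only [mul_assoc, ← Finset.mul_sum, Finset.sum_mul]
  rw [Finset.sum_comm]
  simp [fld]

theorem fld_siteProd_mul (y u : Phase bc m N) (k : ℤ) :
    fld (fun r => siteProd α y r * u r) 0 k = (1 + α * fld y 0 k) * fld u 0 k := by
  by_cases h : HasLabel bc m N 0 k
  · obtain ⟨p, hj, hk⟩ := h
    rw [fld_eq _ p hj hk, fld_eq u p hj hk, siteProd, hj]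
    simp [fld_congr y 0 hk]
  · rw [fld_of_not u h, fld_of_not _ h, mul_zero]

/-- The derivative of the change of variables. -/
def changeVarsDeriv (α : ℝ) (y : Phase bc m N) : Phase bc m N →L[ℝ] Phase bc m N :=
  LinearMap.toContinuousLinearMap
    { toFun := fun u p => ∑ r, frame α y p r * (siteProd α y r * u r)
      map_add' := fun u v => by
        funext p
        simp only [Pi.add_apply, mul_add, Finset.sum_add_distrib]
      map_smul' := fun t u => by
        funext p
        simp only [Pi.smul_apply, smul_eq_mul, RingHom.id_apply, Finset.mul_sum]
        exact Finset.sum_congr rfl fun r _ => by ring }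

theorem changeVarsDeriv_apply (y u : Phase bc m N) (p : Label bc m N) :
    changeVarsDeriv α y u p = ∑ r, frame α y p r * (siteProd α y r * u r) := rfl

theorem hasFDerivAt_prod_inv {x : Phase bc m N} (hx : x ∈ domMinus bc m N α) (k : ℤ) (n : ℕ) :
    HasFDerivAt (fun z : Phase bc m N => (∏ i ∈ Finset.range n, (1 - α * fld z 0 (k + i)))⁻¹)
      ((∏ i ∈ Finset.range n, (1 - α * fld x 0 (k + i)))⁻¹ •
        ∑ i ∈ Finset.range n, (α * (1 - α * fld x 0 (k + i))⁻¹) • fldL bc m N 0 (k + i)) x := by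
  induction n with
  | zero => simpa using hasFDerivAt_const (1 : ℝ) x
  | succ n ih =>
    have h := mem_domMinus_iff.1 hx (k + n)
    have h1 : HasFDerivAt (fun z : Phase bc m N => 1 - α * fld z 0 (k + n))
        (-(α • fldL bc m N 0 (k + n))) x :=
      ((hasFDerivAt_fld 0 (k + n) x).const_mul α).const_sub 1
    have h2 := (hasDerivAt_inv h).comp_hasFDerivAt x h1
    have h3 := ih.mul h2
    simp only [Finset.prod_range_succ, mul_inv]
    refine h3.congr_fderiv ?_
    ext u
    simp only [Finset.sum_range_succ, add_apply, smul_apply,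
      neg_apply, smul_eq_mul, Function.comp_apply, fldL_apply]
    field_simp
    ring

theorem hasFDerivAt_changeVars {x : Phase bc m N} (hx : x ∈ domMinus bc m N α) :
    HasFDerivAt (changeVars α) (changeVarsDeriv α (changeVars α x)) x := by
  rw [hasFDerivAt_pi']
  intro p
  have h1 : HasFDerivAt (fun z : Phase bc m N => z p)
      (ContinuousLinearMap.proj (R := ℝ) (φ := fun _ : Label bc m N => ℝ) p) x :=
    (ContinuousLinearMap.proj (R := ℝ) (φ := fun _ : Label bc m N => ℝ) p).hasFDerivAt
  have h := h1.mul (hasFDerivAt_prod_inv hx p.site (p.fieldNo + 1))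
  refine (h.congr_fderiv ?_)
  ext u
  simp only [add_apply, smul_apply, smul_eq_mul,
    ContinuousLinearMap.comp_apply, ContinuousLinearMap.proj_apply, changeVarsDeriv_apply,
    sum_apply, fldL_apply]
  rw [sum_frame_mul]
  simp only [fld_siteProd_mul]
  simp only [siteProd, one_add_fld_changeVars hx, Finset.prod_inv_distrib]
  rw [changeVars, Finset.mul_sum, Finset.mul_sum, Finset.mul_sum, add_comm]
  congr 1
  refine Finset.sum_congr rfl fun i _ => ?_
  rw [div_eq_mul_inv]
  ring

/-- The bracket with the matrix `R` in the moving frame. -/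
def frameBivector (α : ℝ) (R : Bivector bc m N) : Bivector bc m N :=
  fun y p q => ∑ r, ∑ s, frame α y p r * R y r s * frame α y q s

/-- Bilinear forms with matrices that are related by a congruence transformation. -/
theorem sum_congruence {ι : Type*} [Fintype ι] (A R : ι → ι → ℝ) (f g : ι → ℝ) :
    ∑ p, ∑ q, (∑ r, ∑ s, A p r * R r s * A q s) * f p * g q =
      ∑ r, ∑ s, R r s * (∑ p, f p * A p r) * ∑ q, g q * A q s := by
  have h1 : ∀ p q, (∑ r, ∑ s, A p r * R r s * A q s) * f p * g q =
      ∑ r, ∑ s, R r s * (f p * A p r) * (g q * A q s) := fun p q => by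
    simp only [Finset.sum_mul]
    exact Finset.sum_congr rfl fun r _ => Finset.sum_congr rfl fun s _ => by ring
  have h2 : ∀ r s, R r s * (∑ p, f p * A p r) * (∑ q, g q * A q s) =
      ∑ p, ∑ q, R r s * (f p * A p r) * (g q * A q s) := fun r s => by
    rw [mul_assoc, Finset.sum_mul_sum, Finset.mul_sum]
    refine Finset.sum_congr rfl fun p _ => ?_
    rw [Finset.mul_sum]
    exact Finset.sum_congr rfl fun q _ => by ring
  simp only [h1, h2]
  calc ∑ p, ∑ q, ∑ r, ∑ s, R r s * (f p * A p r) * (g q * A q s)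
      = ∑ p, ∑ r, ∑ q, ∑ s, R r s * (f p * A p r) * (g q * A q s) :=
        Finset.sum_congr rfl fun p _ => Finset.sum_comm
    _ = ∑ r, ∑ p, ∑ s, ∑ q, R r s * (f p * A p r) * (g q * A q s) := by
        rw [Finset.sum_comm]
        exact Finset.sum_congr rfl fun r _ => Finset.sum_congr rfl fun p _ => Finset.sum_comm
    _ = _ := Finset.sum_congr rfl fun r _ => Finset.sum_comm

/-- A linear functional on the phase space in coordinates. -/
theorem clm_apply_eq_sum (f : Phase bc m N →L[ℝ] ℝ) (v : Phase bc m N) :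
    f v = ∑ p, f (Pi.single p 1) * v p := by
  conv_lhs => rw [← Finset.univ_sum_single v]
  rw [map_sum]
  refine Finset.sum_congr rfl fun p _ => ?_
  have : (Pi.single p (v p) : Phase bc m N) = v p • Pi.single p (1 : ℝ) := by
    rw [← Pi.single_smul, smul_eq_mul, mul_one]
  rw [this, map_smul, smul_eq_mul, mul_comm]

/-- Rescaling by `siteProd` turns a bracket in the old variables into the frame matrix of
its push-forward. -/
theorem pb_frameBivector {R β : Bivector bc m N} {x : Phase bc m N}
    (hx : x ∈ domMinus bc m N α)
    (h : ∀ r s, R (changeVars α x) r s =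
      siteProd α (changeVars α x) r * siteProd α (changeVars α x) s * β x r s)
    {F G : Phase bc m N → ℝ} (hF : DifferentiableAt ℝ F (changeVars α x))
    (hG : DifferentiableAt ℝ G (changeVars α x)) :
    pb (frameBivector α R) F G (changeVars α x) =
      pb β (F ∘ changeVars α) (G ∘ changeVars α) x := by
  have key : ∀ {F : Phase bc m N → ℝ}, DifferentiableAt ℝ F (changeVars α x) → ∀ r,
      fderiv ℝ (F ∘ changeVars α) x (Pi.single r 1) =
        (∑ p, fderiv ℝ F (changeVars α x) (Pi.single p 1) * frame α (changeVars α x) p r) *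
          siteProd α (changeVars α x) r := by
    intro F hF r
    rw [(hF.hasFDerivAt.comp x (hasFDerivAt_changeVars hx)).fderiv, ContinuousLinearMap.comp_apply,
      clm_apply_eq_sum, Finset.sum_mul]
    refine Finset.sum_congr rfl fun p _ => ?_
    rw [changeVarsDeriv_apply, Finset.sum_eq_single r]
    · simp [mul_assoc]
    · intro q _ hq; simp [Pi.single_eq_of_ne hq]
    · simp
  unfold pb frameBivector
  rw [sum_congruence]
  refine Finset.sum_congr rfl fun r _ => Finset.sum_congr rfl fun s _ => ?_
  rw [key hF, key hG, h]
  ring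

end ChangeOfVariables

/-! ### Poisson brackets in coordinates -/

section Poisson

variable {bc : Boundary} {m N : ℕ} {α : ℝ}

/-- One of the three terms of the Jacobi identity for the coordinates `p`, `q`, `r`: the
bracket `{x_p, {x_q, x_r}}`. -/
def nestedBracket (P : Bivector bc m N) (x : Phase bc m N) (p q r : Label bc m N) : ℝ :=
  ∑ u, P x p u * fderiv ℝ (fun y => P y q r) x (Pi.single u 1)

/-- The Jacobi identity for the coordinate functions at a point. -/
def CoordJacobi (P : Bivector bc m N) (x : Phase bc m N) : Prop :=
  ∀ p q r, nestedBracket P x p q r + nestedBracket P x q r p + nestedBracket P x r p q = 0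

theorem fderiv_coord (x v : Phase bc m N) (p : Label bc m N) :
    fderiv ℝ (fun y : Phase bc m N => y p) x v = v p := by
  have h : HasFDerivAt (fun y : Phase bc m N => y p)
      (ContinuousLinearMap.proj (R := ℝ) (φ := fun _ : Label bc m N => ℝ) p) x :=
    (ContinuousLinearMap.proj (R := ℝ) (φ := fun _ : Label bc m N => ℝ) p).hasFDerivAt
  rw [h.fderiv]; rfl

theorem pb_coord_left (P : Bivector bc m N) (p : Label bc m N) (G : Phase bc m N → ℝ)
    (x : Phase bc m N) :
    pb P (fun y => y p) G x = ∑ u, P x p u * fderiv ℝ G x (Pi.single u 1) := by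
  unfold pb
  rw [Finset.sum_eq_single p]
  · simp [fderiv_coord]
  · intro q _ hq
    simp [fderiv_coord, Pi.single_eq_of_ne (Ne.symm hq)]
  · simp

theorem pb_coord (P : Bivector bc m N) (p q : Label bc m N) :
    pb P (fun y => y p) (fun y => y q) = fun x => P x p q := by
  funext x
  rw [pb_coord_left, Finset.sum_eq_single q]
  · simp [fderiv_coord]
  · intro u _ hu
    simp [fderiv_coord, Pi.single_eq_of_ne (Ne.symm hu)]
  · simp

theorem nestedBracket_eq_pb (P : Bivector bc m N) (x : Phase bc m N) (p q r : Label bc m N) :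
    nestedBracket P x p q r = pb P (fun y => y p) (pb P (fun y => y q) (fun y => y r)) x := by
  rw [pb_coord, pb_coord_left, nestedBracket]

theorem pb_congr (P : Bivector bc m N) {F G G' : Phase bc m N → ℝ} {x : Phase bc m N}
    (h : G =ᶠ[nhds x] G') : pb P F G x = pb P F G' x := by
  unfold pb
  rw [h.fderiv_eq]

theorem pb_skew {P : Bivector bc m N} {x : Phase bc m N} (h : ∀ p q, P x p q = -P x q p)
    (F G : Phase bc m N → ℝ) : pb P F G x = -pb P G F x := by
  unfold pb
  rw [Finset.sum_comm, ← Finset.sum_neg_distrib]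
  refine Finset.sum_congr rfl fun q _ => ?_
  rw [← Finset.sum_neg_distrib]
  refine Finset.sum_congr rfl fun p _ => ?_
  rw [h]; ring

/-- The matrix of second derivatives. -/
def hess (F : Phase bc m N → ℝ) (x : Phase bc m N) (p q : Label bc m N) : ℝ :=
  fderiv ℝ (fderiv ℝ F) x (Pi.single q 1) (Pi.single p 1)

theorem hess_symm {F : Phase bc m N → ℝ} {x : Phase bc m N} (hF : ContDiffAt ℝ 2 F x)
    (p q : Label bc m N) : hess F x p q = hess F x q p :=
  (hF.isSymmSndFDerivAt (by simp)) _ _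

theorem hasFDerivAt_partial {F : Phase bc m N → ℝ} {x : Phase bc m N} (hF : ContDiffAt ℝ 2 F x)
    (v : Phase bc m N) :
    HasFDerivAt (fun y => fderiv ℝ F y v) ((fderiv ℝ (fderiv ℝ F) x).flip v) x := by
  have h : DifferentiableAt ℝ (fderiv ℝ F) x :=
    (hF.fderiv_right (m := 1) (by norm_num)).differentiableAt (by norm_num)
  refine (h.hasFDerivAt.clm_apply (hasFDerivAt_const v x)).congr_fderiv ?_
  ext u; simp

theorem fderiv_pb {P : Bivector bc m N} {x : Phase bc m N}
    (hP : ∀ p q, DifferentiableAt ℝ (fun y => P y p q) x)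
    {G H : Phase bc m N → ℝ} (hG : ContDiffAt ℝ 2 G x) (hH : ContDiffAt ℝ 2 H x)
    (u : Label bc m N) :
    fderiv ℝ (pb P G H) x (Pi.single u 1) = ∑ p, ∑ q,
      (fderiv ℝ (fun y => P y p q) x (Pi.single u 1) *
          fderiv ℝ G x (Pi.single p 1) * fderiv ℝ H x (Pi.single q 1) +
        P x p q * hess G x p u * fderiv ℝ H x (Pi.single q 1) +
        P x p q * fderiv ℝ G x (Pi.single p 1) * hess H x q u) := by
  have h : HasFDerivAt (pb P G H) (∑ p, ∑ q,
      ((P x p q * fderiv ℝ G x (Pi.single p 1)) •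
          (fderiv ℝ (fderiv ℝ H) x).flip (Pi.single q 1) +
        fderiv ℝ H x (Pi.single q 1) • (P x p q • (fderiv ℝ (fderiv ℝ G) x).flip (Pi.single p 1) +
          fderiv ℝ G x (Pi.single p 1) • fderiv ℝ (fun y => P y p q) x))) x := by
    refine HasFDerivAt.fun_sum fun p _ => HasFDerivAt.fun_sum fun q _ => ?_
    exact ((hP p q).hasFDerivAt.mul (hasFDerivAt_partial hG _)).mul (hasFDerivAt_partial hH _)
  rw [h.fderiv]
  simp only [sum_apply, add_apply, smul_apply, ContinuousLinearMap.flip_apply, smul_eq_mul]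
  refine Finset.sum_congr rfl fun p _ => Finset.sum_congr rfl fun q _ => ?_
  simp only [hess]
  ring

/-- The nested bracket of functions: the terms with second derivatives are values of the Hessians
at the Hamiltonian vectors `X u = ∑ p, ∂_p F P_{pu}`. -/
theorem pb_pb_eq {P : Bivector bc m N} {x : Phase bc m N}
    (hP : ∀ p q, DifferentiableAt ℝ (fun y => P y p q) x) (hs : ∀ p q, P x p q = -P x q p)
    (F : Phase bc m N → ℝ) {G H : Phase bc m N → ℝ} (hG : ContDiffAt ℝ 2 G x)
    (hH : ContDiffAt ℝ 2 H x) (X : (Phase bc m N → ℝ) → Label bc m N → ℝ)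
    (hX : X = fun F u => ∑ p, P x p u * fderiv ℝ F x (Pi.single p 1)) :
    pb P F (pb P G H) x =
      (∑ p, ∑ q, ∑ r, nestedBracket P x p q r * fderiv ℝ F x (Pi.single p 1) *
        fderiv ℝ G x (Pi.single q 1) * fderiv ℝ H x (Pi.single r 1)) +
      (∑ u, ∑ v, hess H x u v * X G u * X F v) - ∑ u, ∑ v, hess G x u v * X H u * X F v := by
  have h0 : pb P F (pb P G H) x = ∑ u, X F u * fderiv ℝ (pb P G H) x (Pi.single u 1) := by
    simp only [pb, hX, Finset.sum_mul]
    rw [Finset.sum_comm]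
  have hXn : ∀ H p, X H p = -∑ q, P x p q * fderiv ℝ H x (Pi.single q 1) := fun H p => by
    rw [hX, ← Finset.sum_neg_distrib]
    exact Finset.sum_congr rfl fun q _ => by rw [hs]; ring
  have h1 : ∀ u, fderiv ℝ (pb P G H) x (Pi.single u 1) =
      (∑ p, ∑ q, fderiv ℝ (fun y => P y p q) x (Pi.single u 1) *
          fderiv ℝ G x (Pi.single p 1) * fderiv ℝ H x (Pi.single q 1)) -
        (∑ p, hess G x p u * X H p) + ∑ q, hess H x q u * X G q := fun u => by
    rw [fderiv_pb hP hG hH]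
    simp only [Finset.sum_add_distrib]
    rw [sub_eq_add_neg]
    congr 1
    · congr 1
      rw [← Finset.sum_neg_distrib]
      refine Finset.sum_congr rfl fun p _ => ?_
      rw [hXn, mul_neg, neg_neg, Finset.mul_sum]
      exact Finset.sum_congr rfl fun q _ => by ring
    · rw [Finset.sum_comm]
      refine Finset.sum_congr rfl fun q _ => ?_
      rw [hX, Finset.mul_sum]
      exact Finset.sum_congr rfl fun p _ => by ring
  rw [h0]
  simp only [h1, mul_add, mul_sub, Finset.sum_add_distrib, Finset.sum_sub_distrib]
  have e1 : ∀ G H : Phase bc m N → ℝ, ∑ u, X F u * ∑ p, hess G x p u * X H p =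
      ∑ u, ∑ v, hess G x u v * X H u * X F v := fun G H => by
    simp only [Finset.mul_sum]
    rw [Finset.sum_comm]
    exact Finset.sum_congr rfl fun p _ => Finset.sum_congr rfl fun q _ => by ring
  rw [e1, e1]
  have e2 : ∑ u, X F u * ∑ p, ∑ q, fderiv ℝ (fun y => P y p q) x (Pi.single u 1) *
        fderiv ℝ G x (Pi.single p 1) * fderiv ℝ H x (Pi.single q 1) =
      ∑ p, ∑ q, ∑ r, nestedBracket P x p q r * fderiv ℝ F x (Pi.single p 1) *
        fderiv ℝ G x (Pi.single q 1) * fderiv ℝ H x (Pi.single r 1) := by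
    simp only [hX, nestedBracket, Finset.mul_sum, Finset.sum_mul]
    rw [Finset.sum_comm' (t' := Finset.univ) (s' := fun _ => Finset.univ) (by simp)]
    calc _ = ∑ q, ∑ u, ∑ r, ∑ p, _ := Finset.sum_congr rfl fun q _ =>
            Finset.sum_congr rfl fun u _ => Finset.sum_congr rfl fun r _ => rfl
      _ = ∑ q, ∑ r, ∑ p, ∑ u, _ := Finset.sum_congr rfl fun q _ => by
            rw [Finset.sum_comm]
            exact Finset.sum_congr rfl fun r _ => Finset.sum_comm.trans
              (Finset.sum_congr rfl fun p _ => Finset.sum_congr rfl fun u _ => by ring)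
      _ = ∑ q, ∑ p, ∑ r, ∑ u, _ := Finset.sum_congr rfl fun q _ => Finset.sum_comm
      _ = _ := Finset.sum_comm
  rw [e2]
  ring

/-- For a skew-symmetric bracket the Jacobi identity holds for all functions as soon as it holds for
the coordinates. -/
theorem pb_jacobi {P : Bivector bc m N} {x : Phase bc m N}
    (hP : ∀ p q, DifferentiableAt ℝ (fun y => P y p q) x) (hs : ∀ p q, P x p q = -P x q p)
    (hJ : CoordJacobi P x) {F G H : Phase bc m N → ℝ} (hF : ContDiffAt ℝ 2 F x)
    (hG : ContDiffAt ℝ 2 G x) (hH : ContDiffAt ℝ 2 H x) :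
    pb P F (pb P G H) x + pb P G (pb P H F) x + pb P H (pb P F G) x = 0 := by
  rw [pb_pb_eq hP hs F hG hH _ rfl, pb_pb_eq hP hs G hH hF _ rfl, pb_pb_eq hP hs H hF hG _ rfl]
  have e : ∀ (F : Phase bc m N → ℝ) (hF : ContDiffAt ℝ 2 F x) (X Y : Label bc m N → ℝ),
      ∑ u, ∑ v, hess F x u v * X u * Y v = ∑ u, ∑ v, hess F x u v * Y u * X v := by
    intro F hF X Y
    rw [Finset.sum_comm]
    refine Finset.sum_congr rfl fun v _ => Finset.sum_congr rfl fun u _ => ?_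
    rw [hess_symm hF]; ring
  rw [e F hF (fun u => ∑ p, P x p u * fderiv ℝ G x (Pi.single p 1)),
    e G hG (fun u => ∑ p, P x p u * fderiv ℝ H x (Pi.single p 1)),
    e H hH (fun u => ∑ p, P x p u * fderiv ℝ G x (Pi.single p 1))]
  have c1 : ∀ (A : Label bc m N → Label bc m N → Label bc m N → ℝ) (f g h : Label bc m N → ℝ),
      ∑ p, ∑ q, ∑ r, A p q r * g p * h q * f r = ∑ p, ∑ q, ∑ r, A q r p * f p * g q * h r := by
    intro A f g h
    rw [Finset.sum_congr rfl fun p _ => Finset.sum_comm, Finset.sum_comm]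
    exact Finset.sum_congr rfl fun p _ => Finset.sum_congr rfl fun q _ =>
      Finset.sum_congr rfl fun r _ => by ring
  rw [c1 (nestedBracket P x) (fun p => fderiv ℝ F x (Pi.single p 1))
      (fun p => fderiv ℝ G x (Pi.single p 1)) (fun p => fderiv ℝ H x (Pi.single p 1)),
    ← c1 (fun p q r => nestedBracket P x r p q) (fun p => fderiv ℝ H x (Pi.single p 1))
      (fun p => fderiv ℝ F x (Pi.single p 1)) (fun p => fderiv ℝ G x (Pi.single p 1))]
  have z : (∑ p, ∑ q, ∑ r, nestedBracket P x p q r * fderiv ℝ F x (Pi.single p 1) *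
        fderiv ℝ G x (Pi.single q 1) * fderiv ℝ H x (Pi.single r 1)) +
      (∑ p, ∑ q, ∑ r, nestedBracket P x q r p * fderiv ℝ F x (Pi.single p 1) *
        fderiv ℝ G x (Pi.single q 1) * fderiv ℝ H x (Pi.single r 1)) +
      (∑ p, ∑ q, ∑ r, nestedBracket P x r p q * fderiv ℝ F x (Pi.single p 1) *
        fderiv ℝ G x (Pi.single q 1) * fderiv ℝ H x (Pi.single r 1)) = 0 := by
    simp only [← Finset.sum_add_distrib]
    refine Finset.sum_eq_zero fun p _ => Finset.sum_eq_zero fun q _ =>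
      Finset.sum_eq_zero fun r _ => ?_
    linear_combination (fderiv ℝ F x (Pi.single p 1) *
        fderiv ℝ G x (Pi.single q 1) * fderiv ℝ H x (Pi.single r 1)) * hJ p q r
  linarith

theorem two_le_smooth : (2 : WithTop ℕ∞) ≤ ∞ := WithTop.coe_le_coe.2 (le_top : (2 : ℕ∞) ≤ ⊤)

/-- It suffices to verify the Jacobi identity for the coordinate functions. -/
theorem isPoisson_of_coordJacobi {P : Bivector bc m N}
    (hP : ∀ p q, ContDiff ℝ ∞ fun x => P x p q) (hs : ∀ x p q, P x p q = -P x q p)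
    (hJ : ∀ x, CoordJacobi P x) : IsPoisson P where
  smooth := hP
  skew F G _ _ x := pb_skew (hs x) F G
  jacobi F G H hF hG hH x :=
    pb_jacobi (fun p q => ((hP p q).differentiable (by simp)) x) (hs x) (hJ x)
      (hF.of_le two_le_smooth).contDiffAt
      (hG.of_le two_le_smooth).contDiffAt
      (hH.of_le two_le_smooth).contDiffAt

theorem dense_domPlus : Dense (domPlus bc m N α) := by
  intro y
  rcases eq_or_ne α 0 with rfl | hα
  · exact subset_closure (by simp [domPlus])
  -- All `d_k` are moved by a common small amount.
  let z : Phase bc m N := fun p => if p.fieldNo = 0 then 1 else 0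
  have hz : ∀ k : Fin N, fld z 0 ((k : ℕ) : ℤ) = 1 := fun k => by
    obtain ⟨p, hj, hk⟩ : HasLabel bc m N 0 ((k : ℕ) : ℤ) :=
      hasLabel_iff.2 ⟨Nat.zero_le _, isSite_fin k, by simpa using isSite_fin k⟩
    rw [fld_eq z p hj hk]
    exact if_pos hj
  have hc : Continuous fun t : ℝ => y + t • z := by fun_prop
  have hd := (Set.finite_range fun k : Fin N =>
    -(1 + α * fld y 0 ((k : ℕ) : ℤ)) / α).countable.dense_compl ℝ
  have h := map_mem_closure hc (hd 0) (t := domPlus bc m N α) fun t ht k h0 => ht ⟨k, ?_⟩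
  · simpa using h
  · rw [fld_add, fld_smul, hz] at h0
    field_simp
    linarith

theorem continuous_nestedBracket {P : Bivector bc m N}
    (hP : ∀ p q, ContDiff ℝ ∞ fun x => P x p q) (p q r : Label bc m N) :
    Continuous fun x => nestedBracket P x p q r :=
  continuous_finsetSum _ fun u _ => (hP p u).continuous.mul
    (((hP q r).continuous_fderiv (by simp)).clm_apply continuous_const)

/-- If the bracket `Q` is the push-forward of a Poisson bracket under the change of variables where
the latter is defined, then it is a Poisson bracket on the whole phase space: the Jacobi identity
extends from a dense set. -/
theorem isPoisson_of_pushForward {P Q : Bivector bc m N} (hP : IsPoisson P)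
    (hQ : ∀ p q, ContDiff ℝ ∞ fun x => Q x p q) (hs : ∀ x p q, Q x p q = -Q x q p)
    (h : IsPushForward α P Q) : IsPoisson Q := by
  refine isPoisson_of_coordJacobi hQ hs fun y p q r => ?_
  have hPs : ∀ x p q, P x p q = -P x q p := fun x p q => by
    have := hP.skew (fun y => y p) (fun y => y q) (contDiff_apply ℝ ℝ p) (contDiff_apply ℝ ℝ q) x
    rwa [pb_coord, pb_coord] at this
  have hPJ : ∀ x, CoordJacobi P x := fun x p q r => by
    simp only [nestedBracket_eq_pb]
    exact hP.jacobi _ _ _ (contDiff_apply ℝ ℝ p) (contDiff_apply ℝ ℝ q) (contDiff_apply ℝ ℝ r) x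
  have hcoord : ∀ p : Label bc m N, ContDiff ℝ ∞ fun y : Phase bc m N => y p :=
    fun p => contDiff_apply ℝ ℝ p
  have key : ∀ x ∈ domMinus bc m N α, ∀ p q r, nestedBracket Q (changeVars α x) p q r =
      pb P ((fun y => y p) ∘ changeVars α)
        (pb P ((fun y => y q) ∘ changeVars α) ((fun y => y r) ∘ changeVars α)) x := by
    intro x hx p q r
    rw [nestedBracket_eq_pb, h _ _ (hcoord p).contDiffOn ?_ x hx]
    · refine pb_congr P ?_
      filter_upwards [isOpen_domMinus.mem_nhds hx] with z hz
      exact h _ _ (hcoord q).contDiffOn (hcoord r).contDiffOn z hz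
    · rw [pb_coord]; exact (hQ q r).contDiffOn
  have hB : ∀ x ∈ domMinus bc m N α, ∀ p : Label bc m N,
      ContDiffAt ℝ 2 ((fun y => y p) ∘ changeVars α) x := fun x hx p =>
    ((hcoord p).contDiffAt.comp x
      (contDiffOn_changeVars.contDiffAt (isOpen_domMinus.mem_nhds hx))).of_le
      two_le_smooth
  have hcont : Continuous fun y => nestedBracket Q y p q r + nestedBracket Q y q r p +
      nestedBracket Q y r p q :=
    ((continuous_nestedBracket hQ p q r).add (continuous_nestedBracket hQ q r p)).add
      (continuous_nestedBracket hQ r p q)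
  refine congrFun (hcont.ext_on (dense_domPlus (α := α)) (continuous_const (y := (0 : ℝ)))
    fun y hy => ?_) y
  have hx := (isChangeOfVariables (bc := bc) (m := m) (N := N) (α := α)).mapsTo_symm hy
  have hy' : changeVars α (changeVars (-α) y) = y := isChangeOfVariables.invOn.2 hy
  simp only
  rw [← hy', key _ hx, key _ hx, key _ hx]
  exact pb_jacobi (fun p q => ((hP.smooth p q).differentiable (by simp)) _) (hPs _) (hPJ _)
    (hB _ hx p) (hB _ hx q) (hB _ hx r)

theorem nestedBracket_linear_combination {P Q : Bivector bc m N}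
    (hP : ∀ p q, ContDiff ℝ ∞ fun x => P x p q) (hQ : ∀ p q, ContDiff ℝ ∞ fun x => Q x p q)
    (s t : ℝ) (x : Phase bc m N) (p q r : Label bc m N) :
    nestedBracket (s • P + t • Q) x p q r = s ^ 2 * nestedBracket P x p q r +
      s * t * ((∑ u, P x p u * fderiv ℝ (fun y => Q y q r) x (Pi.single u 1)) +
        ∑ u, Q x p u * fderiv ℝ (fun y => P y q r) x (Pi.single u 1)) +
      t ^ 2 * nestedBracket Q x p q r := by
  have h : ∀ u : Label bc m N, fderiv ℝ (fun y => (s • P + t • Q) y q r) x (Pi.single u 1) =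
      s * fderiv ℝ (fun y => P y q r) x (Pi.single u 1) +
        t * fderiv ℝ (fun y => Q y q r) x (Pi.single u 1) := fun u => by
    have h1 := (((hP q r).differentiable (by simp)) x).hasFDerivAt.const_mul s
    have h2 := (((hQ q r).differentiable (by simp)) x).hasFDerivAt.const_mul t
    have h3 : HasFDerivAt (fun y => (s • P + t • Q) y q r) _ x := h1.add h2
    rw [h3.fderiv]
    simp
  simp only [nestedBracket, h, Finset.mul_sum, ← Finset.sum_add_distrib]
  refine Finset.sum_congr rfl fun u _ => ?_
  simp only [Pi.add_apply, Pi.smul_apply, smul_eq_mul]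
  ring

/-- The Jacobi identity for `s P + t Q` is polynomial in `s`, so that the value `s = 0` need not be
considered separately. -/
theorem arePoissonCompatible_of_ne_zero {P Q : Bivector bc m N}
    (hP : ∀ p q, ContDiff ℝ ∞ fun x => P x p q) (hQ : ∀ p q, ContDiff ℝ ∞ fun x => Q x p q)
    (hPs : ∀ x p q, P x p q = -P x q p) (hQs : ∀ x p q, Q x p q = -Q x q p)
    (h : ∀ s t : ℝ, s ≠ 0 → IsPoisson (s • P + t • Q)) : ArePoissonCompatible P Q := by
  have hJ : ∀ s t : ℝ, s ≠ 0 → ∀ x, CoordJacobi (s • P + t • Q) x := fun s t hs x p q r => by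
    simp only [nestedBracket_eq_pb]
    exact (h s t hs).jacobi _ _ _ (contDiff_apply ℝ ℝ p) (contDiff_apply ℝ ℝ q)
      (contDiff_apply ℝ ℝ r) x
  have hall : ∀ s t : ℝ, IsPoisson (s • P + t • Q) := by
    intro s t
    refine isPoisson_of_coordJacobi (fun p q => ?_) (fun x p q => ?_) fun x p q r => ?_
    · exact (contDiff_const.mul (hP p q)).add (contDiff_const.mul (hQ p q))
    · simp only [Pi.add_apply, Pi.smul_apply, smul_eq_mul, hPs x p q, hQs x p q]; ring
    -- A polynomial of degree two in `s` that vanishes at `1`, `-1` and `2` is zero; the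
    -- coefficients are the Lagrange basis polynomials.
    · have h1 := hJ 1 t one_ne_zero x p q r
      have h2 := hJ (-1) t (by norm_num) x p q r
      have h3 := hJ 2 t two_ne_zero x p q r
      simp only [nestedBracket_linear_combination hP hQ] at h1 h2 h3 ⊢
      linear_combination (-(s + 1) * (s - 2) / 2) * h1 + ((s - 1) * (s - 2) / 6) * h2 +
        ((s - 1) * (s + 1) / 3) * h3
  refine ⟨?_, ?_, hall⟩
  · simpa using hall 1 0
  · simpa using hall 0 1

end Poisson

/-! ### A quadratic Poisson bracket on matrices and its periodization -/

/-- The sign of an integer as a real number. -/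
def sgn (x : ℤ) : ℝ := if 0 < x then 1 else if x < 0 then -1 else 0

/-- The sign with the value `1` at `0`. -/
def sgnPos (x : ℤ) : ℝ := if 0 ≤ x then 1 else -1

theorem sgn_of_pos {x : ℤ} (h : 0 < x) : sgn x = 1 := if_pos h

theorem sgn_of_neg {x : ℤ} (h : x < 0) : sgn x = -1 := by
  rw [sgn, if_neg (by omega), if_pos h]

theorem sgn_self_sub (x : ℤ) : sgn (x - x) = 0 := by simp [sgn]

theorem sgnPos_of_nonneg {x : ℤ} (h : 0 ≤ x) : sgnPos x = 1 := if_pos h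

theorem sgnPos_of_neg {x : ℤ} (h : x < 0) : sgnPos x = -1 := if_neg (by omega)

theorem sgn_neg (x : ℤ) : sgn (-x) = -sgn x := by
  unfold sgn; split_ifs <;> first | omega | norm_num

theorem sgn_sub_comm (x y : ℤ) : sgn (x - y) = -sgn (y - x) := by
  rw [← sgn_neg, neg_sub]

/-- The classical Yang–Baxter equation for the sign function. -/
theorem sgn_yangBaxter (a c e : ℤ) :
    (a = c ∧ c = e) ∨ sgn (c - a) * sgn (e - c) + sgn (e - c) * sgn (a - e) +
      sgn (a - e) * sgn (c - a) = -1 := by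
  unfold sgn
  split_ifs <;> first | (exfalso; omega) | (left; omega) | (right; norm_num)

/-- The coefficient of the exchange term in the quadratic bracket of matrix entries. -/
def exchangeCoeff (a b c d : ℤ) : ℝ := (sgn (c - a) + sgn (d - b)) / 2

/-- The coefficient of the log-canonical term in the quadratic bracket of matrix entries. -/
def twistCoeff (a b c d : ℤ) : ℝ :=
  (sgn (c - a) + sgn (d - b) - sgnPos (d - a) + sgnPos (b - c)) / 2

/-- The bracket of the entries `M a b` and `M c d`: the standard quadratic bracket on matrices,
twisted by a constant bivector on the torus that rescales rows and columns. The twist is such that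
the entries below the diagonal are Casimir functions when only one subdiagonal is present. -/
def entryBracket (M : ℤ → ℤ → ℝ) (a b c d : ℤ) : ℝ :=
  exchangeCoeff a b c d * (M a d * M c b) + twistCoeff a b c d * (M a b * M c d)

/-- The nested bracket `{M a b, {M c d, M e f}}`. -/
def nestedEntryBracket (M : ℤ → ℤ → ℝ) (a b c d e f : ℤ) : ℝ :=
  exchangeCoeff c d e f *
      (entryBracket M a b c f * M e d + M c f * entryBracket M a b e d) +
    twistCoeff c d e f *
      (entryBracket M a b c d * M e f + M c d * entryBracket M a b e f)

theorem entryBracket_skew (M : ℤ → ℤ → ℝ) (a b c d : ℤ) :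
    entryBracket M a b c d = -entryBracket M c d a b := by
  unfold entryBracket exchangeCoeff twistCoeff
  rw [sgn_sub_comm a c, sgn_sub_comm b d]
  ring

/-- The Jacobi identity for the bracket of matrix entries. The contributions of the log-canonical
terms cancel; the other ones combine to the difference of the Yang–Baxter expressions for the rows
and for the columns, which are both equal to `-1`. -/
theorem nestedEntryBracket_cyclic (M : ℤ → ℤ → ℝ) (a b c d e f : ℤ) :
    nestedEntryBracket M a b c d e f + nestedEntryBracket M c d e f a b +
      nestedEntryBracket M e f a b c d = 0 := by
  have key : nestedEntryBracket M a b c d e f + nestedEntryBracket M c d e f a b +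
      nestedEntryBracket M e f a b c d =
      ((sgn (c - a) * sgn (e - c) + sgn (e - c) * sgn (a - e) + sgn (a - e) * sgn (c - a)) -
        (sgn (d - b) * sgn (f - d) + sgn (f - d) * sgn (b - f) + sgn (b - f) * sgn (d - b))) / 4 *
      (M a f * M c b * M e d - M a d * M c f * M e b) := by
    unfold nestedEntryBracket entryBracket exchangeCoeff twistCoeff
    rw [sgn_sub_comm e a, sgn_sub_comm f b, sgn_sub_comm a c, sgn_sub_comm b d,
      sgn_sub_comm c e, sgn_sub_comm d f]
    ring
  rw [key]
  -- In the exceptional case of three equal rows or columns the cubic terms cancel.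
  rcases sgn_yangBaxter a c e with ⟨rfl, rfl⟩ | h1
  · ring
  rcases sgn_yangBaxter b d f with ⟨rfl, rfl⟩ | h2
  · ring
  rw [h1, h2]; ring

section Support

variable {m : ℕ} {S : ℤ → Prop} {M : ℤ → ℤ → ℝ}

/-- The matrix `M` has only one subdiagonal and `m` superdiagonals, and vanishes outside of the rows
and columns in `S`. -/
def BandSupport (m : ℕ) (S : ℤ → Prop) (M : ℤ → ℤ → ℝ) : Prop :=
  ∀ a b, M a b ≠ 0 → (a - 1 ≤ b ∧ b ≤ a + m) ∧ S a ∧ S b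

/-- The entries in the upper triangle of the band form a Poisson submanifold; moreover, brackets of
distant entries vanish. -/
theorem entryBracket_support (hM : BandSupport m S M) {a b c d : ℤ} (hab : a ≤ b)
    (hab' : b ≤ a + m) (h : entryBracket M a b c d ≠ 0) :
    (c ≤ d ∧ d ≤ c + m) ∧ (c ≤ a + m + 1 ∧ a ≤ c + m + 1) ∧ S c ∧ S d := by
  have hz : ∀ a b, M a b = 0 ∨ ((a - 1 ≤ b ∧ b ≤ a + m) ∧ S a ∧ S b) := fun a b => by
    by_cases h0 : M a b = 0
    · exact Or.inl h0
    · exact Or.inr (hM a b h0)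
  by_contra hcon
  apply h
  -- The two terms vanish separately, except when the intervals share an end point.
  rcases lt_trichotomy a c with hac | rfl | hac <;> rcases lt_trichotomy b d with hbd | rfl | hbd
  · have e1 : M a d * M c b = 0 := by
      rcases hz a d with h1 | ⟨h1, -, hd⟩
      · rw [h1, zero_mul]
      rcases hz c b with h2 | ⟨h2, hc, -⟩
      · rw [h2, mul_zero]
      exact absurd ⟨⟨by omega, by omega⟩, ⟨by omega, by omega⟩, hc, hd⟩ hcon
    have e2 : twistCoeff a b c d * M c d = 0 := by
      rcases hz c d with h1 | ⟨h1, hc, hd⟩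
      · rw [h1, mul_zero]
      have : b < c := by
        by_contra h2
        exact hcon ⟨⟨by omega, by omega⟩, ⟨by omega, by omega⟩, hc, hd⟩
      rw [twistCoeff, sgn_of_pos (by omega), sgn_of_pos (by omega), sgnPos_of_nonneg (by omega),
        sgnPos_of_neg (by omega)]
      norm_num
    unfold entryBracket
    linear_combination exchangeCoeff a b c d * e1 + M a b * e2
  · rcases hz c b with h1 | ⟨h1, hc, hd⟩
    · simp [entryBracket, h1]
    have : c = b + 1 := by
      by_contra h2
      exact hcon ⟨⟨by omega, by omega⟩, ⟨by omega, by omega⟩, hc, hd⟩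
    subst this
    rw [entryBracket, exchangeCoeff, twistCoeff, sgn_of_pos (by omega), sgn_self_sub,
      sgnPos_of_nonneg (by omega), sgnPos_of_neg (by omega)]
    ring
  · rcases hz c d with h1 | ⟨h1, -, -⟩
    · simp [entryBracket, exchangeCoeff, h1, sgn_of_pos (sub_pos.2 hac), sgn_of_neg (sub_neg.2 hbd)]
    rw [entryBracket, exchangeCoeff, twistCoeff, sgn_of_pos (by omega), sgn_of_neg (by omega),
      sgnPos_of_nonneg (by omega), sgnPos_of_nonneg (by omega)]
    ring
  · rcases hz a d with h1 | ⟨h1, hc, hd⟩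
    · simp [entryBracket, h1]
    exact absurd ⟨⟨by omega, by omega⟩, ⟨by omega, by omega⟩, hc, hd⟩ hcon
  · rcases hz a b with h1 | ⟨h1, hc, hd⟩
    · simp [entryBracket, h1]
    exact absurd ⟨⟨by omega, by omega⟩, ⟨by omega, by omega⟩, hc, hd⟩ hcon
  · rcases hz a d with h1 | ⟨h1, hc, hd⟩
    · simp [entryBracket, h1]
    have : d = a - 1 := by
      by_contra h2
      exact hcon ⟨⟨by omega, by omega⟩, ⟨by omega, by omega⟩, hc, hd⟩
    subst this
    rw [entryBracket, exchangeCoeff, twistCoeff, sgn_of_neg (x := a - 1 - b) (by omega),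
      sgn_self_sub, sgnPos_of_neg (by omega), sgnPos_of_nonneg (by omega)]
    ring
  · rcases hz c d with h1 | ⟨h1, -, -⟩
    · simp [entryBracket, exchangeCoeff, h1, sgn_of_neg (sub_neg.2 hac), sgn_of_pos (sub_pos.2 hbd)]
    rw [entryBracket, exchangeCoeff, twistCoeff, sgn_of_neg (by omega), sgn_of_pos (by omega),
      sgnPos_of_nonneg (by omega), sgnPos_of_nonneg (by omega)]
    ring
  · rcases hz c b with h1 | ⟨h1, hc, hd⟩
    · simp [entryBracket, h1]
    exact absurd ⟨⟨by omega, by omega⟩, ⟨by omega, by omega⟩, hc, hd⟩ hcon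
  · have e1 : M a d * M c b = 0 := by
      rcases hz a d with h1 | ⟨h1, -, hd⟩
      · rw [h1, zero_mul]
      rcases hz c b with h2 | ⟨h2, hc, -⟩
      · rw [h2, mul_zero]
      exact absurd ⟨⟨by omega, by omega⟩, ⟨by omega, by omega⟩, hc, hd⟩ hcon
    have e2 : twistCoeff a b c d * M c d = 0 := by
      rcases hz c d with h1 | ⟨h1, hc, hd⟩
      · rw [h1, mul_zero]
      have : d < a := by
        by_contra h2
        exact hcon ⟨⟨by omega, by omega⟩, ⟨by omega, by omega⟩, hc, hd⟩
      rw [twistCoeff, sgn_of_neg (by omega), sgn_of_neg (by omega), sgnPos_of_neg (by omega),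
        sgnPos_of_nonneg (by omega)]
      norm_num
    unfold entryBracket
    linear_combination exchangeCoeff a b c d * e1 + M a b * e2

/-- Nested brackets of distant entries vanish, so that sums over shifts are finite. -/
theorem nestedEntryBracket_support (hM : BandSupport m S M) {a b c d e f : ℤ}
    (hab : a ≤ b) (hab' : b ≤ a + m) (hcd : c ≤ d) (hcd' : d ≤ c + m) (hef : e ≤ f)
    (hef' : f ≤ e + m) (h : nestedEntryBracket M a b c d e f ≠ 0) :
    |a - c| ≤ 4 * m + 4 ∧ |e - c| ≤ 2 * m + 2 := by
  have hB : ∀ u v, entryBracket M a b u v = 0 ∨ (u ≤ v ∧ v ≤ u + m) ∧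
      (u ≤ a + m + 1 ∧ a ≤ u + m + 1) := fun u v => by
    by_cases h0 : entryBracket M a b u v = 0
    · exact Or.inl h0
    · have := entryBracket_support hM hab hab' h0
      exact Or.inr ⟨this.1, this.2.1⟩
  have hz : ∀ a b, M a b = 0 ∨ (a - 1 ≤ b ∧ b ≤ a + m) := fun a b => by
    by_cases h0 : M a b = 0
    · exact Or.inl h0
    · exact Or.inr (hM a b h0).1
  have ht : twistCoeff c d e f = 0 ∨ |e - c| ≤ 2 * m + 2 := by
    by_contra hcon
    push Not at hcon
    rcases lt_abs.1 hcon.2 with h1 | h1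
    · apply hcon.1
      rw [twistCoeff, sgn_of_pos (by omega), sgn_of_pos (by omega), sgnPos_of_nonneg (by omega),
        sgnPos_of_neg (by omega)]
      norm_num
    · apply hcon.1
      rw [twistCoeff, sgn_of_neg (by omega), sgn_of_neg (by omega), sgnPos_of_neg (by omega),
        sgnPos_of_nonneg (by omega)]
      norm_num
  by_contra hcon
  apply h
  have t1 : entryBracket M a b c f * M e d = 0 := by
    rcases hB c f with h1 | h1
    · rw [h1, zero_mul]
    rcases hz e d with h2 | h2
    · rw [h2, mul_zero]
    exact absurd ⟨abs_le.2 ⟨by omega, by omega⟩, abs_le.2 ⟨by omega, by omega⟩⟩ hcon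
  have t2 : M c f * entryBracket M a b e d = 0 := by
    rcases hB e d with h1 | h1
    · rw [h1, mul_zero]
    rcases hz c f with h2 | h2
    · rw [h2, zero_mul]
    exact absurd ⟨abs_le.2 ⟨by omega, by omega⟩, abs_le.2 ⟨by omega, by omega⟩⟩ hcon
  have t3 : twistCoeff c d e f * entryBracket M a b c d = 0 := by
    rcases hB c d with h1 | h1
    · rw [h1, mul_zero]
    rcases ht with h2 | h2
    · rw [h2, zero_mul]
    exact absurd ⟨abs_le.2 ⟨by omega, by omega⟩, h2⟩ hcon
  have t4 : twistCoeff c d e f * entryBracket M a b e f = 0 := by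
    rcases hB e f with h1 | h1
    · rw [h1, mul_zero]
    rcases ht with h2 | h2
    · rw [h2, zero_mul]
    have := abs_le.1 h2
    exact absurd ⟨abs_le.2 ⟨by omega, by omega⟩, h2⟩ hcon
  unfold nestedEntryBracket
  linear_combination exchangeCoeff c d e f * t1 + exchangeCoeff c d e f * t2 + M e f * t3 +
    M c d * t4

end Support

theorem entryBracket_shift {M : ℤ → ℤ → ℝ} {g : ℤ} (hM : ∀ a b, M (a + g) (b + g) = M a b)
    (a b c d : ℤ) :
    entryBracket M (a + g) (b + g) (c + g) (d + g) = entryBracket M a b c d := by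
  simp only [entryBracket, exchangeCoeff, twistCoeff, hM, add_sub_add_right_eq_sub]

theorem nestedEntryBracket_shift {M : ℤ → ℤ → ℝ} {g : ℤ}
    (hM : ∀ a b, M (a + g) (b + g) = M a b) (a b c d e f : ℤ) :
    nestedEntryBracket M (a + g) (b + g) (c + g) (d + g) (e + g) (f + g) =
      nestedEntryBracket M a b c d e f := by
  simp only [nestedEntryBracket, entryBracket_shift hM, exchangeCoeff, twistCoeff, hM,
    add_sub_add_right_eq_sub]

section Periodization

variable {bc : Boundary} {m N : ℕ}

theorem SameSite.neg_zero {g : ℤ} (h : SameSite bc N g 0) : SameSite bc N (-g) 0 :=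
  ((sameSite_congr_sub (by ring)).1 h).symm

theorem sameSite_neg_zero {g : ℤ} : SameSite bc N (-g) 0 ↔ SameSite bc N g 0 :=
  ⟨fun h => by simpa using h.neg_zero, SameSite.neg_zero⟩

theorem SameSite.add_zero {g h : ℤ} (hg : SameSite bc N g 0) (hh : SameSite bc N h 0) :
    SameSite bc N (g + h) 0 := by
  have h1 := hg.add_right h
  rw [zero_add] at h1
  exact h1.trans hh

theorem sameSite_add_zero_iff {g h : ℤ} (hg : SameSite bc N g 0) :
    SameSite bc N (h + g) 0 ↔ SameSite bc N h 0 :=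
  ⟨fun h1 => by simpa using h1.add_zero hg.neg_zero, fun h1 => h1.add_zero hg⟩

/-- The sum over all shifts of the lattice that fix the sites: the multiples of `N` in the periodic
case, zero alone in the open-end case. -/
def shiftSum (bc : Boundary) (N : ℕ) (f : ℤ → ℝ) : ℝ :=
  ∑ᶠ g, if SameSite bc N g 0 then f g else 0

theorem shiftSum_congr {f f' : ℤ → ℝ} (h : ∀ g, SameSite bc N g 0 → f g = f' g) :
    shiftSum bc N f = shiftSum bc N f' :=
  finsum_congr fun g => by split_ifs with hg <;> simp [h g, hg]

theorem shiftSum_shift (f : ℤ → ℝ) {g : ℤ} (hg : SameSite bc N g 0) :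
    shiftSum bc N (fun h => f (h + g)) = shiftSum bc N f := by
  unfold shiftSum
  rw [← finsum_comp_equiv (Equiv.addRight g) (f := fun h => if SameSite bc N h 0 then f h else 0)]
  exact finsum_congr fun h => by simp [sameSite_add_zero_iff hg]

theorem shiftSum_neg (f : ℤ → ℝ) : shiftSum bc N (fun h => f (-h)) = shiftSum bc N f := by
  unfold shiftSum
  rw [← finsum_comp_equiv (Equiv.neg ℤ)]
  exact finsum_congr fun h => by simp [sameSite_neg_zero]

theorem shiftSum_eq_sum {f : ℤ → ℝ} (W : Finset ℤ)
    (h : ∀ g, SameSite bc N g 0 → f g ≠ 0 → g ∈ W) :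
    shiftSum bc N f = ∑ g ∈ W, if SameSite bc N g 0 then f g else 0 := by
  refine finsum_eq_sum_of_support_subset _ fun g hg => ?_
  simp only [Function.mem_support, ne_eq, ite_eq_right_iff, Classical.not_imp] at hg
  exact h g hg.1 hg.2

/-- The bracket of the entry `(a, b)` with the sum of all translates of the entry `(u, v)`. -/
def periodizedBracket (bc : Boundary) (N : ℕ) (M : ℤ → ℤ → ℝ) (a b u v : ℤ) : ℝ :=
  shiftSum bc N fun g => entryBracket M a b (u + g) (v + g)

/-- A family of band matrices on the phase space, invariant under the shifts of the lattice, the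
entries of which on and above the diagonal are, up to a common factor `κ` and constants, the phase
variables. -/
structure IsPeriodicBand (M : Phase bc m N → ℤ → ℤ → ℝ) (κ : ℝ) : Prop where
  band : ∀ x, BandSupport m (IsSite bc N) (M x)
  shift : ∀ x g, SameSite bc N g 0 → ∀ a b, M x (a + g) (b + g) = M x a b
  smooth : ∀ a b, ContDiff ℝ ∞ fun x => M x a b
  deriv : ∀ x a b, HasFDerivAt (fun y => M y a b)
    (if a ≤ b then κ • fldL bc m N (b - a).toNat a else 0) x

theorem periodizedBracket_shift (M : ℤ → ℤ → ℝ) (a b u v : ℤ) {g : ℤ}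
    (hg : SameSite bc N g 0) :
    periodizedBracket bc N M a b (u + g) (v + g) = periodizedBracket bc N M a b u v := by
  unfold periodizedBracket
  rw [← shiftSum_shift (fun h => entryBracket M a b (u + h) (v + h)) hg]
  exact shiftSum_congr fun h _ => by rw [add_comm h g, ← add_assoc, ← add_assoc]

/-- By invariance under shifts, the first entry may be translated instead of the second one. -/
theorem periodizedBracket_eq {M : ℤ → ℤ → ℝ}
    (hM : ∀ g, SameSite bc N g 0 → ∀ a b, M (a + g) (b + g) = M a b) (a b u v : ℤ) :
    periodizedBracket bc N M a b u v =
      shiftSum bc N fun g => entryBracket M (a + g) (b + g) u v := by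
  unfold periodizedBracket
  rw [← shiftSum_neg]
  refine shiftSum_congr fun g hg => ?_
  rw [← entryBracket_shift (hM g hg)]
  simp

theorem periodizedBracket_skew {M : ℤ → ℤ → ℝ}
    (hM : ∀ g, SameSite bc N g 0 → ∀ a b, M (a + g) (b + g) = M a b) (a b u v : ℤ) :
    periodizedBracket bc N M a b u v = -periodizedBracket bc N M u v a b := by
  rw [periodizedBracket_eq hM, periodizedBracket, shiftSum, shiftSum, ← finsum_neg_distrib]
  refine finsum_congr fun g => ?_
  rw [entryBracket_skew]
  split_ifs <;> simp

/-- The brackets with entries that are not phase variables vanish: below the diagonal because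
these entries are Casimir functions, outside of the lattice because these entries are zero. -/
theorem periodizedBracket_eq_zero {M : ℤ → ℤ → ℝ} (hM : BandSupport m (IsSite bc N) M)
    {a b u v : ℤ} (hab : a ≤ b) (hab' : b ≤ a + m)
    (h : v < u ∨ ¬HasLabel bc m N (v - u).toNat u) :
    periodizedBracket bc N M a b u v = 0 := by
  unfold periodizedBracket shiftSum
  refine finsum_eq_zero_of_forall_eq_zero fun g => ?_
  split_ifs with hg
  · by_contra h0
    obtain ⟨h1, -, h2, h3⟩ := entryBracket_support hM hab hab' h0
    have hu : SameSite bc N (u + g) u := (sameSite_congr_sub (by ring)).1 hg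
    have hv : SameSite bc N (v + g) v := (sameSite_congr_sub (by ring)).1 hg
    rcases h with h | h
    · omega
    · refine h (hasLabel_iff.2 ⟨by omega, (isSite_congr hu).1 h2, ?_⟩)
      have : u + ((v - u).toNat : ℤ) = v := by omega
      rw [this]
      exact (isSite_congr hv).1 h3
  · rfl

theorem periodizedBracket_eq_sum {M : ℤ → ℤ → ℝ} (hM : BandSupport m (IsSite bc N) M)
    {a b : ℤ} (hab : a ≤ b) (hab' : b ≤ a + m) (u v : ℤ) :
    periodizedBracket bc N M a b u v =
      ∑ g ∈ Finset.Icc (a - u - (2 * m + 2)) (a - u + (2 * m + 2)),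
        if SameSite bc N g 0 then entryBracket M a b (u + g) (v + g) else 0 := by
  refine shiftSum_eq_sum _ fun g _ h0 => ?_
  have := entryBracket_support hM hab hab' h0
  rw [Finset.mem_Icc]
  omega

/-- The bracket on the phase space given by the periodized bracket of the matrix entries. -/
def bandBivector (M : Phase bc m N → ℤ → ℤ → ℝ) : Bivector bc m N := fun x p q =>
  periodizedBracket bc N (M x) p.site (p.site + p.fieldNo) q.site (q.site + q.fieldNo)

variable {M : Phase bc m N → ℤ → ℤ → ℝ} {κ : ℝ}

theorem Label.le_site_add (p : Label bc m N) : p.site ≤ p.site + p.fieldNo := by omega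

theorem Label.site_add_le (p : Label bc m N) : p.site + p.fieldNo ≤ p.site + m := by
  have := p.fieldNo_le; omega

/-- The sum over all variables in the chain rule reproduces the bracket with the entry `(u, v)`.
-/
theorem sum_bandBivector_mul (hM : IsPeriodicBand M κ) (x : Phase bc m N) (p : Label bc m N)
    (u v : ℤ) :
    ∑ r, bandBivector M x p r *
        (if u ≤ v then κ • fldL bc m N (v - u).toNat u else 0) (Pi.single r 1) =
      κ * periodizedBracket bc N (M x) p.site (p.site + p.fieldNo) u v := by
  by_cases huv : u ≤ v
  · have e : ∀ r : Label bc m N, bandBivector M x p r *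
        (if u ≤ v then κ • fldL bc m N (v - u).toNat u else 0) (Pi.single r 1) =
        if r.fieldNo = (v - u).toNat ∧ SameSite bc N u r.site then
          κ * bandBivector M x p r else 0 := fun r => by
      rw [if_pos huv, smul_apply, fldL_apply, fld_single]
      split_ifs <;> simp [mul_comm]
    simp only [e]
    by_cases h : HasLabel bc m N (v - u).toNat u
    · obtain ⟨r, hj, hk⟩ := h
      rw [sum_label_ite _ _ _ r hj hk, bandBivector, hj]
      congr 1
      have h1 : r.site = u + (r.site - u) := by ring
      have h2 : u + (r.site - u) + ((v - u).toNat : ℤ) = v + (r.site - u) := by omega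
      have h3 : SameSite bc N (r.site - u) 0 := sameSite_iff_sub.1 hk.symm
      rw [h1, h2, periodizedBracket_shift _ _ _ _ _ h3]
    · rw [sum_label_ite_of_not _ h, periodizedBracket_eq_zero (hM.band x) p.le_site_add
        p.site_add_le (Or.inr h), mul_zero]
  · rw [periodizedBracket_eq_zero (hM.band x) p.le_site_add p.site_add_le (Or.inl (by omega))]
    simp [huv]

theorem hasFDerivAt_entryBracket (hM : IsPeriodicBand M κ) (x : Phase bc m N) (c d e f : ℤ) :
    HasFDerivAt (fun y => entryBracket (M y) c d e f)
      (let l : ℤ → ℤ → Phase bc m N →L[ℝ] ℝ := fun a b =>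
        if a ≤ b then κ • fldL bc m N (b - a).toNat a else 0
      exchangeCoeff c d e f • (M x c f • l e d + M x e d • l c f) +
        twistCoeff c d e f • (M x c d • l e f + M x e f • l c d)) x :=
  (((hM.deriv x c f).mul (hM.deriv x e d)).const_mul _).add
    (((hM.deriv x c d).mul (hM.deriv x e f)).const_mul _)

theorem hasFDerivAt_bandBivector (hM : IsPeriodicBand M κ) (x : Phase bc m N)
    (q r : Label bc m N) :
    HasFDerivAt (fun y => bandBivector M y q r)
      (∑ h ∈ Finset.Icc (q.site - r.site - (2 * m + 2)) (q.site - r.site + (2 * m + 2)),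
        if SameSite bc N h 0 then
          (fderiv ℝ (fun y => entryBracket (M y) q.site (q.site + q.fieldNo) (r.site + h)
            (r.site + r.fieldNo + h)) x) else 0) x := by
  have e : (fun y => bandBivector M y q r) = fun y =>
      ∑ h ∈ Finset.Icc (q.site - r.site - (2 * m + 2)) (q.site - r.site + (2 * m + 2)),
        if SameSite bc N h 0 then entryBracket (M y) q.site (q.site + q.fieldNo) (r.site + h)
            (r.site + r.fieldNo + h) else 0 := by
    funext y
    exact periodizedBracket_eq_sum (hM.band y) q.le_site_add q.site_add_le _ _
  rw [e]
  refine HasFDerivAt.fun_sum fun h _ => ?_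
  split_ifs
  · exact (hasFDerivAt_entryBracket hM x _ _ _ _).differentiableAt.hasFDerivAt
  · exact hasFDerivAt_const _ _

/-- The nested brackets on the phase space are sums of nested brackets of matrix entries over
all relative shifts. -/
theorem nestedBracket_bandBivector (hM : IsPeriodicBand M κ) (x : Phase bc m N)
    (p q r : Label bc m N) :
    nestedBracket (bandBivector M) x p q r = κ * ∑ᶠ z : ℤ × ℤ,
      if SameSite bc N z.1 0 ∧ SameSite bc N z.2 0 then
        nestedEntryBracket (M x) (p.site + z.2) (p.site + p.fieldNo + z.2)
          q.site (q.site + q.fieldNo) (r.site + z.1) (r.site + r.fieldNo + z.1) else 0 := by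
  set a := p.site
  set b := p.site + p.fieldNo
  set c := q.site
  set d := q.site + q.fieldNo
  set e := r.site
  set f := r.site + r.fieldNo
  have hB := hM.band x
  have hab : a ≤ b := p.le_site_add
  have hab' : b ≤ a + m := p.site_add_le
  have hcd : c ≤ d := q.le_site_add
  have hcd' : d ≤ c + m := q.site_add_le
  have hef : e ≤ f := r.le_site_add
  have hef' : f ≤ e + m := r.site_add_le
  -- For a fixed shift `h` of the third entry, the chain rule turns the sum over all variables into
  -- a sum over the shifts `g` of the first entry.
  have inner : ∀ h : ℤ, ∑ u, bandBivector M x p u *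
      fderiv ℝ (fun y => entryBracket (M y) c d (e + h) (f + h)) x (Pi.single u 1) =
      κ * shiftSum bc N fun g => nestedEntryBracket (M x) (a + g) (b + g) c d (e + h) (f + h) := by
    intro h
    have e1 : ∀ u, bandBivector M x p u *
        fderiv ℝ (fun y => entryBracket (M y) c d (e + h) (f + h)) x (Pi.single u 1) =
        exchangeCoeff c d (e + h) (f + h) * (M x c (f + h) * (bandBivector M x p u *
            (if e + h ≤ d then κ • fldL bc m N (d - (e + h)).toNat (e + h) else 0)
              (Pi.single u 1)) +
          M x (e + h) d * (bandBivector M x p u *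
            (if c ≤ f + h then κ • fldL bc m N (f + h - c).toNat c else 0) (Pi.single u 1))) +
        twistCoeff c d (e + h) (f + h) * (M x c d * (bandBivector M x p u *
            (if e + h ≤ f + h then κ • fldL bc m N (f + h - (e + h)).toNat (e + h) else 0)
              (Pi.single u 1)) +
          M x (e + h) (f + h) * (bandBivector M x p u *
            (if c ≤ d then κ • fldL bc m N (d - c).toNat c else 0) (Pi.single u 1))) := fun u => by
      rw [(hasFDerivAt_entryBracket hM x _ _ _ _).fderiv]
      simp only [add_apply, smul_apply, smul_eq_mul]
      ring
    simp only [e1, Finset.sum_add_distrib, ← Finset.mul_sum, sum_bandBivector_mul hM]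
    have hfin : ∀ (A : ℝ) (u v : ℤ), (Function.support fun g : ℤ =>
        A * if SameSite bc N g 0 then entryBracket (M x) (a + g) (b + g) u v else 0).Finite := by
      intro A u v
      refine (Set.finite_Icc (u - a - (m + 1)) (u - a + (m + 1))).subset fun g hg => ?_
      have h0 : entryBracket (M x) (a + g) (b + g) u v ≠ 0 := by
        intro h0
        simp [h0] at hg
      have := entryBracket_support hB (by omega) (by omega) h0
      rw [Set.mem_Icc]
      omega
    have e2 : ∀ (A : ℝ) (u v : ℤ), A * periodizedBracket bc N (M x) a b u v =
        ∑ᶠ g : ℤ, A * if SameSite bc N g 0 then entryBracket (M x) (a + g) (b + g) u v else 0 := by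
      intro A u v
      rw [periodizedBracket_eq (hM.shift x), shiftSum, mul_finsum]
    have e3 : ∀ A B C D X Y : ℝ, ∀ u v u' v' w z w' z' : ℤ,
        X * (A * (κ * periodizedBracket bc N (M x) a b u v) +
          B * (κ * periodizedBracket bc N (M x) a b u' v')) +
        Y * (C * (κ * periodizedBracket bc N (M x) a b w z) +
          D * (κ * periodizedBracket bc N (M x) a b w' z')) =
        κ * ((X * A * periodizedBracket bc N (M x) a b u v +
          X * B * periodizedBracket bc N (M x) a b u' v') +
        (Y * C * periodizedBracket bc N (M x) a b w z +
          Y * D * periodizedBracket bc N (M x) a b w' z')) := by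
      intros; ring
    rw [e3]
    simp only [e2]
    rw [← finsum_add_distrib (hfin _ _ _) (hfin _ _ _),
      ← finsum_add_distrib (hfin _ _ _) (hfin _ _ _),
      ← finsum_add_distrib (((hfin _ _ _).union (hfin _ _ _)).subset
          (Function.support_add _ _))
        (((hfin _ _ _).union (hfin _ _ _)).subset (Function.support_add _ _)), shiftSum]
    congr 1
    refine finsum_congr fun g => ?_
    split_ifs
    · unfold nestedEntryBracket; ring
    · simp
  have hsupp : (Function.support fun z : ℤ × ℤ =>
      if SameSite bc N z.1 0 ∧ SameSite bc N z.2 0 then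
        nestedEntryBracket (M x) (a + z.2) (b + z.2) c d (e + z.1) (f + z.1) else 0) ⊆
      Set.Icc (c - e - (2 * m + 2)) (c - e + (2 * m + 2)) ×ˢ
        Set.Icc (c - a - (4 * m + 4)) (c - a + (4 * m + 4)) := by
    intro z hz
    have h0 : nestedEntryBracket (M x) (a + z.2) (b + z.2) c d (e + z.1) (f + z.1) ≠ 0 := by
      intro h0
      simp [h0] at hz
    have h1 := nestedEntryBracket_support hB (by omega) (by omega) hcd hcd' (by omega) (by omega) h0
    rw [abs_le, abs_le] at h1
    simp only [Set.mem_prod, Set.mem_Icc]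
    omega
  rw [finsum_curry _ (((Set.finite_Icc _ _).prod (Set.finite_Icc _ _)).subset hsupp)]
  have e4 : ∀ h : ℤ, (∑ᶠ g : ℤ, if SameSite bc N (h, g).1 0 ∧ SameSite bc N (h, g).2 0 then
        nestedEntryBracket (M x) (a + (h, g).2) (b + (h, g).2) c d (e + (h, g).1) (f + (h, g).1)
        else 0) =
      if SameSite bc N h 0 then shiftSum bc N fun g =>
        nestedEntryBracket (M x) (a + g) (b + g) c d (e + h) (f + h) else 0 := fun h => by
    split_ifs with hh
    · exact finsum_congr fun g => by simp [hh]
    · exact finsum_eq_zero_of_forall_eq_zero fun g => by simp [hh]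
  rw [finsum_congr e4, finsum_eq_sum_of_support_subset
    (s := Finset.Icc (c - e - (2 * m + 2)) (c - e + (2 * m + 2))), nestedBracket,
    (hasFDerivAt_bandBivector hM x q r).fderiv]
  · simp only [sum_apply, Finset.mul_sum]
    rw [Finset.sum_comm]
    refine Finset.sum_congr rfl fun h _ => ?_
    split_ifs with hh
    · exact inner h
    · simp
  · intro h hh
    rw [Function.mem_support, ← e4] at hh
    obtain ⟨g, hg⟩ : ∃ g, (if SameSite bc N (h, g).1 0 ∧ SameSite bc N (h, g).2 0 then
        nestedEntryBracket (M x) (a + (h, g).2) (b + (h, g).2) c d (e + (h, g).1) (f + (h, g).1)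
        else 0) ≠ 0 := by
      by_contra hcon
      push Not at hcon
      exact hh (finsum_eq_zero_of_forall_eq_zero hcon)
    have := hsupp hg
    simpa using this.1

/-- The reindexing of pairs of shifts that corresponds to a cyclic permutation of three
intervals. -/
def cyclicShift : ℤ × ℤ ≃ ℤ × ℤ where
  toFun z := (-z.2, z.1 - z.2)
  invFun z := (z.2 - z.1, -z.1)
  left_inv z := by ext <;> simp
  right_inv z := by ext <;> simp

/-- After reindexing the sums over shifts, the Jacobi identity holds for each pair of shifts, as
it holds for the matrix entries. -/
theorem coordJacobi_bandBivector (hM : IsPeriodicBand M κ) (x : Phase bc m N) :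
    CoordJacobi (bandBivector M) x := by
  intro p q r
  have hfin : ∀ p q r : Label bc m N, (Function.support fun z : ℤ × ℤ =>
      if SameSite bc N z.1 0 ∧ SameSite bc N z.2 0 then
        nestedEntryBracket (M x) (p.site + z.2) (p.site + p.fieldNo + z.2)
          q.site (q.site + q.fieldNo) (r.site + z.1) (r.site + r.fieldNo + z.1) else 0).Finite := by
    intro p q r
    refine ((Set.finite_Icc (q.site - r.site - (2 * m + 2)) (q.site - r.site + (2 * m + 2))).prod
      (Set.finite_Icc (q.site - p.site - (4 * m + 4)) (q.site - p.site + (4 * m + 4)))).subset ?_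
    intro z hz
    have h0 : nestedEntryBracket (M x) (p.site + z.2) (p.site + p.fieldNo + z.2)
        q.site (q.site + q.fieldNo) (r.site + z.1) (r.site + r.fieldNo + z.1) ≠ 0 := by
      intro h0
      simp [h0] at hz
    have hp := p.fieldNo_le
    have hq := q.fieldNo_le
    have hr := r.fieldNo_le
    have h1 := nestedEntryBracket_support (hM.band x) (by omega) (by omega) (by omega) (by omega)
      (by omega) (by omega) h0
    rw [abs_le, abs_le] at h1
    simp only [Set.mem_prod, Set.mem_Icc]
    omega
  rw [nestedBracket_bandBivector hM, nestedBracket_bandBivector hM, nestedBracket_bandBivector hM,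
    ← mul_add, ← mul_add]
  rw [← finsum_comp_equiv cyclicShift (f := fun z : ℤ × ℤ =>
      if SameSite bc N z.1 0 ∧ SameSite bc N z.2 0 then
        nestedEntryBracket (M x) (p.site + z.2) (p.site + p.fieldNo + z.2)
          q.site (q.site + q.fieldNo) (r.site + z.1) (r.site + r.fieldNo + z.1) else 0),
    ← finsum_comp_equiv cyclicShift.symm (f := fun z : ℤ × ℤ =>
      if SameSite bc N z.1 0 ∧ SameSite bc N z.2 0 then
        nestedEntryBracket (M x) (r.site + z.2) (r.site + r.fieldNo + z.2)
          p.site (p.site + p.fieldNo) (q.site + z.1) (q.site + q.fieldNo + z.1) else 0),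
    ← finsum_add_distrib, ← finsum_add_distrib]
  · rw [mul_eq_zero]; right
    refine finsum_eq_zero_of_forall_eq_zero fun z => ?_
    have e1 : (SameSite bc N (cyclicShift z).1 0 ∧ SameSite bc N (cyclicShift z).2 0) ↔
        (SameSite bc N z.1 0 ∧ SameSite bc N z.2 0) := by
      change SameSite bc N (-z.2) 0 ∧ SameSite bc N (z.1 - z.2) 0 ↔ _
      constructor
      · rintro ⟨h1, h2⟩
        exact ⟨by simpa using h2.add_zero h1.neg_zero, by simpa using h1.neg_zero⟩
      · rintro ⟨h1, h2⟩
        exact ⟨h2.neg_zero, by simpa [sub_eq_add_neg] using h1.add_zero h2.neg_zero⟩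
    have e2 : (SameSite bc N (cyclicShift.symm z).1 0 ∧ SameSite bc N (cyclicShift.symm z).2 0) ↔
        (SameSite bc N z.1 0 ∧ SameSite bc N z.2 0) := by
      change SameSite bc N (z.2 - z.1) 0 ∧ SameSite bc N (-z.1) 0 ↔ _
      constructor
      · rintro ⟨h1, h2⟩
        exact ⟨by simpa using h2.neg_zero, by simpa using h1.add_zero h2.neg_zero⟩
      · rintro ⟨h1, h2⟩
        exact ⟨by simpa [sub_eq_add_neg] using h2.add_zero h1.neg_zero, h1.neg_zero⟩
    simp only [e1, e2]
    split_ifs with hz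
    · have s1 := nestedEntryBracket_shift (hM.shift x z.2 hz.2) (p.site + (z.1 - z.2))
        (p.site + p.fieldNo + (z.1 - z.2)) q.site (q.site + q.fieldNo) (r.site + -z.2)
        (r.site + r.fieldNo + -z.2)
      have s2 := nestedEntryBracket_shift (hM.shift x z.1 hz.1) (r.site + -z.1)
        (r.site + r.fieldNo + -z.1) p.site (p.site + p.fieldNo) (q.site + (z.2 - z.1))
        (q.site + q.fieldNo + (z.2 - z.1))
      have c := nestedEntryBracket_cyclic (M x) (p.site + z.1) (p.site + p.fieldNo + z.1)
        (q.site + z.2) (q.site + q.fieldNo + z.2) r.site (r.site + r.fieldNo)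
      change nestedEntryBracket (M x) (p.site + (z.1 - z.2)) (p.site + p.fieldNo + (z.1 - z.2))
          q.site (q.site + q.fieldNo) (r.site + -z.2) (r.site + r.fieldNo + -z.2) + _ +
        nestedEntryBracket (M x) (r.site + -z.1)
          (r.site + r.fieldNo + -z.1) p.site (p.site + p.fieldNo) (q.site + (z.2 - z.1))
          (q.site + q.fieldNo + (z.2 - z.1)) = 0
      rw [← s1, ← s2]
      simp only [add_assoc, sub_add_cancel, neg_add_cancel, add_zero] at c ⊢
      linarith
    · simp
  · exact (((hfin p q r).preimage cyclicShift.injective.injOn).union (hfin q r p)).subset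
      (Function.support_add _ _)
  · exact (hfin _ _ _).preimage cyclicShift.symm.injective.injOn
  · exact (hfin _ _ _).preimage cyclicShift.injective.injOn
  · exact hfin _ _ _

/-- The periodized bracket of the entries of a band matrix is a Poisson bracket. -/
theorem isPoisson_bandBivector (hM : IsPeriodicBand M κ) (C : ℝ) :
    IsPoisson fun x p q => C * bandBivector M x p q := by
  have hsm : ∀ p q, ContDiff ℝ ∞ fun x => bandBivector M x p q := by
    intro p q
    have e : (fun y => bandBivector M y p q) = _ := funext fun y =>
      periodizedBracket_eq_sum (hM.band y) p.le_site_add p.site_add_le _ _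
    rw [e]
    refine ContDiff.sum fun h _ => ?_
    split_ifs
    · exact (contDiff_const.mul ((hM.smooth _ _).mul (hM.smooth _ _))).add
        (contDiff_const.mul ((hM.smooth _ _).mul (hM.smooth _ _)))
    · exact contDiff_const
  refine isPoisson_of_coordJacobi (fun p q => contDiff_const.mul (hsm p q)) (fun x p q => ?_)
    fun x p q r => ?_
  · rw [bandBivector, periodizedBracket_skew (hM.shift x), mul_neg]; rfl
  · have e : (fun x p q => C * bandBivector M x p q) =
        C • bandBivector M + (0 : ℝ) • bandBivector M := by
      funext x p q; simp
    rw [e]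
    simp only [nestedBracket_linear_combination hsm hsm]
    linear_combination C ^ 2 * coordJacobi_bandBivector hM x p q r

end Periodization

/-! ### The brackets of the lattices as periodized brackets -/

section Lists

variable {bc : Boundary} {m N : ℕ} {α : ℝ}

/-- The contribution of the `i`-th field at `k` and the `j`-th field at `l` to the bracket with
the list `h` on the infinite lattice. -/
def listTerm (m : ℕ) (h : ℕ → ℕ → ℤ → ℕ → ℝ) (i : ℕ) (k : ℤ) (j : ℕ) (l : ℤ) : ℝ :=
  (if k ≤ l ∧ l ≤ k + m + 1 then h i j k (l - k).toNat else 0) -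
    if l ≤ k ∧ k ≤ l + m + 1 then h j i l (k - l).toNat else 0

theorem listTerm_skew (h : ℕ → ℕ → ℤ → ℕ → ℝ) (i : ℕ) (k : ℤ) (j : ℕ) (l : ℤ) :
    listTerm m h i k j l = -listTerm m h j l i k := by
  unfold listTerm; ring

theorem shiftSum_add {f f' : ℤ → ℝ} {u v : ℤ} (h : ∀ g, f g ≠ 0 → u ≤ g ∧ g ≤ v)
    (h' : ∀ g, f' g ≠ 0 → u ≤ g ∧ g ≤ v) :
    shiftSum bc N (fun g => f g + f' g) = shiftSum bc N f + shiftSum bc N f' := by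
  rw [shiftSum_eq_sum (Finset.Icc u v), shiftSum_eq_sum (Finset.Icc u v),
    shiftSum_eq_sum (Finset.Icc u v), ← Finset.sum_add_distrib]
  · exact Finset.sum_congr rfl fun g _ => by split_ifs <;> simp
  · exact fun g _ hg => Finset.mem_Icc.2 (h' g hg)
  · exact fun g _ hg => Finset.mem_Icc.2 (h g hg)
  · intro g _ hg
    rw [Finset.mem_Icc]
    by_cases h0 : f g = 0
    · exact h' g fun h1 => hg (by simp [h0, h1])
    · exact h g h0

theorem mul_shiftSum (A : ℝ) (f : ℤ → ℝ) :
    A * shiftSum bc N f = shiftSum bc N fun g => A * f g := by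
  unfold shiftSum
  rw [mul_finsum]
  exact finsum_congr fun g => by split_ifs <;> simp

/-- A bracket given by a list is the sum, over all shifts of the second variable, of the brackets
with the same list on the infinite lattice; the distance `ℓ` of the two sites determines the
shift. -/
theorem bivectorOfList_eq (h : Phase bc m N → ℕ → ℕ → ℤ → ℕ → ℝ) (y : Phase bc m N)
    (hh : ∀ g, SameSite bc N g 0 → ∀ i j k l, h y i j (k + g) l = h y i j k l)
    (p q : Label bc m N) :
    bivectorOfList h y p q =
      shiftSum bc N fun g => listTerm m (h y) p.fieldNo p.site q.fieldNo (q.site + g) := by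
  unfold listTerm bivectorOfList
  simp only [sub_eq_add_neg]
  rw [shiftSum_add (u := p.site - q.site - (m + 1)) (v := p.site - q.site + (m + 1)),
    Finset.sum_add_distrib]
  · congr 1
    · rw [shiftSum_eq_sum ((Finset.range (m + 2)).image fun l : ℕ => p.site - q.site + l),
        Finset.sum_image]
      · refine Finset.sum_congr rfl fun l hl => ?_
        rw [Finset.mem_range] at hl
        refine if_congr (sameSite_congr_sub (by ring)) ?_ rfl
        rw [if_pos (by omega)]
        congr 1
        omega
      · intro l _ l' _ h
        simpa using h
      · intro g _ hg
        rw [Finset.mem_image]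
        by_cases hc : p.site ≤ q.site + g ∧ q.site + g ≤ p.site + m + 1
        · exact ⟨(q.site + g - p.site).toNat, Finset.mem_range.2 (by omega), by omega⟩
        · rw [if_neg hc] at hg
          exact absurd rfl hg
    · rw [shiftSum_eq_sum ((Finset.range (m + 2)).image fun l : ℕ => p.site - q.site - l),
        Finset.sum_image]
      · refine Finset.sum_congr rfl fun l hl => ?_
        rw [Finset.mem_range] at hl
        have e : SameSite bc N (q.site + l) p.site ↔
            SameSite bc N (p.site - q.site - l) 0 := by
          rw [sameSite_comm]; exact sameSite_congr_sub (by ring)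
        by_cases hs : SameSite bc N (p.site - q.site - l) 0
        · rw [if_pos (e.2 hs), if_pos hs, if_pos (by omega), hh _ hs]
          congr 2
          omega
        · rw [if_neg (fun h' => hs (e.1 h')), if_neg hs, neg_zero]
      · intro l _ l' _ h
        simpa using h
      · intro g _ hg
        rw [Finset.mem_image]
        by_cases hc : q.site + g ≤ p.site ∧ p.site ≤ q.site + g + m + 1
        · exact ⟨(p.site - (q.site + g)).toNat, Finset.mem_range.2 (by omega), by omega⟩
        · rw [if_neg hc] at hg
          exact absurd neg_zero hg
  · intro g hg
    have := (ite_ne_right_iff.1 hg).1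
    omega
  · intro g hg
    have := (ite_ne_right_iff.1 (neg_ne_zero.1 hg)).1
    omega

/-- The bracket of the `0`-th field at one site with itself is irrelevant. -/
theorem bivectorOfList_congr {h h' : Phase bc m N → ℕ → ℕ → ℤ → ℕ → ℝ} {y : Phase bc m N}
    (hh : ∀ i j k l, ¬(i = 0 ∧ j = 0 ∧ l = 0) → h y i j k l = h' y i j k l)
    (p q : Label bc m N) : bivectorOfList h y p q = bivectorOfList h' y p q := by
  unfold bivectorOfList
  refine Finset.sum_congr rfl fun l _ => ?_
  by_cases hc : p.fieldNo = 0 ∧ q.fieldNo = 0 ∧ l = 0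
  · obtain ⟨hp, hq, rfl⟩ := hc
    by_cases hs : SameSite bc N p.site q.site
    · obtain rfl := Label.ext_of_sameSite (hp.trans hq.symm) hs
      simp
    · have hs' : ¬SameSite bc N q.site p.site := fun h => hs h.symm
      simp [hs, hs']
  · rw [hh _ _ _ _ hc, hh _ _ _ _ fun h => hc ⟨h.2.1, h.1, h.2.2⟩]

/-- The list of the matrix of the cubic bracket in the moving frame. Up to the factors
`1 + α d_{k+i}` it coincides with the list of the linear bracket. -/
def cubicList (α : ℝ) (y : Phase bc m N) (i j : ℕ) (k : ℤ) (l : ℕ) : ℝ :=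
  (if l = i ∧ ¬(i = 0 ∧ j = 0) then -(fld y (i + j) k * (1 + α * fld y 0 (k + i))) else 0) +
    if l = i + 1 then -(α * fld y (i + j + 1) k) else 0

/-- The list in the definition of the quadratic bracket. -/
def quadraticList (α : ℝ) (x : Phase bc m N) (i j : ℕ) (k : ℤ) (l : ℕ) : ℝ :=
  if i = 0 ∧ j = 0 then 0
  else if i = 0 then
    (if l = 0 then -(fld x j k * (1 + α * fld x 0 k)) else 0)
  else if j = 0 then
    (if l = i then -(fld x i k * (1 + α * fld x 0 (k + i))) else 0)
  else if l = i then
    -fld x (i + j) k - α * (fld x i k * fld x j (k + i))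
  else if 1 ≤ l ∧ l < i ∧ i < l + j then
    -(α * (fld x i k * fld x j (k + l))) + α * (fld x (j + l) k * fld x (i - l) (k + l))
  else 0

theorem quadraticBracket_eq : quadraticBracket bc m N α = bivectorOfList (quadraticList α) := rfl

/-- The band matrix `s U + t L`, where `L` has the diagonal entries `1 + α d_k` and the
subdiagonal entries `α`, and `U` is unipotent with the entries `-α c⁽ʲ⁾_k` above the diagonal. -/
def bandPlus (α s t : ℝ) (y : Phase bc m N) (a b : ℤ) : ℝ :=
  if IsSite bc N a ∧ IsSite bc N b then
    if b = a - 1 then t * α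
    else if b = a then s + t * (1 + α * fld y 0 a)
    else if a < b then -(s * α * fld y (b - a).toNat a)
    else 0
  else 0

/-- The band matrix `s P + t V` in the old variables; `P` has the entries `1 - α b_k` on the
diagonal and `-α a⁽ʲ⁾_k` above it, and `V` has the diagonal entries `1` and
the subdiagonal entries `α`. -/
def bandMinus (α s t : ℝ) (x : Phase bc m N) (a b : ℤ) : ℝ :=
  if IsSite bc N a ∧ IsSite bc N b then
    if b = a - 1 then t * α
    else if b = a then s * (1 - α * fld x 0 a) + t
    else if a < b then -(s * α * fld x (b - a).toNat a)
    else 0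
  else 0

theorem fld_toNat_of_not (y : Phase bc m N) {a b : ℤ} (hab : a ≤ b)
    (h : ¬(IsSite bc N a ∧ IsSite bc N b)) : fld y (b - a).toNat a = 0 := by
  refine fld_of_not y fun h' => h ?_
  have := hasLabel_iff.1 h'
  have e : a + ((b - a).toNat : ℤ) = b := by omega
  rw [e] at this
  exact this.2

theorem bandSupport_bandPlus (s t : ℝ) (y : Phase bc m N) :
    BandSupport m (IsSite bc N) (bandPlus α s t y) := by
  intro a b h
  unfold bandPlus at h
  split_ifs at h with h1 h2 h3 h4
  · exact ⟨by omega, h1⟩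
  · exact ⟨by omega, h1⟩
  · refine ⟨?_, h1⟩
    have : (b - a).toNat ≤ m := by
      by_contra h5
      rw [fld_of_lt y a (by omega)] at h
      simp at h
    omega
  · exact absurd rfl h
  · exact absurd rfl h

/-- In the old variables the entries of the band matrices are affine functions, and those below
the diagonal are constant. -/
theorem isPeriodicBand_bandMinus (s t : ℝ) :
    IsPeriodicBand (bandMinus (bc := bc) (m := m) (N := N) α s t) (-(s * α)) where
  band := by
    intro x a b h
    unfold bandMinus at h
    split_ifs at h with h1 h2 h3 h4
    · exact ⟨by omega, h1⟩
    · exact ⟨by omega, h1⟩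
    · refine ⟨?_, h1⟩
      have : (b - a).toNat ≤ m := by
        by_contra h5
        rw [fld_of_lt x a (by omega)] at h
        simp at h
      omega
    · exact absurd rfl h
    · exact absurd rfl h
  shift := by
    intro x g hg a b
    have ha : SameSite bc N (a + g) a := (sameSite_congr_sub (by ring)).1 hg
    have hb : SameSite bc N (b + g) b := (sameSite_congr_sub (by ring)).1 hg
    unfold bandMinus
    rw [isSite_congr ha, isSite_congr hb, fld_congr x _ ha, fld_congr x _ ha]
    have e1 : b + g = a + g - 1 ↔ b = a - 1 := by omega
    have e2 : b + g = a + g ↔ b = a := by omega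
    have e3 : a + g < b + g ↔ a < b := by omega
    have e4 : b + g - (a + g) = b - a := by ring
    simp only [e1, e2, e3, e4]
  smooth := by
    intro a b
    unfold bandMinus
    split_ifs
    · exact contDiff_const
    · exact (contDiff_const.mul (contDiff_const.sub (contDiff_const.mul
        (contDiff_fld 0 a)))).add contDiff_const
    · exact (contDiff_const.mul (contDiff_fld _ a)).neg
    · exact contDiff_const
    · exact contDiff_const
  deriv := by
    intro x a b
    by_cases hab : a ≤ b
    · rw [if_pos hab]
      by_cases hs : IsSite bc N a ∧ IsSite bc N b
      · rcases hab.eq_or_lt with rfl | hlt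
        · have e : (fun y : Phase bc m N => bandMinus α s t y a a) =
              fun y => s * (1 - α * fld y 0 a) + t := by
            funext y; rw [bandMinus, if_pos hs, if_neg (by omega), if_pos rfl]
          rw [e]
          have h := ((((hasFDerivAt_fld 0 a x).const_mul α).const_sub 1).const_mul s).add_const t
          refine h.congr_fderiv ?_
          ext u
          simp [mul_assoc]
        · have e : (fun y : Phase bc m N => bandMinus α s t y a b) =
              fun y => -(s * α * fld y (b - a).toNat a) := by
            funext y
            rw [bandMinus, if_pos hs, if_neg (by omega), if_neg (by omega), if_pos hlt]
          rw [e]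
          refine ((hasFDerivAt_fld _ a x).const_mul (s * α)).neg.congr_fderiv ?_
          ext u
          simp
      · have e : fldL bc m N (b - a).toNat a = 0 := by
          ext u
          exact fld_toNat_of_not _ hab hs
        rw [e, smul_zero]
        have e : (fun y : Phase bc m N => bandMinus α s t y a b) = fun _ => 0 := by
          funext y; rw [bandMinus, if_neg hs]
        rw [e]
        exact hasFDerivAt_const _ _
    · rw [if_neg hab]
      have e : ∀ y : Phase bc m N, bandMinus α s t y a b = bandMinus α s t x a b := by
        intro y
        unfold bandMinus
        rw [if_neg (show ¬b = a by omega), if_neg (show ¬b = a by omega),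
          if_neg (show ¬a < b by omega), if_neg (show ¬a < b by omega)]
      exact (hasFDerivAt_const _ x).congr_of_eventuallyEq (Filter.Eventually.of_forall e)

theorem bandPlus_shift (s t : ℝ) (y : Phase bc m N) {g : ℤ} (hg : SameSite bc N g 0) (a b : ℤ) :
    bandPlus α s t y (a + g) (b + g) = bandPlus α s t y a b := by
  have ha : SameSite bc N (a + g) a := (sameSite_congr_sub (by ring)).1 hg
  have hb : SameSite bc N (b + g) b := (sameSite_congr_sub (by ring)).1 hg
  unfold bandPlus
  rw [isSite_congr ha, isSite_congr hb, fld_congr y _ ha, fld_congr y _ ha]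
  have e1 : b + g = a + g - 1 ↔ b = a - 1 := by omega
  have e2 : b + g = a + g ↔ b = a := by omega
  have e3 : a + g < b + g ↔ a < b := by omega
  have e4 : b + g - (a + g) = b - a := by ring
  simp only [e1, e2, e3, e4]

/-- A non-vanishing sequence on `ℤ` consists of the quotients of consecutive terms of another one.
-/
theorem exists_potential {D : ℤ → ℝ} (hD : ∀ k, D k ≠ 0) :
    ∃ Δ : ℤ → ℝ, (∀ k, Δ k ≠ 0) ∧ ∀ k, Δ (k + 1) = Δ k * D k := by
  refine ⟨fun k => (∏ i ∈ Finset.range k.toNat, D i) /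
    ∏ i ∈ Finset.range (-k).toNat, D (-(i + 1)), fun k => ?_, fun k => ?_⟩
  · exact div_ne_zero (Finset.prod_ne_zero_iff.2 fun i _ => hD _)
      (Finset.prod_ne_zero_iff.2 fun i _ => hD _)
  · simp only
    rcases le_or_gt 0 k with hk | hk
    · have e1 : (k + 1).toNat = k.toNat + 1 := by omega
      have e2 : (-(k + 1)).toNat = 0 := by omega
      have e3 : (-k).toNat = 0 := by omega
      have e4 : ((k.toNat : ℕ) : ℤ) = k := by omega
      rw [e1, e2, e3, Finset.prod_range_succ, e4]
      simp
    · have e1 : (k + 1).toNat = 0 := by omega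
      have e2 : k.toNat = 0 := by omega
      have e3 : (-k).toNat = (-(k + 1)).toNat + 1 := by omega
      have e4 : -((((-(k + 1)).toNat : ℕ) : ℤ) + 1) = k := by omega
      rw [e1, e2, e3, Finset.prod_range_succ, e4]
      have := hD k
      have h : ∏ i ∈ Finset.range (-(k + 1)).toNat, D (-((i : ℤ) + 1)) ≠ 0 :=
        Finset.prod_ne_zero_iff.2 fun i _ => hD _
      field_simp

/-- Products of consecutive terms telescope. -/
theorem prod_eq_potential {D Δ : ℤ → ℝ} (hΔ : ∀ k, Δ k ≠ 0) (hD : ∀ k, Δ (k + 1) = Δ k * D k)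
    (k : ℤ) (n : ℕ) : ∏ i ∈ Finset.range n, D (k + i) = Δ (k + n) / Δ k := by
  induction n with
  | zero => simp [hΔ k]
  | succ n ih =>
    rw [Finset.prod_range_succ, ih]
    push_cast
    rw [← add_assoc, hD]
    ring

end Lists

/-! ### The brackets in terms of band matrices -/

section Identification

variable {bc : Boundary} {m N : ℕ} {α : ℝ}

theorem siteProd_eq_potential {y : Phase bc m N} {Δ : ℤ → ℝ} (hΔ : ∀ k, Δ k ≠ 0)
    (hD : ∀ k, Δ (k + 1) = Δ k * (1 + α * fld y 0 k)) (p : Label bc m N) {g : ℤ}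
    (hg : SameSite bc N g 0) :
    siteProd α y p = Δ (p.site + p.fieldNo + g + 1) / Δ (p.site + g) := by
  have h := prod_eq_potential (D := fun k => 1 + α * fld y 0 k) hΔ hD (p.site + g) (p.fieldNo + 1)
  have e : p.site + (p.fieldNo : ℤ) + g + 1 = p.site + g + ((p.fieldNo + 1 : ℕ) : ℤ) := by
    push_cast; ring
  rw [e, ← h]
  refine Finset.prod_congr rfl fun i _ => ?_
  rw [fld_congr y 0 (k := p.site + g + i) (l := p.site + i)]
  exact (sameSite_congr_sub (by ring)).1 hg

/-- Rescaling by `siteProd` is conjugation of the band matrix by a diagonal matrix. -/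
theorem bandPlus_changeVars (s t : ℝ) {x : Phase bc m N} (hx : x ∈ domMinus bc m N α)
    {Δ : ℤ → ℝ} (hΔ : ∀ k, Δ k ≠ 0)
    (hD : ∀ k, Δ (k + 1) = Δ k * (1 + α * fld (changeVars α x) 0 k)) (a b : ℤ) :
    bandPlus α s t (changeVars α x) a b = Δ (b + 1) / Δ a * bandMinus α s t x a b := by
  have hx' := mem_domMinus_iff.1 hx
  unfold bandPlus bandMinus
  split_ifs with h1 h2 h3 h4
  · rw [h2, sub_add_cancel, div_self (hΔ a), one_mul]
  · subst h3
    rw [hD b, mul_div_cancel_left₀ _ (hΔ b), one_add_fld_changeVars hx]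
    have := hx' b
    field_simp
  · rw [fld_changeVars]
    have h := prod_eq_potential hΔ hD a ((b - a).toNat + 1)
    have e : a + (((b - a).toNat + 1 : ℕ) : ℤ) = b + 1 := by omega
    rw [e] at h
    simp only [one_add_fld_changeVars hx, Finset.prod_inv_distrib] at h
    rw [← h, div_eq_mul_inv]
    ring
  · simp
  · simp

/-- The bracket of matrix entries is homogeneous in each row and in each column, hence it is
compatible with the conjugation by diagonal matrices. -/
theorem bandBivector_changeVars (s t : ℝ) {x : Phase bc m N} (hx : x ∈ domMinus bc m N α)
    (p q : Label bc m N) :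
    bandBivector (bandPlus α s t) (changeVars α x) p q =
      siteProd α (changeVars α x) p * siteProd α (changeVars α x) q *
        bandBivector (bandMinus α s t) x p q := by
  obtain ⟨Δ, hΔ, hD⟩ := exists_potential (D := fun k => 1 + α * fld (changeVars α x) 0 k)
    fun k => by
      rw [one_add_fld_changeVars hx]
      exact inv_ne_zero (mem_domMinus_iff.1 hx k)
  unfold bandBivector periodizedBracket
  rw [mul_shiftSum]
  refine shiftSum_congr fun g hg => ?_
  rw [siteProd_eq_potential hΔ hD q hg, siteProd_eq_potential hΔ hD p (g := 0) (sameSite_refl _)]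
  simp only [entryBracket, bandPlus_changeVars s t hx hΔ hD, add_zero]
  ring

/-- Rescaling by `siteProd` turns the linear bracket into the list of the cubic bracket: the
products of factors `1 + α d_k` over the intervals of `{a⁽ⁱ⁾_k, a⁽ʲ⁾_{k+i}}` have exactly the
factor at the common end point `k + i` in excess of the product over the union `[k, k + i + j]`,
and for the adjacent intervals of `{a⁽ⁱ⁾_k, a⁽ʲ⁾_{k+i+1}}` there is no excess. -/
theorem cubicList_changeVars {x : Phase bc m N} (hx : x ∈ domMinus bc m N α) (p q : Label bc m N) :
    bivectorOfList (cubicList α) (changeVars α x) p q =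
      siteProd α (changeVars α x) p * siteProd α (changeVars α x) q *
        linearBracket bc m N (-α) x p q := by
  obtain ⟨Δ, hΔ, hD⟩ := exists_potential (D := fun k => 1 + α * fld (changeVars α x) 0 k)
    fun k => by
      rw [one_add_fld_changeVars hx]
      exact inv_ne_zero (mem_domMinus_iff.1 hx k)
  -- The condition `(i, j) ≠ (0, 0)` may be dropped, since the additional terms cancel by
  -- skew-symmetry.
  rw [bivectorOfList_congr (h' := fun y i j k l =>
    (if l = i then -(fld y (i + j) k * (1 + α * fld y 0 (k + i))) else 0) +
      if l = i + 1 then -(α * fld y (i + j + 1) k) else 0)]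
  · have hf : ∀ (j : ℕ) (k : ℤ), fld (changeVars α x) j k = Δ (k + j + 1) / Δ k * fld x j k := by
      intro j k
      have h := prod_eq_potential (D := fun k => 1 + α * fld (changeVars α x) 0 k) hΔ hD k (j + 1)
      have e : k + (j : ℤ) + 1 = k + ((j + 1 : ℕ) : ℤ) := by push_cast; ring
      rw [e, ← h, fld_changeVars]
      simp only [one_add_fld_changeVars hx, Finset.prod_inv_distrib]
      rw [div_eq_inv_mul]
    have key : ∀ (p q : Label bc m N) (l : ℕ), SameSite bc N (p.site + l) q.site →
        (if l = p.fieldNo then -(fld (changeVars α x) (p.fieldNo + q.fieldNo) p.site *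
            (1 + α * fld (changeVars α x) 0 (p.site + p.fieldNo))) else 0) +
          (if l = p.fieldNo + 1 then
            -(α * fld (changeVars α x) (p.fieldNo + q.fieldNo + 1) p.site) else 0) =
        siteProd α (changeVars α x) p * siteProd α (changeVars α x) q *
          ((if l = p.fieldNo then -fld x (p.fieldNo + q.fieldNo) p.site else 0) +
            if l = p.fieldNo + 1 then -α * fld x (p.fieldNo + q.fieldNo + 1) p.site else 0) := by
      intro p q l hl
      rw [siteProd_eq_potential hΔ hD q (g := p.site + l - q.site) (sameSite_iff_sub.1 hl),
        siteProd_eq_potential hΔ hD p (g := 0) (sameSite_refl _)]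
      have e1 : q.site + (p.site + l - q.site) = p.site + l := by ring
      have e2 : q.site + (q.fieldNo : ℤ) + (p.site + l - q.site) + 1 =
        p.site + l + q.fieldNo + 1 := by ring
      have h0 := hΔ p.site
      rw [e1, e2, hf (p.fieldNo + q.fieldNo), hf (p.fieldNo + q.fieldNo + 1), add_zero, add_zero]
      by_cases h1 : l = p.fieldNo
      · subst h1
        rw [if_pos rfl, if_pos rfl, if_neg (by omega), if_neg (by omega),
          hD (p.site + p.fieldNo)]
        have h1 := hΔ (p.site + p.fieldNo)
        push_cast
        rw [← add_assoc p.site]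
        field_simp
        ring
      · rw [if_neg h1, if_neg h1]
        by_cases h2 : l = p.fieldNo + 1
        · subst h2
          have h1 := hΔ (p.site + p.fieldNo + 1)
          rw [if_pos rfl, if_pos rfl]
          push_cast
          have e3 : p.site + ((p.fieldNo : ℤ) + 1) = p.site + p.fieldNo + 1 := by ring
          have e4 : p.site + ((p.fieldNo : ℤ) + q.fieldNo + 1) + 1 =
            p.site + p.fieldNo + 1 + q.fieldNo + 1 := by ring
          rw [e3, e4]
          field_simp
          ring
        · simp [h2]
    unfold linearBracket bivectorOfList
    rw [Finset.mul_sum]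
    refine Finset.sum_congr rfl fun l _ => ?_
    rw [mul_sub]
    congr 1
    · split_ifs with hs
      · exact key p q l hs
      · simp
    · split_ifs with hs
      · rw [mul_comm (siteProd α (changeVars α x) p)]
        exact key q p l hs
      · simp
  · intro i j k l h
    simp only [cubicList]
    congr 1
    refine if_congr ?_ rfl rfl
    constructor
    · exact fun h => h.1
    · rintro rfl
      exact ⟨rfl, fun h' => h ⟨h'.1, h'.2, h'.1⟩⟩

theorem bandPlus_of_lt (s t : ℝ) (y : Phase bc m N) {a b : ℤ} (h : a < b) :
    bandPlus α s t y a b = -(s * α * fld y (b - a).toNat a) := by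
  unfold bandPlus
  split_ifs with h1 h2 h3
  · omega
  · omega
  · rfl
  · rw [fld_toNat_of_not y h.le h1]; simp

theorem bandPlus_self (s t : ℝ) (y : Phase bc m N) {a : ℤ} (h : IsSite bc N a) :
    bandPlus α s t y a a = s + t * (1 + α * fld y 0 a) := by
  rw [bandPlus, if_pos ⟨h, h⟩, if_neg (by omega), if_pos rfl]

theorem bandPlus_sub (s t : ℝ) (y : Phase bc m N) {b : ℤ} (h : IsSite bc N (b + 1))
    (h' : IsSite bc N b) : bandPlus α s t y (b + 1) b = t * α := by
  rw [bandPlus, if_pos ⟨h, h'⟩, if_pos (by omega)]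

theorem bandPlus_of_lt_sub (s t : ℝ) (y : Phase bc m N) {a b : ℤ} (h : b < a - 1) :
    bandPlus α s t y a b = 0 := by
  unfold bandPlus
  split_ifs <;> first | omega | rfl

/-- It suffices to verify an identity between skew-symmetric quantities for intervals
`[k, k + i]`, `[l, l + j]` of which the first one comes first in the lexicographic order. -/
theorem of_lexicographic {P : ℕ → ℤ → ℕ → ℤ → Prop}
    (hsymm : ∀ i k j l, P i k j l → P j l i k)
    (h : ∀ i k j l, (k < l ∨ k = l ∧ i ≤ j) → P i k j l) (i : ℕ) (k : ℤ) (j : ℕ) (l : ℤ) :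
    P i k j l := by
  by_cases h1 : k < l ∨ k = l ∧ i ≤ j
  · exact h i k j l h1
  · exact hsymm _ _ _ _ (h j l i k (by omega))

/-- The bracket of the entries of `s U + t L` is linear in `t`: the part quadratic in `L` vanishes,
and the mixed part is the frame matrix of the cubic bracket. -/
theorem entryBracket_bandPlus (s t : ℝ) (y : Phase bc m N) (i : ℕ) (k : ℤ) (j : ℕ) (l : ℤ)
    (hi : i ≤ m) (hj : j ≤ m) (hk : IsSite bc N k) (hki : IsSite bc N (k + i))
    (hl : IsSite bc N l) (hlj : IsSite bc N (l + j)) :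
    entryBracket (bandPlus α s t y) k (k + i) l (l + j) =
      s ^ 2 * entryBracket (bandPlus α 1 0 y) k (k + i) l (l + j) +
        s * t * α * listTerm m (cubicList α y) i k j l := by
  revert hi hj hk hki hl hlj
  refine of_lexicographic (P := fun i k j l => i ≤ m → j ≤ m → IsSite bc N k →
    IsSite bc N (k + i) → IsSite bc N l → IsSite bc N (l + j) →
    entryBracket (bandPlus α s t y) k (k + i) l (l + j) =
      s ^ 2 * entryBracket (bandPlus α 1 0 y) k (k + i) l (l + j) +
        s * t * α * listTerm m (cubicList α y) i k j l) ?_ ?_ i k j l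
  · intro i k j l h hj hi hl hlj hk hki
    rw [entryBracket_skew, h hi hj hk hki hl hlj, entryBracket_skew (bandPlus α 1 0 y),
      listTerm_skew]
    ring
  intro i k j l hkl hi hj hk hki hl hlj
  -- The cases are the relative positions of the four end points of the two intervals.
  rcases hkl with hkl | ⟨rfl, hij⟩
  · have e0 : listTerm m (cubicList α y) i k j l =
        if l ≤ k + m + 1 then cubicList α y i j k (l - k).toNat else 0 := by
      rw [listTerm, if_neg (c := l ≤ k ∧ k ≤ l + m + 1) (by omega), sub_zero]
      exact if_congr (by omega) rfl rfl
    rw [e0]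
    rcases lt_trichotomy (k + i : ℤ) (l + j) with hbd | hbd | hbd
    · have ead : (l + j - k : ℤ).toNat = (l - k).toNat + j := by omega
      have f1 : ∀ s t, bandPlus α s t y k (l + j) = -(s * α * fld y ((l - k).toNat + j) k) :=
        fun s t => by rw [bandPlus_of_lt s t y (by omega), ead]
      have x1 : exchangeCoeff k (k + i) l (l + j) = 1 := by
        rw [exchangeCoeff, sgn_of_pos (by omega), sgn_of_pos (by omega)]; norm_num
      rcases lt_trichotomy l (k + i) with hlb | rfl | hlb
      · have z : cubicList α y i j k (l - k).toNat = 0 := by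
          rw [cubicList, if_neg (by omega), if_neg (by omega), add_zero]
        simp only [entryBracket, f1, z, ite_self, bandPlus_of_lt _ _ y hlb,
          bandPlus_of_lt _ _ y (show k < k + i by omega),
          bandPlus_of_lt _ _ y (show l < l + j by omega)]
        ring
      · have e1 : (k + i - k : ℤ).toNat = i := by omega
        have z : cubicList α y i j k i = -(fld y (i + j) k * (1 + α * fld y 0 (k + i))) := by
          rw [cubicList, if_pos ⟨rfl, by omega⟩, if_neg (by omega), add_zero]
        rw [e1] at f1 ⊢
        rw [if_pos (by omega), z]
        simp only [entryBracket, f1, x1, bandPlus_self _ _ y hki, bandPlus_of_lt _ _ y hkl,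
          bandPlus_of_lt _ _ y hbd]
        ring
      · have x2 : twistCoeff k (k + i) l (l + j) = 0 := by
          rw [twistCoeff, sgn_of_pos (by omega), sgn_of_pos (by omega),
            sgnPos_of_nonneg (by omega), sgnPos_of_neg (by omega)]
          norm_num
        rcases eq_or_ne l (k + i + 1) with rfl | hne
        · have e1 : (k + i + 1 - k : ℤ).toNat = i + 1 := by omega
          have z : cubicList α y i j k (i + 1) = -(α * fld y (i + j + 1) k) := by
            rw [cubicList, if_neg (by omega), if_pos rfl, zero_add]
          have f2 : ∀ s t, bandPlus α s t y k (k + i + 1 + j) = -(s * α * fld y (i + j + 1) k) :=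
            fun s t => by rw [f1, e1, Nat.add_right_comm]
          rw [e1, if_pos (by omega), z]
          simp only [entryBracket, f2, x1, x2, bandPlus_sub _ _ y hl hki]
          ring
        · have z : cubicList α y i j k (l - k).toNat = 0 := by
            rw [cubicList, if_neg (by omega), if_neg (by omega), add_zero]
          simp only [entryBracket, z, ite_self, x2,
            bandPlus_of_lt_sub _ _ y (show (k + i : ℤ) < l - 1 by omega)]
          ring
    · have x1 : exchangeCoeff k (k + i) l (l + j) = 1 / 2 := by
        rw [exchangeCoeff, sgn_of_pos (by omega), hbd, sgn_self_sub]; norm_num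
      have x2 : twistCoeff k (k + i) l (l + j) = 1 / 2 := by
        rw [twistCoeff, sgn_of_pos (by omega), hbd, sgn_self_sub,
          sgnPos_of_nonneg (by omega), sgnPos_of_nonneg (by omega)]
        norm_num
      rcases Nat.eq_zero_or_pos j with rfl | hj0
      · have e1 : (l - k).toNat = i := by omega
        have e2 : l + ((0 : ℕ) : ℤ) = k + i := by omega
        have e3 : l = k + i := by omega
        have z : cubicList α y i 0 k i = -(fld y (i + 0) k * (1 + α * fld y 0 (k + i))) := by
          rw [cubicList, if_pos ⟨rfl, by omega⟩, if_neg (by omega), add_zero]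
        rw [e1, if_pos (by omega), z]
        subst e3
        rw [e2] at x1 x2 ⊢
        simp only [entryBracket, x1, x2, bandPlus_self _ _ y hki, bandPlus_of_lt _ _ y hkl, e1,
          add_zero]
        ring
      · have z : cubicList α y i j k (l - k).toNat = 0 := by
          rw [cubicList, if_neg (by omega), if_neg (by omega), add_zero]
        simp only [entryBracket, z, ite_self,
          bandPlus_of_lt _ _ y (show k < k + i by omega),
          bandPlus_of_lt _ _ y (show k < l + j by omega),
          bandPlus_of_lt _ _ y (show l < k + i by omega),
          bandPlus_of_lt _ _ y (show l < l + j by omega)]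
        ring
    · have x1 : exchangeCoeff k (k + i) l (l + j) = 0 := by
        rw [exchangeCoeff, sgn_of_pos (by omega), sgn_of_neg (by omega)]; norm_num
      have x2 : twistCoeff k (k + i) l (l + j) = 0 := by
        rw [twistCoeff, sgn_of_pos (by omega), sgn_of_neg (by omega),
          sgnPos_of_nonneg (by omega), sgnPos_of_nonneg (by omega)]
        norm_num
      have z : cubicList α y i j k (l - k).toNat = 0 := by
        rw [cubicList, if_neg (by omega), if_neg (by omega), add_zero]
      simp only [entryBracket, x1, x2, z, ite_self]
      ring
  · have e0 : listTerm m (cubicList α y) i k j k =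
        cubicList α y i j k 0 - cubicList α y j i k 0 := by
      rw [listTerm, if_pos (by omega), if_pos (by omega), sub_self, Int.toNat_zero]
    rw [e0]
    rcases hij.eq_or_lt with rfl | hij
    · have x1 : exchangeCoeff k (k + i) k (k + i) = 0 := by
        rw [exchangeCoeff, sgn_self_sub, sgn_self_sub]; norm_num
      have x2 : twistCoeff k (k + i) k (k + i) = 0 := by
        rw [twistCoeff, sgn_self_sub, sgn_self_sub, sgnPos_of_nonneg (by omega)]
        norm_num
      simp only [entryBracket, x1, x2]
      ring
    · have z : cubicList α y j i k 0 = 0 := by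
        rw [cubicList, if_neg (by omega), if_neg (by omega), add_zero]
      rw [z, sub_zero]
      rcases Nat.eq_zero_or_pos i with rfl | hi0
      · have x1 : exchangeCoeff k k k (k + j) = 1 / 2 := by
          rw [exchangeCoeff, sgn_self_sub, sgn_of_pos (by omega)]; norm_num
        have x2 : twistCoeff k k k (k + j) = 1 / 2 := by
          rw [twistCoeff, sgn_self_sub, sgn_of_pos (by omega),
            sgnPos_of_nonneg (by omega), sgnPos_of_nonneg (by omega)]
          norm_num
        have z : cubicList α y 0 j k 0 = -(fld y (0 + j) k * (1 + α * fld y 0 k)) := by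
          rw [cubicList, if_pos ⟨rfl, by omega⟩, if_neg (by omega), add_zero]
          simp
        rw [z]
        have e2 : k + ((0 : ℕ) : ℤ) = k := by omega
        have e3 : (k + j - k : ℤ).toNat = j := by omega
        rw [e2, zero_add]
        simp only [entryBracket, x1, x2, bandPlus_self _ _ y hk,
          bandPlus_of_lt _ _ y (show k < k + j by omega), e3]
        ring
      · have z : cubicList α y i j k 0 = 0 := by
          rw [cubicList, if_neg (by omega), if_neg (by omega), add_zero]
        simp only [entryBracket, z,
          bandPlus_of_lt _ _ y (show k < k + i by omega),
          bandPlus_of_lt _ _ y (show k < k + j by omega)]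
        ring

theorem quadraticList_shift (y : Phase bc m N) {g : ℤ} (hg : SameSite bc N g 0)
    (i j : ℕ) (k : ℤ) (l : ℕ) : quadraticList α y i j (k + g) l = quadraticList α y i j k l := by
  have h : ∀ n, SameSite bc N (k + g + n) (k + n) := fun n => (sameSite_congr_sub (by ring)).1 hg
  have h0 : SameSite bc N (k + g) k := (sameSite_congr_sub (by ring)).1 hg
  simp only [quadraticList, fld_congr y _ (h _), fld_congr y _ h0]

theorem cubicList_shift (y : Phase bc m N) {g : ℤ} (hg : SameSite bc N g 0)
    (i j : ℕ) (k : ℤ) (l : ℕ) : cubicList α y i j (k + g) l = cubicList α y i j k l := by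
  have h : ∀ n, SameSite bc N (k + g + n) (k + n) := fun n => (sameSite_congr_sub (by ring)).1 hg
  have h0 : SameSite bc N (k + g) k := (sameSite_congr_sub (by ring)).1 hg
  simp only [cubicList, fld_congr y _ (h _), fld_congr y _ h0]

/-- The indicator of an interval. -/
def between (a x b : ℤ) : ℝ := if a ≤ x ∧ x ≤ b then 1 else 0

theorem between_of_mem {a x b : ℤ} (h : a ≤ x ∧ x ≤ b) : between a x b = 1 := if_pos h

theorem between_of_notMem {a x b : ℤ} (h : ¬(a ≤ x ∧ x ≤ b)) : between a x b = 0 := if_neg h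

/-- The quadratic bracket in terms of the bracket of the entries of `U`; the additional terms come
from the moving frame. -/
theorem listTerm_quadraticList (hα : α ≠ 0) (y : Phase bc m N) (i : ℕ) (k : ℤ) (j : ℕ) (l : ℤ)
    (hi : i ≤ m) (hj : j ≤ m) (hk : IsSite bc N k) (hki : IsSite bc N (k + i))
    (hl : IsSite bc N l) (hlj : IsSite bc N (l + j)) :
    listTerm m (quadraticList α y) i k j l =
      α⁻¹ * entryBracket (bandPlus α 1 0 y) k (k + i) l (l + j) +
        α * (fld y i k * fld y j l) * (between k (l + j) (k + i) - between k l (k + i) +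
          between l k (l + j) - between l (k + i) (l + j)) := by
  revert hi hj hk hki hl hlj
  refine of_lexicographic (P := fun i k j l => i ≤ m → j ≤ m → IsSite bc N k →
    IsSite bc N (k + i) → IsSite bc N l → IsSite bc N (l + j) →
    listTerm m (quadraticList α y) i k j l =
      α⁻¹ * entryBracket (bandPlus α 1 0 y) k (k + i) l (l + j) +
        α * (fld y i k * fld y j l) * (between k (l + j) (k + i) - between k l (k + i) +
          between l k (l + j) - between l (k + i) (l + j))) ?_ ?_ i k j l
  · intro i k j l h hj hi hl hlj hk hki
    rw [entryBracket_skew, listTerm_skew, h hi hj hk hki hl hlj]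
    ring
  intro i k j l hkl hi hj hk hki hl hlj
  have fdiag : ∀ a, IsSite bc N a → bandPlus α 1 0 y a a = 1 := fun a ha => by
    rw [bandPlus_self _ _ y ha]; ring
  have fup : ∀ (a b : ℤ) (n : ℕ), 0 < n → b = a + n → bandPlus α 1 0 y a b = -(α * fld y n a) := by
    intro a b n hn hb
    rw [bandPlus_of_lt _ _ y (by omega), show (b - a).toNat = n by omega, one_mul]
  -- The cases are the relative positions of the four end points of the two intervals.
  rcases hkl with hkl | ⟨rfl, hij⟩
  · obtain ⟨L, rfl⟩ : ∃ L : ℕ, l = k + L := ⟨(l - k).toNat, by omega⟩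
    have e0 : listTerm m (quadraticList α y) i k j (k + L) =
        if L ≤ m + 1 then quadraticList α y i j k L else 0 := by
      rw [listTerm, if_neg (c := k + L ≤ k ∧ k ≤ k + L + m + 1) (by omega), sub_zero,
        show (k + L - k : ℤ).toNat = L by omega]
      exact if_congr (by omega) rfl rfl
    rw [e0, between_of_notMem (a := k + L) (x := k) (by omega)]
    have f1 := fup k (k + L + j) (L + j) (by omega) (by push_cast; ring)
    rcases lt_trichotomy (k + i : ℤ) (k + L + j) with hbd | hbd | hbd
    · have x1 : exchangeCoeff k (k + i) (k + L) (k + L + j) = 1 := by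
        rw [exchangeCoeff, sgn_of_pos (by omega), sgn_of_pos (by omega)]; norm_num
      rw [between_of_notMem (x := k + L + j) (by omega)]
      rcases lt_trichotomy L i with hlb | rfl | hlb
      · have x2 : twistCoeff k (k + i) (k + L) (k + L + j) = 1 := by
          rw [twistCoeff, sgn_of_pos (by omega), sgn_of_pos (by omega),
            sgnPos_of_nonneg (by omega), sgnPos_of_nonneg (by omega)]
          norm_num
        rw [if_pos (by omega), quadraticList, if_neg (by omega), if_neg (by omega),
          if_neg (by omega), if_neg (by omega), if_pos (by omega),
          between_of_mem (by omega), between_of_mem (by omega), entryBracket, x1, x2, f1,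
          fup (k + L) (k + i) (i - L) (by omega) (by omega),
          fup k (k + i) i (by omega) rfl, fup (k + L) (k + L + j) j (by omega) rfl,
          add_comm j L]
        field_simp
        ring
      · have x2 : twistCoeff k (k + L) (k + L) (k + L + j) = 1 := by
          rw [twistCoeff, sgn_of_pos (by omega), sgn_of_pos (by omega),
            sgnPos_of_nonneg (by omega), sgnPos_of_nonneg (by omega)]
          norm_num
        rw [if_pos (by omega), quadraticList, if_neg (by omega), if_neg (by omega),
          if_neg (by omega), if_pos rfl,
          between_of_mem (by omega), between_of_mem (by omega), entryBracket, x1, x2, f1,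
          fdiag _ hki, fup k (k + L) L (by omega) rfl, fup (k + L) (k + L + j) j (by omega) rfl]
        field_simp
        ring
      · have x2 : twistCoeff k (k + i) (k + L) (k + L + j) = 0 := by
          rw [twistCoeff, sgn_of_pos (by omega), sgn_of_pos (by omega),
            sgnPos_of_nonneg (by omega), sgnPos_of_neg (by omega)]
          norm_num
        have z : quadraticList α y i j k L = 0 := by
          unfold quadraticList
          split_ifs <;> first | rfl | omega
        have f2 : bandPlus α 1 0 y (k + L) (k + i) = 0 := by
          rcases eq_or_ne L (i + 1) with rfl | hne
          · have e : k + ((i + 1 : ℕ) : ℤ) = k + i + 1 := by push_cast; ring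
            rw [e] at hl ⊢
            rw [bandPlus_sub _ _ y hl hki, zero_mul]
          · exact bandPlus_of_lt_sub _ _ y (by omega)
        rw [z, ite_self, entryBracket, x2, f2, between_of_notMem (by omega),
          between_of_notMem (by omega)]
        ring
    · have x1 : exchangeCoeff k (k + i) (k + L) (k + L + j) = 1 / 2 := by
        rw [exchangeCoeff, sgn_of_pos (by omega), hbd, sgn_self_sub]; norm_num
      have x2 : twistCoeff k (k + i) (k + L) (k + L + j) = 1 / 2 := by
        rw [twistCoeff, sgn_of_pos (by omega), hbd, sgn_self_sub,
          sgnPos_of_nonneg (by omega), sgnPos_of_nonneg (by omega)]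
        norm_num
      obtain rfl : i = L + j := by omega
      rw [if_pos (by omega), between_of_mem (by omega), between_of_mem (by omega),
        between_of_mem (by omega), quadraticList, if_neg (by omega), if_neg (by omega),
        entryBracket, x1, x2, ← hbd, fup k (k + (L + j : ℕ)) (L + j) (by omega) rfl]
      rcases Nat.eq_zero_or_pos j with rfl | hj0
      · rw [if_pos rfl, if_pos (by omega)]
        have e : k + ((L + 0 : ℕ) : ℤ) = k + L := by push_cast; ring
        rw [e, fdiag _ hl]
        field_simp
        ring
      · rw [if_neg (by omega), if_neg (by omega), if_neg (by omega),
          fup (k + L) (k + (L + j : ℕ)) j hj0 (by push_cast; ring)]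
        field_simp
        ring
    · have x1 : exchangeCoeff k (k + i) (k + L) (k + L + j) = 0 := by
        rw [exchangeCoeff, sgn_of_pos (by omega), sgn_of_neg (by omega)]; norm_num
      have x2 : twistCoeff k (k + i) (k + L) (k + L + j) = 0 := by
        rw [twistCoeff, sgn_of_pos (by omega), sgn_of_neg (by omega),
          sgnPos_of_nonneg (by omega), sgnPos_of_nonneg (by omega)]
        norm_num
      have z : quadraticList α y i j k L = 0 := by
        unfold quadraticList
        split_ifs <;> first | rfl | omega
      rw [z, ite_self, entryBracket, x1, x2, between_of_mem (by omega), between_of_mem (by omega),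
        between_of_notMem (by omega)]
      ring
  · have e0 : listTerm m (quadraticList α y) i k j k =
        quadraticList α y i j k 0 - quadraticList α y j i k 0 := by
      rw [listTerm, if_pos (by omega), if_pos (by omega), sub_self, Int.toNat_zero]
    rw [e0]
    rcases hij.eq_or_lt with rfl | hij
    · have x1 : exchangeCoeff k (k + i) k (k + i) = 0 := by
        rw [exchangeCoeff, sgn_self_sub, sgn_self_sub]; norm_num
      have x2 : twistCoeff k (k + i) k (k + i) = 0 := by
        rw [twistCoeff, sgn_self_sub, sgn_self_sub, sgnPos_of_nonneg (by omega)]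
        norm_num
      rw [entryBracket, x1, x2]
      ring
    · have x1 : exchangeCoeff k (k + i) k (k + j) = 1 / 2 := by
        rw [exchangeCoeff, sgn_self_sub, sgn_of_pos (by omega)]; norm_num
      have x2 : twistCoeff k (k + i) k (k + j) = 1 / 2 := by
        rw [twistCoeff, sgn_self_sub, sgn_of_pos (by omega),
          sgnPos_of_nonneg (by omega), sgnPos_of_nonneg (by omega)]
        norm_num
      have z : quadraticList α y j i k 0 = 0 := by
        unfold quadraticList
        split_ifs <;> first | rfl | omega
      rw [z, between_of_notMem (x := k + j) (by omega), between_of_mem (by omega),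
        between_of_mem (by omega), between_of_mem (by omega), entryBracket, x1, x2,
        fup k (k + j) j (by omega) rfl]
      rcases Nat.eq_zero_or_pos i with rfl | hi0
      · rw [quadraticList, if_neg (by omega), if_pos rfl, if_pos rfl]
        have e : k + ((0 : ℕ) : ℤ) = k := by simp
        rw [e, fdiag _ hk]
        field_simp
        ring
      · have z : quadraticList α y i j k 0 = 0 := by
          unfold quadraticList
          split_ifs <;> first | rfl | omega
        rw [z, fup k (k + i) i hi0 rfl]
        field_simp
        ring

end Identification

/-! ### The cubic bracket and the pencil -/

section Pencil

variable {bc : Boundary} {m N : ℕ} {α : ℝ}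

theorem sum_shiftSum {ι : Type*} (s : Finset ι) {f : ι → ℤ → ℝ} {u v : ℤ}
    (h : ∀ i ∈ s, ∀ g, f i g ≠ 0 → u ≤ g ∧ g ≤ v) :
    ∑ i ∈ s, shiftSum bc N (f i) = shiftSum bc N fun g => ∑ i ∈ s, f i g := by
  rw [shiftSum_eq_sum (Finset.Icc u v)]
  · rw [Finset.sum_congr rfl fun i hi =>
      shiftSum_eq_sum (Finset.Icc u v) fun g _ hg => Finset.mem_Icc.2 (h i hi g hg),
      Finset.sum_comm]
    exact Finset.sum_congr rfl fun g _ => by split_ifs <;> simp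
  · intro g _ hg
    obtain ⟨i, hi, hi'⟩ := Finset.exists_ne_zero_of_sum_ne_zero hg
    exact Finset.mem_Icc.2 (h i hi g hi')

theorem listTerm_support {h : ℕ → ℕ → ℤ → ℕ → ℝ} {i j : ℕ} {k l : ℤ}
    (h0 : listTerm m h i k j l ≠ 0) : k ≤ l + m + 1 ∧ l ≤ k + m + 1 := by
  by_contra hc
  refine h0 ?_
  rw [listTerm, if_neg (by omega), if_neg (by omega), sub_zero]

theorem isSite_site_shift (q : Label bc m N) {g : ℤ} (hg : SameSite bc N g 0) :
    IsSite bc N (q.site + g) ∧ IsSite bc N (q.site + g + q.fieldNo) :=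
  ⟨(isSite_congr ((sameSite_congr_sub (by ring)).1 hg)).2 q.isSite_site,
    (isSite_congr ((sameSite_congr_sub (by ring)).1 hg)).2 q.isSite_site_add⟩

theorem bandBivector_eq (M : Phase bc m N → ℤ → ℤ → ℝ) (y : Phase bc m N) (p q : Label bc m N) :
    bandBivector M y p q = shiftSum bc N fun g =>
      entryBracket (M y) p.site (p.site + p.fieldNo) (q.site + g) (q.site + g + q.fieldNo) :=
  shiftSum_congr fun g _ => by rw [add_right_comm]

/-- The bracket of the entries of `s U + t L` consists of the bracket of the entries of `U` and of
the matrix of the cubic bracket in the moving frame. -/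
theorem bandBivector_bandPlus (s t : ℝ) (y : Phase bc m N) (p q : Label bc m N) :
    bandBivector (bandPlus α s t) y p q = s ^ 2 * bandBivector (bandPlus α 1 0) y p q +
      s * t * α * bivectorOfList (cubicList α) y p q := by
  rw [bivectorOfList_eq _ _ fun g hg i j k l => cubicList_shift y hg i j k l, bandBivector_eq,
    bandBivector_eq, mul_shiftSum, mul_shiftSum,
    ← shiftSum_add (u := p.site - q.site - (m + 1)) (v := p.site - q.site + (m + 1))]
  · refine shiftSum_congr fun g hg => ?_
    obtain ⟨h1, h2⟩ := isSite_site_shift q hg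
    exact entryBracket_bandPlus s t y _ _ _ _ p.fieldNo_le q.fieldNo_le p.isSite_site
      p.isSite_site_add h1 h2
  · intro g hg
    have := entryBracket_support (bandSupport_bandPlus 1 0 y) p.le_site_add p.site_add_le
      (right_ne_zero_of_mul hg)
    omega
  · intro g hg
    have := listTerm_support (right_ne_zero_of_mul hg)
    omega

/-- The bracket with a diagonal entry of `U` scales its row and its column with opposite factors.
-/
theorem entryBracket_diag (y : Phase bc m N) (x l : ℤ) (j : ℕ) (hl : IsSite bc N l)
    (hlj : IsSite bc N (l + j)) :
    entryBracket (bandPlus α 1 0 y) x x l (l + j) =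
      -α * fld y j l * ((if x = l then 1 else 0) - if x = l + j then 1 else 0) := by
  have fdiag : ∀ a, IsSite bc N a → bandPlus α 1 0 y a a = 1 := fun a ha => by
    rw [bandPlus_self _ _ y ha]; ring
  rcases Nat.eq_zero_or_pos j with rfl | hj
  · rw [Nat.cast_zero, add_zero, sub_self, mul_zero, entryBracket]
    rcases eq_or_ne x l with rfl | hx
    · rw [exchangeCoeff, twistCoeff]; simp [sgn]
    · have hz : bandPlus α 1 0 y x l * bandPlus α 1 0 y l x = 0 := by
        have hlow : ∀ a b, b < a → bandPlus α 1 0 y a b = 0 := fun a b hab => by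
          unfold bandPlus
          split_ifs <;> first | omega | simp
        rcases lt_or_gt_of_ne hx with h | h
        · rw [hlow l x h, mul_zero]
        · rw [hlow x l h, zero_mul]
      have ht : twistCoeff x x l l = 0 := by
        unfold twistCoeff sgn sgnPos
        split_ifs <;> first | omega | norm_num
      rw [hz, ht]; ring
  · have hlow : ∀ a b, b < a → bandPlus α 1 0 y a b = 0 := fun a b hab => by
      unfold bandPlus
      split_ifs <;> first | omega | simp
    have hcd : bandPlus α 1 0 y l (l + j) = -(α * fld y j l) := by
      rw [bandPlus_of_lt _ _ y (by omega), show (l + j - l).toNat = j by omega, one_mul]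
    rw [entryBracket, hcd]
    rcases eq_or_ne x l with rfl | h1
    · rw [if_pos rfl, if_neg (by omega), fdiag _ hl, hcd, exchangeCoeff, twistCoeff, sgn_self_sub,
        sgn_of_pos (by omega), sgnPos_of_nonneg (by omega), sgnPos_of_nonneg (by omega)]
      ring
    · rcases eq_or_ne x (l + j) with rfl | h2
      · rw [if_neg h1, if_pos rfl, fdiag _ hlj, hcd, exchangeCoeff, twistCoeff, sgn_self_sub,
          sgn_of_neg (by omega), sgnPos_of_nonneg (by omega), sgnPos_of_nonneg (by omega)]
        ring
      · have ht : twistCoeff x x l (l + j) = 0 := by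
          unfold twistCoeff sgn sgnPos
          split_ifs <;> first | omega | norm_num
        have he : exchangeCoeff x x l (l + j) *
            (bandPlus α 1 0 y x (l + j) * bandPlus α 1 0 y l x) = 0 := by
          rcases lt_trichotomy x l with h | h | h
          · rw [hlow l x h, mul_zero, mul_zero]
          · exact absurd h h1
          · rcases lt_trichotomy x (l + j) with h' | h' | h'
            · rw [exchangeCoeff, sgn_of_neg (by omega), sgn_of_pos (by omega)]; ring
            · exact absurd h' h2
            · rw [hlow x _ h', zero_mul, mul_zero]
        rw [he, ht, if_neg h1, if_neg h2]
        ring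

/-- Among the sites of an interval, a given site occurs at most once. -/
theorem sum_range_ite_eq (k c : ℤ) (n : ℕ) :
    (∑ i ∈ Finset.range (n + 1), if k + i = c then (1 : ℝ) else 0) = between k c (k + n) := by
  by_cases h : k ≤ c ∧ c ≤ k + n
  · rw [between_of_mem h, Finset.sum_eq_single (c - k).toNat]
    · rw [if_pos (by omega)]
    · intro i _ hi; rw [if_neg (by omega)]
    · intro hi; rw [Finset.mem_range] at hi; omega
  · rw [between_of_notMem h]
    refine Finset.sum_eq_zero fun i hi => ?_
    rw [Finset.mem_range] at hi
    rw [if_neg (by omega)]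

theorem sum_entryBracket_diag (y : Phase bc m N) (k l : ℤ) (i j : ℕ) (hl : IsSite bc N l)
    (hlj : IsSite bc N (l + j)) :
    ∑ n ∈ Finset.range (i + 1), entryBracket (bandPlus α 1 0 y) (k + n) (k + n) l (l + j) =
      -α * fld y j l * (between k l (k + i) - between k (l + j) (k + i)) := by
  simp only [entryBracket_diag y _ l j hl hlj]
  rw [← Finset.mul_sum, Finset.sum_sub_distrib, sum_range_ite_eq, sum_range_ite_eq]

theorem periodizedBracket_eq_fld (y : Phase bc m N) {a b : ℤ} (hab : a ≤ b) (hab' : b ≤ a + m)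
    (u : ℤ) : fld (fun s : Label bc m N => periodizedBracket bc N (bandPlus α 1 0 y) a b
      s.site (s.site + s.fieldNo)) 0 u =
        periodizedBracket bc N (bandPlus α 1 0 y) a b u u := by
  by_cases h : HasLabel bc m N 0 u
  · obtain ⟨s, hs, hu⟩ := h
    rw [fld_eq _ s hs hu, hs, Nat.cast_zero, add_zero]
    have := periodizedBracket_shift (bandPlus α 1 0 y) a b s.site s.site
      (sameSite_iff_sub.1 hu)
    rw [add_sub_cancel] at this
    exact this.symm
  · rw [fld_of_not _ h, periodizedBracket_eq_zero (bandSupport_bandPlus 1 0 y) hab hab']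
    rw [sub_self]
    exact Or.inr h

/-- The diagonal entries of `U` commute. -/
theorem periodizedBracket_diag (y : Phase bc m N) (x u : ℤ) :
    periodizedBracket bc N (bandPlus α 1 0 y) x x u u = 0 := by
  unfold periodizedBracket shiftSum
  refine finsum_eq_zero_of_forall_eq_zero fun g => ?_
  split_ifs
  · by_cases hu : IsSite bc N (u + g)
    · have h := entryBracket_diag (α := α) y x (u + g) 0 hu (by simpa using hu)
      simpa using h
    · by_contra h
      exact hu (entryBracket_support (bandSupport_bandPlus 1 0 y) le_rfl (by omega) h).2.2.1
  · rfl

/-- The part of a bracket in the moving frame that comes from the frame fields at the sites of a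
variable. -/
theorem sum_periodizedBracket_diag (y : Phase bc m N) (p q : Label bc m N) :
    ∑ n ∈ Finset.range (p.fieldNo + 1), periodizedBracket bc N (bandPlus α 1 0 y)
        (p.site + n) (p.site + n) q.site (q.site + q.fieldNo) =
      shiftSum bc N fun g => -α * fld y q.fieldNo (q.site + g) *
        (between p.site (q.site + g) (p.site + p.fieldNo) -
          between p.site (q.site + g + q.fieldNo) (p.site + p.fieldNo)) := by
  unfold periodizedBracket
  refine (sum_shiftSum _ (u := p.site - q.site - (m + 1)) (v := p.site - q.site + (2 * m + 1))
    ?_).trans ?_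
  rotate_left
  · refine shiftSum_congr fun g hg => ?_
    obtain ⟨h1, h2⟩ := isSite_site_shift q hg
    rw [← sum_entryBracket_diag y _ _ _ _ h1 h2]
    exact Finset.sum_congr rfl fun n _ => by rw [add_right_comm]
  · intro n hn g hg
    have hn' := Finset.mem_range.1 hn
    have hm := p.fieldNo_le
    have := entryBracket_support (bandSupport_bandPlus 1 0 y) le_rfl (by omega) hg
    omega

/-- The same contribution with the roles of the variables exchanged. -/
theorem sum_periodizedBracket_diag' (y : Phase bc m N) (p q : Label bc m N) :
    ∑ n ∈ Finset.range (q.fieldNo + 1), periodizedBracket bc N (bandPlus α 1 0 y)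
        p.site (p.site + p.fieldNo) (q.site + n) (q.site + n) =
      shiftSum bc N fun g => α * fld y p.fieldNo p.site *
        (between (q.site + g) p.site (q.site + g + q.fieldNo) -
          between (q.site + g) (p.site + p.fieldNo) (q.site + g + q.fieldNo)) := by
  unfold periodizedBracket
  refine (sum_shiftSum _ (u := p.site - q.site - (2 * m + 2)) (v := p.site - q.site + (m + 2))
    ?_).trans ?_
  rotate_left
  · refine shiftSum_congr fun g hg => ?_
    have h := sum_entryBracket_diag (α := α) y (q.site + g) p.site q.fieldNo p.fieldNo
      p.isSite_site p.isSite_site_add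
    rw [neg_mul, neg_mul, ← neg_eq_iff_eq_neg, ← Finset.sum_neg_distrib] at h
    rw [← h]
    exact Finset.sum_congr rfl fun n _ => by rw [entryBracket_skew, add_right_comm]
  · intro n hn g hg
    have hn' := Finset.mem_range.1 hn
    have hm := q.fieldNo_le
    have := entryBracket_support (bandSupport_bandPlus 1 0 y) p.le_site_add p.site_add_le hg
    omega

/-- The bracket of the entries of `U` in the moving frame. There are no terms that are quadratic
in the non-trivial part of the frame, since the diagonal entries of `U` commute. -/
theorem frameBivector_bandBivector (y : Phase bc m N) (p q : Label bc m N) :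
    frameBivector α (bandBivector (bandPlus α 1 0)) y p q =
      bandBivector (bandPlus α 1 0) y p q +
        α * y q * (∑ n ∈ Finset.range (q.fieldNo + 1), periodizedBracket bc N (bandPlus α 1 0 y)
          p.site (p.site + p.fieldNo) (q.site + n) (q.site + n)) +
        α * y p * ∑ n ∈ Finset.range (p.fieldNo + 1), periodizedBracket bc N (bandPlus α 1 0 y)
          (p.site + n) (p.site + n) q.site (q.site + q.fieldNo) := by
  set E := periodizedBracket bc N (bandPlus α 1 0 y) with hE
  have hsk : ∀ a b u v, E a b u v = -E u v a b :=
    periodizedBracket_skew fun g hg a b => bandPlus_shift 1 0 y hg a b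
  have hfld : ∀ u, fld (fun r : Label bc m N => E r.site (r.site + r.fieldNo) q.site
      (q.site + q.fieldNo)) 0 u = E u u q.site (q.site + q.fieldNo) := fun u => by
    have h := periodizedBracket_eq_fld (α := α) y q.le_site_add q.site_add_le u
    rw [← hE] at h
    rw [hsk u u, ← h, ← neg_one_mul, ← fld_smul]
    congr 1
    funext r
    rw [Pi.smul_apply, smul_eq_mul, neg_one_mul, ← hsk]
  have h1 : ∀ r : Label bc m N, ∑ s, frame α y p r * bandBivector (bandPlus α 1 0) y r s *
      frame α y q s = frame α y p r * (E r.site (r.site + r.fieldNo) q.site (q.site + q.fieldNo) +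
        α * y q * ∑ n ∈ Finset.range (q.fieldNo + 1),
          E r.site (r.site + r.fieldNo) (q.site + n) (q.site + n)) := fun r => by
    have h := sum_frame_mul (α := α) y (fun s => bandBivector (bandPlus α 1 0) y r s) q
    simp only [bandBivector, ← hE] at h ⊢
    simp only [hE, periodizedBracket_eq_fld y r.le_site_add r.site_add_le] at h ⊢
    rw [← h, Finset.mul_sum]
    exact Finset.sum_congr rfl fun s _ => by ring
  have h2 : ∀ n : ℕ, fld (fun r : Label bc m N => ∑ n ∈ Finset.range (q.fieldNo + 1),
      E r.site (r.site + r.fieldNo) (q.site + n) (q.site + n)) 0 (p.site + n) = 0 := fun n => by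
    refine Finset.sum_eq_zero fun r _ => ?_
    split_ifs with hr
    · beta_reduce
      rw [hr.1, Nat.cast_zero, add_zero]
      exact Finset.sum_eq_zero fun n _ => periodizedBracket_diag y _ _
    · rfl
  unfold frameBivector
  simp only [h1, mul_add, Finset.sum_add_distrib]
  rw [sum_frame_mul (α := α) y (fun r => E r.site (r.site + r.fieldNo) q.site
      (q.site + q.fieldNo)) p]
  simp only [hfld]
  have h3 := sum_frame_mul (α := α) y (fun r => α * y q * ∑ n ∈ Finset.range (q.fieldNo + 1),
    E r.site (r.site + r.fieldNo) (q.site + n) (q.site + n)) p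
  rw [h3]
  have h4 : ∀ n : ℕ, fld (fun r : Label bc m N => α * y q * ∑ n ∈ Finset.range (q.fieldNo + 1),
      E r.site (r.site + r.fieldNo) (q.site + n) (q.site + n)) 0 (p.site + n) = 0 := fun n => by
    have := fld_smul (α * y q) (fun r : Label bc m N => ∑ n ∈ Finset.range (q.fieldNo + 1),
      E r.site (r.site + r.fieldNo) (q.site + n) (q.site + n)) 0 (p.site + n)
    rw [h2, mul_zero] at this
    exact this
  simp only [h4, Finset.sum_const_zero, mul_zero, add_zero]
  simp only [bandBivector, ← hE]
  ring

/-- In the moving frame the quadratic bracket is the bracket of the entries of `U`. -/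
theorem quadraticBracket_eq_frameBivector (hα : α ≠ 0) :
    quadraticBracket bc m N α =
      frameBivector α fun y p q => α⁻¹ * bandBivector (bandPlus α 1 0) y p q := by
  funext y p q
  have e : frameBivector α (fun y p q => α⁻¹ * bandBivector (bandPlus α 1 0) y p q) y p q =
      α⁻¹ * frameBivector α (bandBivector (bandPlus α 1 0)) y p q := by
    unfold frameBivector
    simp only [Finset.mul_sum]
    exact Finset.sum_congr rfl fun r _ => Finset.sum_congr rfl fun s _ => by ring
  rw [e, frameBivector_bandBivector, sum_periodizedBracket_diag, sum_periodizedBracket_diag',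
    bandBivector_eq, quadraticBracket_eq,
    bivectorOfList_eq _ _ fun g hg i j k l => quadraticList_shift y hg i j k l,
    mul_shiftSum, mul_shiftSum]
  have hbw : ∀ {a x b : ℤ}, between a x b ≠ 0 → a ≤ x ∧ x ≤ b := fun {a x b} h => by
    by_contra h'
    exact h (between_of_notMem h')
  have hsub : ∀ {a x b c y d : ℤ}, between a x b - between c y d ≠ 0 →
      (a ≤ x ∧ x ≤ b) ∨ (c ≤ y ∧ y ≤ d) := fun {a x b c y d} h => by
    by_contra h'
    rw [not_or] at h'
    exact h (by rw [between_of_notMem h'.1, between_of_notMem h'.2, sub_zero])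
  have hp := p.fieldNo_le
  have hq := q.fieldNo_le
  have s1 : ∀ g, entryBracket (bandPlus α 1 0 y) p.site (p.site + p.fieldNo) (q.site + g)
      (q.site + g + q.fieldNo) ≠ 0 →
      p.site - q.site - (2 * m + 2) ≤ g ∧ g ≤ p.site - q.site + (2 * m + 2) := fun g hg => by
    have := entryBracket_support (bandSupport_bandPlus 1 0 y) p.le_site_add p.site_add_le hg
    omega
  have s2 : ∀ g, α * y q * (α * fld y p.fieldNo p.site *
        (between (q.site + g) p.site (q.site + g + q.fieldNo) -
          between (q.site + g) (p.site + p.fieldNo) (q.site + g + q.fieldNo))) ≠ 0 →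
      p.site - q.site - (2 * m + 2) ≤ g ∧ g ≤ p.site - q.site + (2 * m + 2) := fun g hg => by
    have := hsub (right_ne_zero_of_mul (right_ne_zero_of_mul hg))
    omega
  have s3 : ∀ g, α * y p * (-α * fld y q.fieldNo (q.site + g) *
        (between p.site (q.site + g) (p.site + p.fieldNo) -
          between p.site (q.site + g + q.fieldNo) (p.site + p.fieldNo))) ≠ 0 →
      p.site - q.site - (2 * m + 2) ≤ g ∧ g ≤ p.site - q.site + (2 * m + 2) := fun g hg => by
    have := hsub (right_ne_zero_of_mul (right_ne_zero_of_mul hg))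
    omega
  rw [← shiftSum_add s1 s2, ← shiftSum_add _ s3, mul_shiftSum]
  · refine shiftSum_congr fun g hg => ?_
    obtain ⟨h1, h2⟩ := isSite_site_shift q hg
    have hyq : fld y q.fieldNo (q.site + g) = y q :=
      fld_eq y q rfl ((sameSite_congr_sub (by ring)).1 hg)
    rw [listTerm_quadraticList hα y _ _ _ _ hp hq p.isSite_site p.isSite_site_add h1 h2, hyq,
      fld_label]
    field_simp
    ring
  · intro g hg
    by_cases h0 : entryBracket (bandPlus α 1 0 y) p.site (p.site + p.fieldNo) (q.site + g)
      (q.site + g + q.fieldNo) = 0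
    · rw [h0, zero_add] at hg
      exact s2 g hg
    · exact s1 g h0

/-- The cubic bracket: its matrix in the moving frame is given by `cubicList`. Both factors are
polynomial, hence the bracket is defined on the whole phase space. -/
def cubicBracket (bc : Boundary) (m N : ℕ) (α : ℝ) : Bivector bc m N :=
  frameBivector α (bivectorOfList (cubicList α))

/-- The Jacobi matrix of the change of variables is the moving frame times a diagonal matrix, and
the latter turns the linear bracket into the matrix of the cubic bracket in the frame. -/
theorem isPushForward_cubicBracket :
    IsPushForward α (linearBracket bc m N (-α)) (cubicBracket bc m N α) := by
  intro F G hF hG x hx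
  have hx' := mapsTo_changeVars hx
  have ho := (isOpen_domPlus (bc := bc) (m := m) (N := N) (α := α)).mem_nhds hx'
  exact pb_frameBivector hx (cubicList_changeVars hx)
    ((hF.contDiffAt ho).differentiableAt (by simp))
    ((hG.contDiffAt ho).differentiableAt (by simp))

/-- The pencil of brackets in the moving frame is given by the bracket of the entries of
`s U + t L`; the factor `s⁻¹` compensates for the factor `s` at the mixed term. -/
theorem smul_quadraticBracket_add (hα : α ≠ 0) {s : ℝ} (hs : s ≠ 0) (t : ℝ) :
    s • quadraticBracket bc m N α + t • cubicBracket bc m N α =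
      frameBivector α fun y p q => α⁻¹ * s⁻¹ * bandBivector (bandPlus α s t) y p q := by
  rw [quadraticBracket_eq_frameBivector hα]
  funext y p q
  simp only [Pi.add_apply, Pi.smul_apply, smul_eq_mul, cubicBracket, frameBivector,
    bandBivector_bandPlus s t, Finset.mul_sum, ← Finset.sum_add_distrib]
  refine Finset.sum_congr rfl fun r _ => Finset.sum_congr rfl fun s' _ => ?_
  field_simp

/-- In the old variables the pencil is given by the brackets of the entries of band matrices which
depend on the variables in an affine way. -/
theorem isPushForward_pencil (hα : α ≠ 0) {s : ℝ} (hs : s ≠ 0) (t : ℝ) :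
    IsPushForward α (fun x p q => α⁻¹ * s⁻¹ * bandBivector (bandMinus α s t) x p q)
      (s • quadraticBracket bc m N α + t • cubicBracket bc m N α) := by
  rw [smul_quadraticBracket_add hα hs]
  intro F G hF hG x hx
  have hx' := mapsTo_changeVars hx
  have ho := (isOpen_domPlus (bc := bc) (m := m) (N := N) (α := α)).mem_nhds hx'
  refine pb_frameBivector hx (fun p q => ?_)
    ((hF.contDiffAt ho).differentiableAt (by simp))
    ((hG.contDiffAt ho).differentiableAt (by simp))
  rw [bandBivector_changeVars s t hx]
  ring

end Pencil

/-! ### Polynomial degree -/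

section Polynomials

variable {bc : Boundary} {m N : ℕ} {α : ℝ}

/-- The function is given by a polynomial of degree at most `d`. -/
def PolyDegLE (d : ℕ) (f : Phase bc m N → ℝ) : Prop :=
  ∃ P : MvPolynomial (Label bc m N) ℝ, P.totalDegree ≤ d ∧ ∀ y, MvPolynomial.eval y P = f y

theorem polyDegLE_const (d : ℕ) (c : ℝ) : PolyDegLE d fun _ : Phase bc m N => c :=
  ⟨MvPolynomial.C c, by simp, fun y => by simp⟩

theorem PolyDegLE.add {d : ℕ} {f g : Phase bc m N → ℝ} (hf : PolyDegLE d f) (hg : PolyDegLE d g) :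
    PolyDegLE d fun y => f y + g y := by
  obtain ⟨P, hP, hP'⟩ := hf
  obtain ⟨Q, hQ, hQ'⟩ := hg
  exact ⟨P + Q, (MvPolynomial.totalDegree_add P Q).trans (max_le hP hQ), fun y => by
    rw [map_add, hP', hQ']⟩

theorem PolyDegLE.mul {d e : ℕ} {f g : Phase bc m N → ℝ} (hf : PolyDegLE d f) (hg : PolyDegLE e g) :
    PolyDegLE (d + e) fun y => f y * g y := by
  obtain ⟨P, hP, hP'⟩ := hf
  obtain ⟨Q, hQ, hQ'⟩ := hg
  exact ⟨P * Q, (MvPolynomial.totalDegree_mul P Q).trans (add_le_add hP hQ), fun y => by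
    rw [map_mul, hP', hQ']⟩

theorem PolyDegLE.mono {d e : ℕ} {f : Phase bc m N → ℝ} (hf : PolyDegLE d f) (h : d ≤ e) :
    PolyDegLE e f := by
  obtain ⟨P, hP, hP'⟩ := hf
  exact ⟨P, hP.trans h, hP'⟩

theorem PolyDegLE.const_mul {d : ℕ} {f : Phase bc m N → ℝ} (hf : PolyDegLE d f) (c : ℝ) :
    PolyDegLE d fun y => c * f y := by
  simpa using (polyDegLE_const 0 c).mul hf

theorem PolyDegLE.neg {d : ℕ} {f : Phase bc m N → ℝ} (hf : PolyDegLE d f) :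
    PolyDegLE d fun y => -f y := by
  simpa using hf.const_mul (-1)

theorem PolyDegLE.ite {d : ℕ} {f g : Phase bc m N → ℝ} {c : Prop} [Decidable c]
    (hf : c → PolyDegLE d f)
    (hg : ¬c → PolyDegLE d g) : PolyDegLE d fun y => if c then f y else g y := by
  by_cases h : c
  · simpa [h] using hf h
  · simpa [h] using hg h

theorem polyDegLE_sum {ι : Type*} {d : ℕ} (s : Finset ι) {f : ι → Phase bc m N → ℝ}
    (h : ∀ i ∈ s, PolyDegLE d (f i)) : PolyDegLE d fun y => ∑ i ∈ s, f i y := by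
  induction s using Finset.induction_on with
  | empty => simpa using polyDegLE_const d 0
  | insert i s hi ih =>
    simp only [Finset.sum_insert hi]
    exact (h i (Finset.mem_insert_self i s)).add
      (ih fun j hj => h j (Finset.mem_insert_of_mem hj))

theorem polyDegLE_coord (p : Label bc m N) : PolyDegLE 1 fun y : Phase bc m N => y p :=
  ⟨MvPolynomial.X p, by simp, fun y => by simp⟩

theorem polyDegLE_fld (j : ℕ) (k : ℤ) : PolyDegLE 1 fun y : Phase bc m N => fld y j k :=
  polyDegLE_sum _ fun p _ => PolyDegLE.ite (fun _ => polyDegLE_coord p) fun _ => polyDegLE_const 1 0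

theorem PolyDegLE.contDiff {d : ℕ} {f : Phase bc m N → ℝ} (hf : PolyDegLE d f) :
    ContDiff ℝ ∞ f := by
  obtain ⟨P, -, hP⟩ := hf
  rw [← funext hP]
  clear hP
  induction P using MvPolynomial.induction_on with
  | C a => simpa using contDiff_const
  | add p q hp hq => simpa using hp.add hq
  | mul_X p i hp => simpa using hp.mul (contDiff_apply ℝ ℝ i)

/-- Only the columns of the frame that belong to the `0`-th field depend on the point. -/
theorem polyDegLE_frame (p r : Label bc m N) :
    PolyDegLE (if r.fieldNo = 0 then 1 else 0) fun y => frame α y p r := by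
  unfold frame
  refine (polyDegLE_const _ _).add ?_
  split_ifs with h
  · simpa using ((polyDegLE_coord p).const_mul α).mul (polyDegLE_const 0 _)
  · simpa [h] using polyDegLE_const 0 0

/-- The degree is less than two exactly where two columns of the frame of degree one occur, so
that the total degree never exceeds three. -/
theorem polyDegLE_cubicList (i j : ℕ) (k : ℤ) (l : ℕ) :
    PolyDegLE (if i = 0 ∧ j = 0 then 1 else 2) fun y : Phase bc m N => cubicList α y i j k l := by
  unfold cubicList
  have h1 : PolyDegLE 1 fun y : Phase bc m N => 1 + α * fld y 0 (k + i) :=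
    (polyDegLE_const 1 1).add ((polyDegLE_fld 0 (k + i)).const_mul α)
  have h2 : PolyDegLE 1 fun y : Phase bc m N => -(α * fld y (i + j + 1) k) :=
    ((polyDegLE_fld _ _).const_mul α).neg
  by_cases h0 : i = 0 ∧ j = 0
  · rw [if_pos h0]
    exact PolyDegLE.add (PolyDegLE.ite (fun h => absurd h0 h.2) fun _ => polyDegLE_const _ 0)
      (PolyDegLE.ite (fun _ => h2) fun _ => polyDegLE_const _ 0)
  · rw [if_neg h0]
    exact PolyDegLE.add (PolyDegLE.ite (fun _ => ((polyDegLE_fld _ _).mul h1).neg)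
      fun _ => polyDegLE_const _ 0)
      (PolyDegLE.ite (fun _ => h2.mono (by norm_num)) fun _ => polyDegLE_const _ 0)

theorem polyDegLE_cubicBracket (p q : Label bc m N) :
    PolyDegLE 3 fun y => cubicBracket bc m N α y p q := by
  unfold cubicBracket frameBivector
  refine polyDegLE_sum _ fun r _ => polyDegLE_sum _ fun s _ => ?_
  have h : PolyDegLE (if r.fieldNo = 0 ∧ s.fieldNo = 0 then 1 else 2)
      fun y => bivectorOfList (cubicList α) y r s := by
    unfold bivectorOfList
    refine polyDegLE_sum _ fun l _ => ?_
    simp only [sub_eq_add_neg]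
    refine (PolyDegLE.ite (fun _ => polyDegLE_cubicList _ _ _ _) fun _ => polyDegLE_const _ 0).add
      (PolyDegLE.ite (fun _ => ?_) fun _ => polyDegLE_const _ 0).neg
    exact (polyDegLE_cubicList _ _ _ _).mono (le_of_eq (if_congr and_comm rfl rfl))
  refine (((polyDegLE_frame p r).mul h).mul (polyDegLE_frame q s)).mono ?_
  split_ifs <;> omega

theorem polyDegLE_quadraticBracket (p q : Label bc m N) :
    ∃ d, PolyDegLE d fun y => quadraticBracket bc m N α y p q := by
  rw [quadraticBracket_eq]
  unfold bivectorOfList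
  refine ⟨2, polyDegLE_sum _ fun l _ => ?_⟩
  have h : ∀ (i j : ℕ) (k : ℤ), PolyDegLE 2 fun y : Phase bc m N => quadraticList α y i j k l := by
    intro i j k
    have hl : ∀ j k, PolyDegLE 2 fun y : Phase bc m N => fld y j k :=
      fun j k => (polyDegLE_fld j k).mono (by norm_num)
    have hq : ∀ j k j' k', PolyDegLE 2 fun y : Phase bc m N => fld y j k * fld y j' k' :=
      fun j k j' k' => (polyDegLE_fld j k).mul (polyDegLE_fld j' k')
    have hd : ∀ k, PolyDegLE 1 fun y : Phase bc m N => 1 + α * fld y 0 k :=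
      fun k => (polyDegLE_const 1 1).add ((polyDegLE_fld 0 k).const_mul α)
    have h0 := polyDegLE_const (bc := bc) (m := m) (N := N) 2 0
    unfold quadraticList
    simp only [sub_eq_add_neg]
    exact PolyDegLE.ite (fun _ => h0) fun _ => PolyDegLE.ite
      (fun _ => PolyDegLE.ite (fun _ => ((polyDegLE_fld _ _).mul (hd _)).neg) fun _ => h0) fun _ =>
      PolyDegLE.ite
        (fun _ => PolyDegLE.ite (fun _ => ((polyDegLE_fld _ _).mul (hd _)).neg) fun _ => h0)
      fun _ => PolyDegLE.ite (fun _ => (hl _ _).neg.add ((hq _ _ _ _).const_mul α).neg) fun _ =>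
      PolyDegLE.ite (fun _ => ((hq _ _ _ _).const_mul α).neg.add ((hq _ _ _ _).const_mul α))
      fun _ => h0
  simp only [sub_eq_add_neg]
  exact (PolyDegLE.ite (fun _ => h _ _ _) fun _ => polyDegLE_const _ 0).add
    (PolyDegLE.ite (fun _ => h _ _ _) fun _ => polyDegLE_const _ 0).neg

end Polynomials

/-! ### Compatibility -/

section Compatibility

variable {bc : Boundary} {m N : ℕ} {α : ℝ}

theorem bivectorOfList_skew (h : Phase bc m N → ℕ → ℕ → ℤ → ℕ → ℝ) (y : Phase bc m N)
    (p q : Label bc m N) : bivectorOfList h y p q = -bivectorOfList h y q p := by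
  unfold bivectorOfList
  rw [← Finset.sum_neg_distrib]
  exact Finset.sum_congr rfl fun l _ => by rw [neg_sub]

theorem cubicBracket_skew (y : Phase bc m N) (p q : Label bc m N) :
    cubicBracket bc m N α y p q = -cubicBracket bc m N α y q p := by
  unfold cubicBracket frameBivector
  rw [Finset.sum_comm, ← Finset.sum_neg_distrib]
  refine Finset.sum_congr rfl fun r _ => ?_
  rw [← Finset.sum_neg_distrib]
  refine Finset.sum_congr rfl fun s _ => ?_
  rw [bivectorOfList_skew]
  ring

/-- For `s ≠ 0` the bracket `s {·,·}_{2α} + t {·,·}_{3α}` is the push-forward of a Poisson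
bracket. -/
theorem arePoissonCompatible_cubicBracket (hα : α ≠ 0) :
    ArePoissonCompatible (quadraticBracket bc m N α) (cubicBracket bc m N α) := by
  have h2 : ∀ p q, ContDiff ℝ ∞ fun y => quadraticBracket bc m N α y p q := fun p q =>
    (polyDegLE_quadraticBracket p q).choose_spec.contDiff
  have h3 : ∀ p q, ContDiff ℝ ∞ fun y => cubicBracket bc m N α y p q := fun p q =>
    (polyDegLE_cubicBracket p q).contDiff
  refine arePoissonCompatible_of_ne_zero h2 h3 (bivectorOfList_skew _) cubicBracket_skew
    fun s t hs => isPoisson_of_pushForward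
      (isPoisson_bandBivector (isPeriodicBand_bandMinus (α := α) s t) (α⁻¹ * s⁻¹)) ?_ ?_
      (isPushForward_pencil hα hs t)
  · exact fun p q => ((h2 p q).const_smul s).add ((h3 p q).const_smul t)
  · intro y p q
    simp only [Pi.add_apply, Pi.smul_apply, smul_eq_mul]
    rw [cubicBracket_skew, quadraticBracket_eq, bivectorOfList_skew]
    ring

end Compatibility

/-! ### Derivations over a ring homomorphism and invariant traces -/

section Derivations

variable {R S : Type*} [Ring R] [Ring S]

/-- `δ` satisfies the Leibniz rule over the ring homomorphism `e`. -/
def IsDerivationOver (e : R →+* S) (δ : R →+ S) : Prop :=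
  ∀ x y, δ (x * y) = δ x * e y + e x * δ y

variable {e : R →+* S} {δ : R →+ S}

theorem IsDerivationOver.map_one (h : IsDerivationOver e δ) : δ 1 = 0 := by
  simpa using h 1 1

theorem IsDerivationOver.map_inverse (h : IsDerivationOver e δ) {x x' : R} (h1 : x * x' = 1)
    (h2 : x' * x = 1) : δ x' = -(e x' * δ x * e x') := by
  have h3 := h x' x
  rw [h2, h.map_one] at h3
  have h4 : δ x' * e x * e x' = -(e x' * δ x) * e x' := by
    rw [eq_neg_of_add_eq_zero_left h3.symm]
  rwa [mul_assoc, ← map_mul, h1, _root_.map_one, mul_one, neg_mul] at h4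

theorem IsDerivationOver.mapMatrix {n : Type*} [Fintype n] [DecidableEq n]
    (h : IsDerivationOver e δ) :
    IsDerivationOver (e.mapMatrix (m := n)) (δ.mapMatrix (m := n) (n := n)) := fun x y => by
  ext i j
  simp only [AddMonoidHom.mapMatrix_apply, RingHom.mapMatrix_apply, Matrix.map_apply,
    Matrix.mul_apply, Matrix.add_apply, map_sum, h _ _, Finset.sum_add_distrib]

variable {τ : S →+ ℝ}

/-- The derivative of the trace of a power, with a scalar weight `M`. The additional factor
`e T ^ k` makes the induction possible. -/
theorem IsDerivationOver.trace_pow (h : IsDerivationOver e δ) (hτ : ∀ x y, τ (x * y) = τ (y * x))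
    {M : S} (hM : ∀ x, M * x = x * M) (T : R) (n k : ℕ) :
    τ (M * (e T ^ k * δ (T ^ (n + 1)))) = (n + 1) * τ (M * (e T ^ (n + k) * δ T)) := by
  induction n generalizing k with
  | zero => simp
  | succ n ih =>
    rw [pow_succ T (n + 1), h, mul_add, mul_add, map_add, map_pow e]
    have h1 : τ (M * (e T ^ k * (δ (T ^ (n + 1)) * e T))) =
        τ (M * (e T ^ (k + 1) * δ (T ^ (n + 1)))) := by
      rw [← mul_assoc (e T ^ k), ← mul_assoc M, hτ, ← mul_assoc, ← mul_assoc, ← hM, pow_succ' (e T),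
        mul_assoc, mul_assoc, mul_assoc]
    have h2 : e T ^ k * (e T ^ (n + 1) * δ T) = e T ^ (n + 1 + k) * δ T := by
      rw [← mul_assoc, ← pow_add, add_comm k]
    rw [h1, ih, h2, show n + (k + 1) = n + 1 + k by ring]
    push_cast
    ring

/-- The derivative of the spectral invariants of `U L⁻¹`. -/
theorem IsDerivationOver.trace_mul_inv_pow (h : IsDerivationOver e δ)
    (hτ : ∀ x y, τ (x * y) = τ (y * x)) {M L U L' : R} (hM : ∀ x, e M * x = x * e M)
    (hδM : δ M = 0) (h1 : L * L' = 1) (h2 : L' * L = 1) {E Λ : S} (hL : δ L = e L * E)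
    (hU : δ U = e U * E - Λ) (n : ℕ) :
    τ (δ (M * (U * L') ^ (n + 1))) =
      -(n + 1) * τ (Λ * (e M * (e L' * (e U * e L') ^ n))) := by
  have hT : δ (U * L') = -(Λ * e L') := by
    have h3 : e L' * e L = 1 := by rw [← map_mul, h2, _root_.map_one]
    rw [h, h.map_inverse h1 h2, hU, hL, ← mul_assoc (e L'), h3, one_mul, sub_mul, mul_neg,
      mul_assoc (e U)]
    abel
  have h4 := h.trace_pow hτ hM (U * L') n 0
  rw [pow_zero, one_mul, add_zero, hT] at h4
  rw [h, hδM, zero_mul, zero_add, h4, map_mul e, mul_neg, mul_neg, map_neg]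
  have h5 : τ (e M * ((e U * e L') ^ n * (Λ * e L'))) =
      τ (Λ * (e M * (e L' * (e U * e L') ^ n))) := by
    rw [← mul_assoc, ← mul_assoc, hτ, ← mul_assoc, hτ, ← mul_assoc (e L'), ← hM,
      mul_assoc (e M)]
  rw [h5]
  ring

/-- The derivative of the spectral invariants of `L U⁻¹`. -/
theorem IsDerivationOver.trace_mul_inv_pow' (h : IsDerivationOver e δ)
    (hτ : ∀ x y, τ (x * y) = τ (y * x)) {M L U U' : R} (hM : ∀ x, e M * x = x * e M)
    (hδM : δ M = 0) (h1 : U * U' = 1) (h2 : U' * U = 1) {E Λ : S} (hL : δ L = e L * E)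
    (hU : δ U = e U * E - Λ) (n : ℕ) :
    τ (δ (M * (L * U') ^ (n + 1))) =
      (n + 1) * τ (Λ * (e M * (e U' * (e L * e U') ^ (n + 1)))) := by
  have hT : δ (L * U') = e L * e U' * (Λ * e U') := by
    have h3 : e U' * e U = 1 := by rw [← map_mul, h2, _root_.map_one]
    rw [h, h.map_inverse h1 h2, hU, hL, mul_sub, ← mul_assoc (e U'), h3, one_mul, sub_mul,
      mul_neg, mul_sub]
    simp only [mul_assoc]
    abel
  have h4 := h.trace_pow hτ hM (L * U') n 0
  rw [pow_zero, one_mul, add_zero, hT] at h4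
  rw [h, hδM, zero_mul, zero_add, h4, map_mul e]
  have h5 : τ (e M * ((e L * e U') ^ n * (e L * e U' * (Λ * e U')))) =
      τ (Λ * (e M * (e U' * (e L * e U') ^ (n + 1)))) := by
    rw [← mul_assoc (_ ^ n), ← pow_succ, ← mul_assoc, ← mul_assoc, hτ, ← mul_assoc, hτ,
      ← mul_assoc (e U'), ← hM, mul_assoc (e M)]
  rw [h5]

/-- The derivative of the logarithmic residue of `U` with respect to the derivation `θ`, weighted
with a scalar `M` that is an eigenvector of this derivation; the term with `E` drops out if its
trace against `M` vanishes. -/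
theorem IsDerivationOver.trace_log (h : IsDerivationOver e δ) (hτ : ∀ x y, τ (x * y) = τ (y * x))
    {θ : R →+ R} {ϑ : S →+ S} (hϑ : IsDerivationOver (RingHom.id S) ϑ)
    (heϑ : ∀ x, e (θ x) = ϑ (e x)) (hδϑ : ∀ x, δ (θ x) = ϑ (δ x)) (hτϑ : ∀ x, τ (ϑ x) = 0)
    {M U U' : R} (hM : ∀ x, e M * x = x * e M) (hδM : δ M = 0) {k : ℝ}
    (hϑM : ∀ x, τ (ϑ (e M) * x) = k * τ (e M * x)) (h1 : U * U' = 1) (h2 : U' * U = 1)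
    {E Λ : S} (hU : δ U = e U * E - Λ) (hE : τ (e M * E) = 0) :
    τ (δ (M * (U' * θ U))) = k * τ (Λ * (e M * e U')) := by
  have h3 : e U' * e U = 1 := by rw [← map_mul, h2, _root_.map_one]
  have h4 : ϑ (e U') = -(e U' * ϑ (e U) * e U') := by
    have := hϑ.map_inverse (x := e U) (x' := e U') (by rw [← map_mul, h1, _root_.map_one]) h3
    simpa using this
  have h5 : τ (δ (M * (U' * θ U))) = τ (e M * ϑ (e U' * δ U)) := by
    rw [h, hδM, zero_mul, zero_add, h, h.map_inverse h1 h2, hϑ, h4, heϑ, hδϑ]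
    simp only [RingHom.id_apply, mul_add, map_add]
    congr 1
    simp only [neg_mul, mul_neg, map_neg]
    rw [mul_assoc (e U' * δ U), ← mul_assoc, hτ, ← mul_assoc _ (e M), ← hM]
    simp only [mul_assoc]
  -- Integration by parts: the trace of a derivative is zero.
  have h6 : τ (ϑ (e M * (e U' * δ U))) = k * τ (e M * (e U' * δ U)) + τ (e M * ϑ (e U' * δ U)) := by
    rw [hϑ, map_add]
    simp only [RingHom.id_apply]
    rw [hϑM]
  rw [hτϑ] at h6
  have h7 : τ (e M * (e U' * δ U)) = -τ (Λ * (e M * e U')) := by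
    rw [hU, mul_sub, ← mul_assoc (e U'), h3, one_mul, mul_sub, map_sub, hE, zero_sub,
      ← mul_assoc, hτ]
  rw [h7] at h6
  rw [h5]
  linarith

end Derivations

/-! ### Termwise operations on formal Laurent series -/

section Termwise

variable {A B : Type*} [CommRing A] [CommRing B]

theorem coeff_mul_of_support_subset {x y : LaurentSeries A} {s t : Set ℤ} (hs : s.IsPWO)
    (ht : t.IsPWO) (hx : x.support ⊆ s) (hy : y.support ⊆ t) (n : ℤ) :
    (x * y).coeff n = ∑ ij ∈ Finset.antidiagonal hs ht n, x.coeff ij.1 * y.coeff ij.2 := by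
  rw [HahnSeries.coeff_mul]
  refine Finset.sum_subset (fun ij h => ?_) fun ij h h' => ?_
  · rw [Finset.mem_antidiagonal] at h ⊢
    exact ⟨hx h.1, hy h.2.1, h.2.2⟩
  · rw [Finset.mem_antidiagonal] at h h'
    by_contra h0
    exact h' ⟨left_ne_zero_of_mul h0, right_ne_zero_of_mul h0, h.2.2⟩

/-- The termwise application of additive maps, which may depend on the exponent. -/
def termwise (f : ℤ → A →+ B) : LaurentSeries A →+ LaurentSeries B where
  toFun x :=
    { coeff := fun n => f n (x.coeff n)
      isPWO_support' := x.isPWO_support.mono fun n hn h0 => hn (by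
        have h0 : x.coeff n = 0 := h0
        simp [h0]) }
  map_zero' := by ext n; simp
  map_add' x y := by ext n; simp

@[simp] theorem coeff_termwise (f : ℤ → A →+ B) (x : LaurentSeries A) (n : ℤ) :
    (termwise f x).coeff n = f n (x.coeff n) := rfl

theorem support_termwise_subset (f : ℤ → A →+ B) (x : LaurentSeries A) :
    (termwise f x).support ⊆ x.support := fun n hn h0 => hn (by
  have h0 : x.coeff n = 0 := h0
  simp [h0])

theorem termwise_single (f : ℤ → A →+ B) (n : ℤ) (a : A) :
    termwise f (HahnSeries.single n a) = HahnSeries.single n (f n a) := by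
  ext k
  rw [coeff_termwise, HahnSeries.coeff_single, HahnSeries.coeff_single]
  split_ifs with h
  · rw [h]
  · exact map_zero _

/-- The termwise application of a ring homomorphism. -/
def mapLaurent (e : A →+* B) : LaurentSeries A →+* LaurentSeries B where
  __ := termwise fun _ => (e : A →+ B)
  map_one' := by
    change termwise (fun _ => (e : A →+ B)) (HahnSeries.single 0 1) = HahnSeries.single 0 1
    rw [termwise_single]
    simp
  map_mul' x y := by
    ext n
    change (termwise (fun _ => (e : A →+ B)) (x * y)).coeff n =
      (termwise (fun _ => (e : A →+ B)) x * termwise (fun _ => (e : A →+ B)) y).coeff n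
    rw [coeff_mul_of_support_subset x.isPWO_support y.isPWO_support (support_termwise_subset _ x)
      (support_termwise_subset _ y), coeff_termwise, HahnSeries.coeff_mul, map_sum]
    exact Finset.sum_congr rfl fun ij _ => map_mul e _ _

@[simp] theorem coeff_mapLaurent (e : A →+* B) (x : LaurentSeries A) (n : ℤ) :
    (mapLaurent e x).coeff n = e (x.coeff n) := rfl

theorem mapLaurent_single (e : A →+* B) (n : ℤ) (a : A) :
    mapLaurent e (HahnSeries.single n a) = HahnSeries.single n (e a) :=
  termwise_single _ n a

theorem support_mapLaurent_subset (e : A →+* B) (x : LaurentSeries A) :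
    (mapLaurent e x).support ⊆ x.support :=
  support_termwise_subset _ x

/-- Termwise maps satisfy the Leibniz rule on series if they do so on monomials. -/
theorem termwise_mul {φ : A →+* B} {f g h : ℤ → A →+ B}
    (H : ∀ i j a b, f (i + j) (a * b) = g i a * φ b + φ a * h j b) (x y : LaurentSeries A) :
    termwise f (x * y) = termwise g x * mapLaurent φ y + mapLaurent φ x * termwise h y := by
  ext n
  rw [HahnSeries.coeff_add, coeff_mul_of_support_subset x.isPWO_support y.isPWO_support
      (support_termwise_subset g x) (support_mapLaurent_subset φ y),
    coeff_mul_of_support_subset x.isPWO_support y.isPWO_support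
      (support_mapLaurent_subset φ x) (support_termwise_subset h y),
    coeff_termwise, HahnSeries.coeff_mul, map_sum, ← Finset.sum_add_distrib]
  refine Finset.sum_congr rfl fun ij hij => ?_
  rw [Finset.mem_antidiagonal] at hij
  rw [← hij.2.2, H]
  rfl

/-- The operator `t d/dt`, in terms of the local parameter `t`, up to the sign `σ`. -/
def eulerOp (A : Type*) [CommRing A] (σ : ℤ) : LaurentSeries A →+ LaurentSeries A :=
  termwise fun n => AddMonoidHom.mulLeft ((σ * n : ℤ) : A)

@[simp] theorem coeff_eulerOp (σ : ℤ) (x : LaurentSeries A) (n : ℤ) :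
    (eulerOp A σ x).coeff n = (σ * n : ℤ) * x.coeff n := rfl

theorem mapLaurent_id : mapLaurent (RingHom.id A) = RingHom.id (LaurentSeries A) := by
  ext x n; rfl

theorem isDerivationOver_eulerOp (σ : ℤ) :
    IsDerivationOver (RingHom.id (LaurentSeries A)) (eulerOp A σ) := by
  rw [← mapLaurent_id]
  refine fun x y => termwise_mul (fun i j a b => ?_) x y
  simp only [AddMonoidHom.coe_mulLeft, RingHom.id_apply]
  push_cast
  ring

end Termwise

/-! ### The coefficients of Lax matrices -/

section Coefficients

variable {bc : Boundary} {m N : ℕ} {α : ℝ} {e : Expansion}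

theorem Expansion.sign_mul_self (e : Expansion) : e.sign * e.sign = 1 := by
  cases e <;> rfl

theorem Expansion.sign_mul_sign_mul (e : Expansion) (p : ℤ) : e.sign * (e.sign * p) = p := by
  rw [← mul_assoc, e.sign_mul_self, one_mul]

theorem Expansion.sign_mul_inj (e : Expansion) {p q : ℤ} : e.sign * p = e.sign * q ↔ p = q :=
  ⟨fun h => by rw [← e.sign_mul_sign_mul p, h, e.sign_mul_sign_mul], fun h => by rw [h]⟩

theorem lamCoeff_add (f g : LaurentSeries ℝ) (p : ℤ) :
    lamCoeff e (f + g) p = lamCoeff e f p + lamCoeff e g p := rfl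

theorem lamCoeff_sub (f g : LaurentSeries ℝ) (p : ℤ) :
    lamCoeff e (f - g) p = lamCoeff e f p - lamCoeff e g p := rfl

theorem lamCoeff_zero (p : ℤ) : lamCoeff e 0 p = 0 := rfl

theorem lamCoeff_sum {ι : Type*} (s : Finset ι) (f : ι → LaurentSeries ℝ) (p : ℤ) :
    lamCoeff e (∑ i ∈ s, f i) p = ∑ i ∈ s, lamCoeff e (f i) p := by
  simp [lamCoeff]

theorem lamCoeff_ite (c : Prop) [Decidable c] (f g : LaurentSeries ℝ) (p : ℤ) :
    lamCoeff e (if c then f else g) p = if c then lamCoeff e f p else lamCoeff e g p := by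
  split_ifs <;> rfl

theorem lamCoeff_lamMono (q : ℤ) (c : ℝ) (p : ℤ) :
    lamCoeff e (lamMono e q c) p = if p = q then c else 0 := by
  simp only [lamCoeff, lamMono, HahnSeries.coeff_single, e.sign_mul_inj]

theorem lamCoeff_one (p : ℤ) : lamCoeff e 1 p = if p = 0 then 1 else 0 := by
  have : (1 : LaurentSeries ℝ) = lamMono e 0 1 := by simp [lamMono]
  rw [this, lamCoeff_lamMono]

theorem lamCoeff_lamMono_mul (q : ℤ) (c : ℝ) (f : LaurentSeries ℝ) (p : ℤ) :
    lamCoeff e (lamMono e q c * f) p = c * lamCoeff e f (p - q) := by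
  rw [lamCoeff, lamMono, HahnSeries.coeff_single_mul, ← mul_sub]
  rfl

theorem lamCoeff_mul_lamMono (q : ℤ) (c : ℝ) (f : LaurentSeries ℝ) (p : ℤ) :
    lamCoeff e (f * lamMono e q c) p = lamCoeff e f (p - q) * c := by
  rw [mul_comm, lamCoeff_lamMono_mul, mul_comm]

theorem lamCoeff_lamNonneg (f : LaurentSeries ℝ) (p : ℤ) :
    lamCoeff e (lamNonneg e f) p = if 0 ≤ p then lamCoeff e f p else 0 := by
  simp only [lamCoeff, lamNonneg, e.sign_mul_sign_mul]

theorem lamCoeff_ext {f g : LaurentSeries ℝ} (h : ∀ p, lamCoeff e f p = lamCoeff e g p) :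
    f = g := by
  ext n
  have := h (e.sign * n)
  rwa [lamCoeff, lamCoeff, e.sign_mul_sign_mul] at this

theorem lamCoeff_laxL_mul (y : Phase bc m N) (X : LaxMatrix N) (r c : Fin N) (p : ℤ) :
    lamCoeff e ((laxL e α y * X) r c) p = (1 + α * fld y 0 (r : ℕ)) * lamCoeff e (X r c) p +
      α * ∑ s : Fin N, if SameSite bc N ((s : ℕ) + 1) (r : ℕ) then lamCoeff e (X s c) (p - 1)
        else 0 := by
  simp only [Matrix.mul_apply, laxL, add_mul, ite_mul, zero_mul, Finset.sum_add_distrib,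
    Finset.sum_ite_eq, Finset.mem_univ, if_true, lamCoeff_add, lamCoeff_sum, lamCoeff_ite,
    lamCoeff_lamMono_mul, lamCoeff_zero, Finset.mul_sum, mul_ite, mul_zero, sub_zero]

theorem lamCoeff_mul_laxL (y : Phase bc m N) (X : LaxMatrix N) (r c : Fin N) (p : ℤ) :
    lamCoeff e ((X * laxL e α y) r c) p = lamCoeff e (X r c) p * (1 + α * fld y 0 (c : ℕ)) +
      α * ∑ s : Fin N, if SameSite bc N ((c : ℕ) + 1) (s : ℕ) then lamCoeff e (X r s) (p - 1)
        else 0 := by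
  simp only [Matrix.mul_apply, laxL, mul_add, mul_ite, mul_zero, Finset.sum_add_distrib,
    Finset.sum_ite_eq', Finset.mem_univ, if_true, lamCoeff_add, lamCoeff_sum, lamCoeff_ite,
    lamCoeff_mul_lamMono, lamCoeff_zero, Finset.mul_sum, sub_zero, mul_comm _ α]

theorem lamCoeff_laxU_mul (y : Phase bc m N) (X : LaxMatrix N) (r c : Fin N) (p : ℤ) :
    lamCoeff e ((laxU e α y * X) r c) p = lamCoeff e (X r c) p -
      α * ∑ j ∈ Finset.Icc 1 m, fld y j (r : ℕ) *
        ∑ s : Fin N, if SameSite bc N ((r : ℕ) + j) (s : ℕ) then lamCoeff e (X s c) (p + j)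
          else 0 := by
  simp only [Matrix.mul_apply, laxU, sub_mul, ite_mul, zero_mul, one_mul, Finset.sum_sub_distrib,
    Finset.sum_ite_eq, Finset.mem_univ, if_true, lamCoeff_sub, lamCoeff_sum, lamCoeff_ite,
    lamCoeff_lamMono_mul, lamCoeff_zero, Finset.mul_sum, Finset.sum_mul, mul_ite, mul_zero,
    sub_neg_eq_add, mul_assoc]
  rw [Finset.sum_comm]

theorem lamCoeff_mul_laxU (y : Phase bc m N) (X : LaxMatrix N) (r c : Fin N) (p : ℤ) :
    lamCoeff e ((X * laxU e α y) r c) p = lamCoeff e (X r c) p -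
      α * ∑ j ∈ Finset.Icc 1 m, ∑ s : Fin N, if SameSite bc N ((s : ℕ) + j) (c : ℕ) then
        fld y j (s : ℕ) * lamCoeff e (X r s) (p + j) else 0 := by
  simp only [Matrix.mul_apply, laxU, mul_sub, mul_ite, mul_zero, mul_one, Finset.sum_sub_distrib,
    Finset.sum_ite_eq', Finset.mem_univ, if_true, lamCoeff_sub, lamCoeff_sum, lamCoeff_ite,
    lamCoeff_mul_lamMono, lamCoeff_zero, Finset.mul_sum, sub_neg_eq_add]
  rw [Finset.sum_comm]
  congr 1
  refine Finset.sum_congr rfl fun j _ => Finset.sum_congr rfl fun s _ => ?_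
  split_ifs
  · ring
  · rfl

/-- The coefficient of `λ^(a - b)` in the entry of a Lax matrix at the residues of `a` and `b`: the
entry `(a, b)` of the corresponding infinite matrix. -/
def band (bc : Boundary) (e : Expansion) (X : LaxMatrix N) (a b : ℤ) : ℝ :=
  ∑ r : Fin N, ∑ c : Fin N, if SameSite bc N a (r : ℕ) ∧ SameSite bc N b (c : ℕ) then
    lamCoeff e (X r c) (a - b) else 0

theorem sum_site_ite (F : Fin N → ℝ) {x : ℤ} {r : Fin N} (hr : SameSite bc N x (r : ℕ)) :
    (∑ s : Fin N, if SameSite bc N x (s : ℕ) then F s else 0) = F r := by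
  rw [Finset.sum_eq_single r, if_pos hr]
  · exact fun s _ hs => if_neg fun h => hs (sameSite_natCast_iff.1 (h.symm.trans hr))
  · exact fun h => absurd (Finset.mem_univ r) h

theorem band_eq_sum_left (X : LaxMatrix N) {a b : ℤ} {c : Fin N} (hc : SameSite bc N b (c : ℕ)) :
    band bc e X a b =
      ∑ s : Fin N, if SameSite bc N a (s : ℕ) then lamCoeff e (X s c) (a - b) else 0 := by
  refine Finset.sum_congr rfl fun r _ => ?_
  simp only [ite_and]
  split_ifs
  · exact sum_site_ite (fun c => lamCoeff e (X r c) (a - b)) hc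
  · simp

theorem band_eq_sum_right (X : LaxMatrix N) {a b : ℤ} {r : Fin N} (hr : SameSite bc N a (r : ℕ)) :
    band bc e X a b =
      ∑ s : Fin N, if SameSite bc N b (s : ℕ) then lamCoeff e (X r s) (a - b) else 0 := by
  have : ∀ s : Fin N, (∑ c : Fin N, if SameSite bc N a (s : ℕ) ∧ SameSite bc N b (c : ℕ) then
      lamCoeff e (X s c) (a - b) else 0) = if SameSite bc N a (s : ℕ) then
        (∑ c : Fin N, if SameSite bc N b (c : ℕ) then lamCoeff e (X s c) (a - b) else 0)
          else 0 := by
    intro s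
    simp only [ite_and]
    split_ifs <;> simp
  unfold band
  simp only [this]
  exact sum_site_ite
    (fun s => ∑ c : Fin N, if SameSite bc N b (c : ℕ) then lamCoeff e (X s c) (a - b) else 0) hr

theorem band_eq (X : LaxMatrix N) {a b : ℤ} {r c : Fin N} (hr : SameSite bc N a (r : ℕ))
    (hc : SameSite bc N b (c : ℕ)) : band bc e X a b = lamCoeff e (X r c) (a - b) := by
  rw [band_eq_sum_left X hc]
  exact sum_site_ite (fun s => lamCoeff e (X s c) (a - b)) hr

theorem band_of_not_left (X : LaxMatrix N) {a : ℤ} (h : ¬IsSite bc N a) (b : ℤ) :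
    band bc e X a b = 0 :=
  Finset.sum_eq_zero fun r _ => Finset.sum_eq_zero fun _ _ => if_neg fun h' => h ⟨r, h'.1⟩

theorem band_of_not_right (X : LaxMatrix N) (a : ℤ) {b : ℤ} (h : ¬IsSite bc N b) :
    band bc e X a b = 0 :=
  Finset.sum_eq_zero fun _ _ => Finset.sum_eq_zero fun c _ => if_neg fun h' => h ⟨c, h'.2⟩

theorem band_congr (X : LaxMatrix N) {a b a' b' : ℤ} (ha : SameSite bc N a a')
    (h : a - b = a' - b') :
    band bc e X a b = band bc e X a' b' := by
  have hb : SameSite bc N b b' := (sameSite_congr_sub (by linarith)).1 ha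
  unfold band
  simp only [h, sameSite_left_congr ha, sameSite_left_congr hb]

theorem band_sub (X X' : LaxMatrix N) (a b : ℤ) :
    band bc e (X - X') a b = band bc e X a b - band bc e X' a b := by
  unfold band
  simp only [← Finset.sum_sub_distrib]
  refine Finset.sum_congr rfl fun r _ => Finset.sum_congr rfl fun c _ => ?_
  split_ifs
  · rfl
  · simp

theorem band_piPlus (X : LaxMatrix N) (a b : ℤ) :
    band bc e (piPlus e X) a b = if b ≤ a then band bc e X a b else 0 := by
  unfold band
  simp only [piPlus, Matrix.map_apply, lamCoeff_lamNonneg, sub_nonneg]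
  split_ifs <;> simp

/-- The multiplication by `L` from the left, in terms of infinite matrices. -/
theorem band_laxL_mul (y : Phase bc m N) (X : LaxMatrix N) {a : ℤ} (ha : IsSite bc N a) (b : ℤ) :
    band bc e (laxL e α y * X) a b =
      (1 + α * fld y 0 a) * band bc e X a b + α * band bc e X (a - 1) b := by
  by_cases hb : IsSite bc N b
  · obtain ⟨r, hr⟩ := ha
    obtain ⟨c, hc⟩ := hb
    rw [band_eq _ hr hc, lamCoeff_laxL_mul, band_eq _ hr hc, band_eq_sum_left _ hc,
      fld_congr y 0 hr]
    congr 2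
    refine Finset.sum_congr rfl fun s _ => ?_
    rw [show a - b - 1 = a - 1 - b by ring]
    refine if_congr ?_ rfl rfl
    rw [← sameSite_right_congr hr, sameSite_comm]
    exact sameSite_congr_sub (by ring)
  · simp only [band_of_not_right _ _ hb, mul_zero, add_zero]

theorem band_mul_laxL (y : Phase bc m N) (X : LaxMatrix N) (a : ℤ) {b : ℤ} (hb : IsSite bc N b) :
    band bc e (X * laxL e α y) a b =
      band bc e X a b * (1 + α * fld y 0 b) + α * band bc e X a (b + 1) := by
  by_cases ha : IsSite bc N a
  · obtain ⟨r, hr⟩ := ha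
    obtain ⟨c, hc⟩ := hb
    rw [band_eq _ hr hc, lamCoeff_mul_laxL, band_eq _ hr hc, band_eq_sum_right _ hr,
      fld_congr y 0 hc]
    congr 2
    refine Finset.sum_congr rfl fun s _ => ?_
    rw [show a - b - 1 = a - (b + 1) by ring]
    exact if_congr (sameSite_left_congr (hc.symm.add_right 1)) rfl rfl
  · simp only [band_of_not_left _ ha, mul_zero, add_zero, zero_mul]

theorem band_laxU_mul (y : Phase bc m N) (X : LaxMatrix N) (a b : ℤ) :
    band bc e (laxU e α y * X) a b =
      band bc e X a b - α * ∑ j ∈ Finset.Icc 1 m, fld y j a * band bc e X (a + j) b := by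
  by_cases hb : IsSite bc N b
  · by_cases ha : IsSite bc N a
    · obtain ⟨r, hr⟩ := ha
      obtain ⟨c, hc⟩ := hb
      rw [band_eq _ hr hc, lamCoeff_laxU_mul, band_eq _ hr hc]
      congr 2
      refine Finset.sum_congr rfl fun j _ => ?_
      rw [band_eq_sum_left _ hc, fld_congr y j hr]
      congr 1
      refine Finset.sum_congr rfl fun s _ => ?_
      rw [show a - b + j = a + j - b by ring]
      exact if_congr (sameSite_left_congr (hr.symm.add_right j)) rfl rfl
    · rw [band_of_not_left _ ha, band_of_not_left _ ha, Finset.sum_eq_zero, mul_zero, sub_zero]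
      intro j _
      rw [fld_of_not y fun h => ha (hasLabel_iff.1 h).2.1, zero_mul]
  · simp only [band_of_not_right _ _ hb, mul_zero, Finset.sum_const_zero, sub_zero]

theorem band_mul_laxU (y : Phase bc m N) (X : LaxMatrix N) (a b : ℤ) :
    band bc e (X * laxU e α y) a b =
      band bc e X a b - α * ∑ j ∈ Finset.Icc 1 m, fld y j (b - j) * band bc e X a (b - j) := by
  by_cases ha : IsSite bc N a
  · by_cases hb : IsSite bc N b
    · obtain ⟨r, hr⟩ := ha
      obtain ⟨c, hc⟩ := hb
      rw [band_eq _ hr hc, lamCoeff_mul_laxU, band_eq _ hr hc]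
      congr 2
      refine Finset.sum_congr rfl fun j _ => ?_
      rw [band_eq_sum_right _ hr, Finset.mul_sum]
      refine Finset.sum_congr rfl fun s _ => ?_
      have h : SameSite bc N (b - j) (s : ℕ) ↔ SameSite bc N ((s : ℕ) + j) (c : ℕ) := by
        rw [← sameSite_right_congr hc, sameSite_comm]
        exact sameSite_congr_sub (by ring)
      rw [show a - b + j = a - (b - j) by ring]
      by_cases hs : SameSite bc N (b - j) (s : ℕ)
      · rw [if_pos (h.1 hs), if_pos hs, fld_congr y j hs]
      · rw [if_neg fun h' => hs (h.2 h'), if_neg hs, mul_zero]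
    · rw [band_of_not_right _ _ hb, band_of_not_right _ _ hb, Finset.sum_eq_zero, mul_zero,
        sub_zero]
      intro j _
      rw [fld_of_not y fun h => hb (by simpa using (hasLabel_iff.1 h).2.2), zero_mul]
  · simp only [band_of_not_left _ ha, mul_zero, Finset.sum_const_zero, sub_zero]

/-! ### Graded matrices -/

/-- The part of a matrix in which only those powers `λᵖ` occur in the entry `(r, c)` for which `p`
and `r - c` are the same site. -/
def gradedPart (bc : Boundary) (e : Expansion) (X : LaxMatrix N) : LaxMatrix N := fun r c =>
  termwise (fun n =>
    if SameSite bc N (e.sign * n) ((r : ℕ) - (c : ℕ)) then AddMonoidHom.id ℝ else 0)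
    (X r c)

/-- Only those powers `λᵖ` occur in the entry `(r, c)` for which `p` and `r - c` are the same
site. -/
def IsGraded (bc : Boundary) (e : Expansion) (X : LaxMatrix N) : Prop :=
  ∀ (r c : Fin N) (p : ℤ), lamCoeff e (X r c) p ≠ 0 → SameSite bc N p ((r : ℕ) - (c : ℕ))

theorem lamCoeff_gradedPart (X : LaxMatrix N) (r c : Fin N) (p : ℤ) :
    lamCoeff e (gradedPart bc e X r c) p =
      if SameSite bc N p ((r : ℕ) - (c : ℕ)) then lamCoeff e (X r c) p else 0 := by
  rw [lamCoeff, gradedPart, coeff_termwise, e.sign_mul_sign_mul]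
  split_ifs <;> rfl

theorem isGraded_iff {X : LaxMatrix N} : IsGraded bc e X ↔ gradedPart bc e X = X := by
  constructor
  · intro h
    refine Matrix.ext fun r c => lamCoeff_ext (e := e) fun p => ?_
    rw [lamCoeff_gradedPart]
    split_ifs with hp
    · rfl
    · by_contra h0
      exact hp (h r c p fun h1 => h0 h1.symm)
  · intro h r c p hp
    rw [← h, lamCoeff_gradedPart] at hp
    exact (ite_ne_right_iff.1 hp).1

/-- The graded part is a homomorphism of modules over the graded matrices. -/
theorem gradedPart_mul {X : LaxMatrix N} (hX : IsGraded bc e X) (Y : LaxMatrix N) :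
    gradedPart bc e (X * Y) = X * gradedPart bc e Y := by
  ext r c n
  rw [Matrix.mul_apply, gradedPart, coeff_termwise, Matrix.mul_apply, HahnSeries.coeff_sum,
    HahnSeries.coeff_sum, map_sum]
  refine Finset.sum_congr rfl fun s _ => ?_
  rw [gradedPart, coeff_mul_of_support_subset (X r s).isPWO_support (Y s c).isPWO_support
    subset_rfl (support_termwise_subset _ _), HahnSeries.coeff_mul, map_sum]
  refine Finset.sum_congr rfl fun ij hij => ?_
  rw [Finset.mem_antidiagonal] at hij
  rw [coeff_termwise]
  have h1 := hX r s (e.sign * ij.1) (by rw [lamCoeff, e.sign_mul_sign_mul]; exact hij.1)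
  have h2 : SameSite bc N (e.sign * n) ((r : ℕ) - (c : ℕ)) ↔
      SameSite bc N (e.sign * ij.2) ((s : ℕ) - (c : ℕ)) := by
    rw [← hij.2.2, mul_add]
    have h3 := h1.add_right (e.sign * ij.2)
    rw [sameSite_left_congr h3]
    exact sameSite_congr_sub (by ring)
  by_cases h : SameSite bc N (e.sign * ij.2) ((s : ℕ) - (c : ℕ))
  · rw [if_pos h, if_pos (h2.2 h)]; rfl
  · rw [if_neg h, if_neg fun h' => h (h2.1 h')]; simp

theorem IsGraded.mul {X Y : LaxMatrix N} (hX : IsGraded bc e X) (hY : IsGraded bc e Y) :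
    IsGraded bc e (X * Y) := by
  rw [isGraded_iff, gradedPart_mul hX, isGraded_iff.1 hY]

theorem isGraded_one : IsGraded bc e (1 : LaxMatrix N) := by
  intro r c p h
  rw [Matrix.one_apply, lamCoeff_ite, lamCoeff_one, lamCoeff_zero] at h
  split_ifs at h with h1 h2
  · rw [h1, h2, sub_self]; exact sameSite_refl _
  all_goals exact absurd rfl h

theorem IsGraded.pow {X : LaxMatrix N} (hX : IsGraded bc e X) (n : ℕ) : IsGraded bc e (X ^ n) := by
  induction n with
  | zero => rw [pow_zero]; exact isGraded_one
  | succ n ih => rw [pow_succ]; exact ih.mul hX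

/-- Inverses of graded matrices are graded. -/
theorem IsGraded.of_mul_eq_one {X Y : LaxMatrix N} (hX : IsGraded bc e X) (h : X * Y = 1) :
    IsGraded bc e Y := by
  have h' : Y * X = 1 := mul_eq_one_comm.1 h
  have h1 := gradedPart_mul hX Y
  rw [h, isGraded_iff.1 isGraded_one] at h1
  rw [isGraded_iff]
  calc gradedPart bc e Y = Y * X * gradedPart bc e Y := by rw [h', one_mul]
    _ = Y := by rw [mul_assoc, ← h1, mul_one]

theorem IsGraded.sub {X Y : LaxMatrix N} (hX : IsGraded bc e X) (hY : IsGraded bc e Y) :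
    IsGraded bc e (X - Y) := by
  intro r c p h
  by_contra h0
  have h1 : lamCoeff e (X r c) p = 0 := by_contra fun h1 => h0 (hX r c p h1)
  have h2 : lamCoeff e (Y r c) p = 0 := by_contra fun h1 => h0 (hY r c p h1)
  exact h (by rw [Matrix.sub_apply, lamCoeff_sub, h1, h2, sub_zero])

theorem IsGraded.piPlus {X : LaxMatrix N} (hX : IsGraded bc e X) : IsGraded bc e (piPlus e X) := by
  intro r c p h
  rw [_root_.piPlus, Matrix.map_apply, lamCoeff_lamNonneg] at h
  exact hX r c p (ite_ne_right_iff.1 h).2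

theorem isGraded_laxL (y : Phase bc m N) : IsGraded bc e (laxL e α y) := by
  intro r c p h
  rw [laxL, lamCoeff_add, lamCoeff_ite, lamCoeff_ite, lamCoeff_lamMono, lamCoeff_lamMono,
    lamCoeff_zero] at h
  by_contra h0
  refine h ?_
  rw [ite_eq_right_iff.2, ite_eq_right_iff.2, add_zero]
  · intro h1
    refine if_neg fun h2 => h0 ?_
    rw [h2]
    rw [sameSite_comm] at h1
    exact ((sameSite_congr_sub (by ring)).1 h1).symm
  · rintro rfl
    refine if_neg fun h2 => h0 ?_
    rw [h2, sub_self]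
    exact sameSite_refl _

theorem isGraded_laxU (y : Phase bc m N) : IsGraded bc e (laxU e α y) := by
  intro r c p h
  rw [laxU, lamCoeff_sub, lamCoeff_ite, lamCoeff_one, lamCoeff_zero, lamCoeff_sum] at h
  by_contra h0
  refine h ?_
  rw [ite_eq_right_iff.2, Finset.sum_eq_zero, sub_zero]
  · intro j _
    rw [lamCoeff_ite, lamCoeff_lamMono, lamCoeff_zero, ite_eq_right_iff]
    intro h1
    refine if_neg fun h2 => h0 ?_
    rw [h2]
    exact ((sameSite_congr_sub (by ring)).1 h1).symm
  · rintro rfl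
    refine if_neg fun h2 => h0 ?_
    rw [h2, sub_self]
    exact sameSite_refl _

/-- In the periodic case powers of `λᴺ` preserve the grading. -/
theorem isGraded_lamMono_smul {X : LaxMatrix N} (hX : IsGraded bc e X) {q : ℤ}
    (hq : bc = Boundary.openEnd → q = 0) (c : ℝ) :
    IsGraded bc e (lamMono e (N * q) c • X) := by
  intro r s p h
  rw [Matrix.smul_apply, smul_eq_mul, lamCoeff_lamMono_mul] at h
  have h1 := hX r s _ (right_ne_zero_of_mul h)
  cases bc
  · refine SameSite.trans ?_ h1
    refine (Int.modEq_iff_dvd.2 ⟨-q, by ring⟩ : p ≡ p - N * q [ZMOD N])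
  · rw [hq rfl, mul_zero, sub_zero] at h1
    exact h1

end Coefficients

/-! ### Hamiltonian vector fields of the cubic bracket -/

section Flow

variable {bc : Boundary} {m N : ℕ} {α : ℝ} {e : Expansion}

theorem isSite_of_mem_Icc {a b x : ℤ} (ha : IsSite bc N a) (hb : IsSite bc N b) (h1 : a ≤ x)
    (h2 : x ≤ b) : IsSite bc N x := by
  cases bc
  · obtain ⟨r, -⟩ := ha
    exact isSite_periodic (Nat.lt_of_le_of_lt (Nat.zero_le _) r.isLt) x
  · rw [isSite_openEnd] at *
    omega

/-- For each field `i` at most one variable at the site `κ i` contributes. -/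
theorem sum_label_family (F : ℕ → ℤ → ℝ)
    (hF : ∀ i k l, SameSite bc N k l → F i k = F i l) (κ : ℕ → ℤ)
    (h0 : ∀ i ≤ m, ¬HasLabel bc m N i (κ i) → F i (κ i) = 0) :
    (∑ r : Label bc m N, if SameSite bc N (κ r.fieldNo) r.site then F r.fieldNo r.site else 0) =
      ∑ i ∈ Finset.range (m + 1), F i (κ i) := by
  rw [sum_label_eq]
  refine Finset.sum_congr rfl fun i hi => ?_
  have h1 : ∀ r : Label bc m N, (if r.fieldNo = i then
      (if SameSite bc N (κ r.fieldNo) r.site then F r.fieldNo r.site else 0) else 0) =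
      if r.fieldNo = i ∧ SameSite bc N (κ i) r.site then F i (κ i) else 0 := fun r => by
    rw [ite_and]
    by_cases h : r.fieldNo = i
    · rw [if_pos h, if_pos h, h]
      split_ifs with h'
      · exact (hF i _ _ h').symm
      · rfl
    · rw [if_neg h, if_neg h]
  rw [Finset.sum_congr rfl fun r _ => h1 r]
  by_cases h : HasLabel bc m N i (κ i)
  · obtain ⟨p, hj, hk⟩ := h
    exact sum_label_ite i (κ i) (fun _ => F i (κ i)) p hj hk
  · rw [sum_label_ite_of_not _ h, h0 i (Nat.lt_succ_iff.1 (Finset.mem_range.1 hi)) h]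

/-- The sum of the products of the entries above the diagonal of the column `a + n`, from the row
`a` upwards, with the entries of `Y` in the row `a`. -/
def rowSum (y : Phase bc m N) (Y : ℤ → ℤ → ℝ) (n : ℕ) (a : ℤ) : ℝ :=
  ∑ i ∈ Finset.range (m + 1), fld y (i + n) (a - i) * Y a (a - i)

/-- The sum of the products of the entries above the diagonal of the row `a`, from the column
`a + n` onwards, with the entries of `Y` in the column `a + n`. -/
def colSum (y : Phase bc m N) (Y : ℤ → ℤ → ℝ) (n : ℕ) (a : ℤ) : ℝ :=
  ∑ i ∈ Finset.range (m + 1), fld y (i + n) a * Y (a + n + i) (a + n)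

/-- The components in the moving frame of a Hamiltonian vector field of the cubic bracket, in terms
of the derivatives `Y (k + j) k` of the Hamiltonian along the frame. -/
def frameField (α : ℝ) (y : Phase bc m N) (Y : ℤ → ℤ → ℝ) (n : ℕ) (a : ℤ) : ℝ :=
  (1 + α * fld y 0 (a + n)) * colSum y Y n a + α * colSum y Y (n + 1) a -
    (1 + α * fld y 0 a) * rowSum y Y n a - α * rowSum y Y (n + 1) (a - 1)

/-- The product of the matrix of the cubic bracket in the moving frame with the derivatives
`Y (k + i) k` of a function along the frame. -/
theorem sum_bivectorOfList_cubicList_mul (y : Phase bc m N) {Y : ℤ → ℤ → ℝ}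
    (hY : ∀ a b a' b', SameSite bc N a a' → a - b = a' - b' → Y a b = Y a' b') (s : Label bc m N) :
    ∑ r : Label bc m N, bivectorOfList (cubicList α) y r s * Y (r.site + r.fieldNo) r.site =
      frameField α y Y s.fieldNo s.site := by
  set j := s.fieldNo with hj
  set c := s.site with hc
  have hcs : IsSite bc N c := s.isSite_site
  have hds : IsSite bc N (c + j) := s.isSite_site_add
  let F1 : ℕ → ℤ → ℝ := fun i k =>
    fld y (i + j) k * (1 + α * fld y 0 (k + i)) * Y (k + i) k
  let F2 : ℕ → ℤ → ℝ := fun i k => α * fld y (i + j + 1) k * Y (k + i) k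
  let F3 : ℕ → ℤ → ℝ := fun i k => fld y (j + i) c * (1 + α * fld y 0 (c + j)) * Y (k + i) k
  let F4 : ℕ → ℤ → ℝ := fun i k => α * fld y (j + i + 1) c * Y (k + i) k
  have hYs : ∀ (i : ℕ) (k l : ℤ), SameSite bc N k l → Y (k + i) k = Y (l + i) l :=
    fun i k l h => hY _ _ _ _ (h.add_right i) (by ring)
  have hterm : ∀ r : Label bc m N,
      bivectorOfList (cubicList α) y r s * Y (r.site + r.fieldNo) r.site =
        ((if SameSite bc N (c + j) r.site then F3 r.fieldNo r.site else 0) +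
          if SameSite bc N (c + j + 1) r.site then F4 r.fieldNo r.site else 0) -
        ((if SameSite bc N (c - r.fieldNo) r.site then F1 r.fieldNo r.site else 0) +
          if SameSite bc N (c - r.fieldNo - 1) r.site then F2 r.fieldNo r.site else 0) := by
    intro r
    rw [bivectorOfList_congr (h' := fun y i j k l =>
      (if l = i then -(fld y (i + j) k * (1 + α * fld y 0 (k + i))) else 0) +
        if l = i + 1 then -(α * fld y (i + j + 1) k) else 0)]
    · have hr := r.fieldNo_le
      have hs := s.fieldNo_le
      have hsum : ∀ (n : ℕ) (hn : n ≤ m) (P : ℕ → Prop) (x z : ℝ),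
          (∑ l ∈ Finset.range (m + 2), if P l then
            ((if l = n then x else 0) + if l = n + 1 then z else 0) else 0) =
            (if P n then x else 0) + if P (n + 1) then z else 0 := by
        intro n hn P x z
        have : ∀ l, (if P l then ((if l = n then x else 0) + if l = n + 1 then z else 0) else 0) =
            (if l = n then (if P n then x else 0) else 0) +
              if l = n + 1 then (if P (n + 1) then z else 0) else 0 := by
          intro l
          by_cases h1 : l = n
          · subst h1; simp
          · by_cases h2 : l = n + 1
            · subst h2; simp
            · simp [h1, h2]
        simp only [this, Finset.sum_add_distrib, Finset.sum_ite_eq', Finset.mem_range]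
        rw [if_pos (c := n < m + 2) (by omega), if_pos (c := n + 1 < m + 2) (by omega)]
      unfold bivectorOfList
      rw [← hj, ← hc] at *
      rw [Finset.sum_sub_distrib, hsum _ hr (fun l => SameSite bc N (r.site + l) c),
        hsum _ hs (fun l => SameSite bc N (c + l) r.site)]
      have e1 : SameSite bc N (r.site + r.fieldNo) c ↔ SameSite bc N (c - r.fieldNo) r.site := by
        rw [sameSite_comm]; exact sameSite_congr_sub (by ring)
      have e2 : SameSite bc N (r.site + (r.fieldNo + 1 : ℕ)) c ↔
          SameSite bc N (c - r.fieldNo - 1) r.site := by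
        rw [sameSite_comm]; exact sameSite_congr_sub (by push_cast; ring)
      have e3 : SameSite bc N (c + (j + 1 : ℕ)) r.site ↔
          SameSite bc N (c + j + 1) r.site := sameSite_congr_sub (by push_cast; ring)
      simp only [e1, e2, e3, F1, F2, F3, F4]
      split_ifs <;> ring
    · intro i j k l h
      simp only [cubicList]
      congr 1
      refine if_congr ?_ rfl rfl
      constructor
      · exact fun h => h.1
      · rintro rfl
        exact ⟨rfl, fun h' => h ⟨h'.1, h'.2, h'.1⟩⟩
  have hc1 : ∀ (n : ℕ) (k l : ℤ), SameSite bc N k l → fld y n k = fld y n l :=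
    fun n k l h => fld_congr y n h
  rw [Finset.sum_congr rfl fun r _ => hterm r, Finset.sum_sub_distrib, Finset.sum_add_distrib,
    Finset.sum_add_distrib]
  rw [sum_label_family F3 (fun i k l h => by simp only [F3, hYs i k l h]) fun _ => c + j,
    sum_label_family F4 (fun i k l h => by simp only [F4, hYs i k l h]) fun _ => c + j + 1,
    sum_label_family F1 (fun i k l h => by
      simp only [F1, hYs i k l h, hc1 _ k l h, hc1 0 _ _ (h.add_right i)]) fun i => c - i,
    sum_label_family F2 (fun i k l h => by
      simp only [F2, hYs i k l h, hc1 _ k l h]) fun i => c - i - 1]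
  · simp only [frameField, rowSum, colSum, Finset.mul_sum, F1, F2, F3, F4, ← Finset.sum_add_distrib,
      ← Finset.sum_sub_distrib]
    refine Finset.sum_congr rfl fun i _ => ?_
    have a1 : c - (i : ℤ) + i = c := by ring
    have a2 : c - (i : ℤ) - 1 + i = c - 1 := by ring
    have a3 : c - 1 - (i : ℤ) = c - i - 1 := by ring
    have a4 : c + ((j + 1 : ℕ) : ℤ) = c + j + 1 := by push_cast; ring
    rw [a1, a2, a3, a4, add_comm j i, add_assoc i j 1]
    ring
  · intro i hi h
    have : fld y (i + j + 1) (c - i - 1) = 0 := fld_of_not y fun h' => h (by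
      have h'' := hasLabel_iff.1 h'
      exact hasLabel_iff.2 ⟨hi, h''.2.1, isSite_of_mem_Icc h''.2.1 h''.2.2 (by omega) (by
        push_cast; omega)⟩)
    simp only [F2, this, mul_zero, zero_mul]
  · intro i hi h
    have : fld y (i + j) (c - i) = 0 := fld_of_not y fun h' => h (by
      have h'' := hasLabel_iff.1 h'
      exact hasLabel_iff.2 ⟨hi, h''.2.1, by simpa using hcs⟩)
    simp only [F1, this, zero_mul]
  · intro i hi h
    have : fld y (j + i + 1) c = 0 := fld_of_not y fun h' => h (by
      have h'' := hasLabel_iff.1 h'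
      exact hasLabel_iff.2 ⟨hi, isSite_of_mem_Icc h''.2.1 h''.2.2 (by omega) (by
        push_cast; omega), isSite_of_mem_Icc h''.2.1 h''.2.2 (by omega) (by push_cast; omega)⟩)
    simp only [F4, this, mul_zero, zero_mul]
  · intro i hi h
    have : fld y (j + i) c = 0 := fld_of_not y fun h' => h (by
      have h'' := hasLabel_iff.1 h'
      refine hasLabel_iff.2 ⟨hi, hds, ?_⟩
      have := h''.2.2
      push_cast at this
      rwa [← add_assoc] at this)
    simp only [F3, this, zero_mul]

/-- The components in the moving frame depend on the residue of the site only. -/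
theorem frameField_congr (y : Phase bc m N) {Y : ℤ → ℤ → ℝ}
    (hY : ∀ a b a' b', SameSite bc N a a' → a - b = a' - b' → Y a b = Y a' b') (n : ℕ) {k l : ℤ}
    (h : SameSite bc N k l) : frameField α y Y n k = frameField α y Y n l := by
  unfold frameField rowSum colSum
  have h1 : ∀ n : ℤ, SameSite bc N (k + n) (l + n) := fun n => h.add_right n
  have h2 : ∀ n : ℤ, SameSite bc N (k - n) (l - n) := fun n => by
    simpa [sub_eq_add_neg] using h1 (-n)
  have h3 : ∀ n n' : ℤ, SameSite bc N (k - n - n') (l - n - n') := fun n n' => by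
    simpa [sub_sub] using h2 (n + n')
  have h4 : ∀ n n' : ℤ, Y (k + n + n') (k + n) = Y (l + n + n') (l + n) :=
    fun n n' => hY _ _ _ _ ((h1 n).add_right n') (by ring)
  have h5 : ∀ n n' : ℤ, Y (k - n) (k - n - n') = Y (l - n) (l - n - n') :=
    fun n n' => hY _ _ _ _ (h2 n) (by ring)
  have h6 : ∀ n : ℤ, Y k (k - n) = Y l (l - n) := fun n => hY _ _ _ _ h (by ring)
  simp only [fld_congr y _ (h1 _), fld_congr y _ h, fld_congr y _ (h2 _),
    fld_congr y _ (h3 _ _), h4, h5, h6]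

/-- The Hamiltonian vector field is obtained from its components in the moving frame. -/
theorem hamField_cubicBracket (y : Phase bc m N) {H : Phase bc m N → ℝ} {Y : ℤ → ℤ → ℝ}
    (hY : ∀ a b a' b', SameSite bc N a a' → a - b = a' - b' → Y a b = Y a' b')
    (hH : ∀ r : Label bc m N, fderiv ℝ H y (fun p => frame α y p r) = Y (r.site + r.fieldNo) r.site)
    (p : Label bc m N) :
    hamField (cubicBracket bc m N α) H y p = frameField α y Y p.fieldNo p.site +
      α * y p * ∑ i ∈ Finset.range (p.fieldNo + 1), frameField α y Y 0 (p.site + i) := by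
  have hfl : ∀ k, IsSite bc N k →
      fld (fun s : Label bc m N => frameField α y Y s.fieldNo s.site) 0 k =
        frameField α y Y 0 k := by
    intro k hk
    obtain ⟨s, hs, hks⟩ : HasLabel bc m N 0 k := by
      rw [hasLabel_iff]; simpa using hk
    rw [fld_eq _ s hs hks, hs]
    exact frameField_congr y hY 0 hks.symm
  have h1 : ∀ s : Label bc m N, ∑ r, bivectorOfList (cubicList α) y r s *
      fderiv ℝ H y (fun p => frame α y p r) = frameField α y Y s.fieldNo s.site := fun s => by
    rw [← sum_bivectorOfList_cubicList_mul y hY s]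
    exact Finset.sum_congr rfl fun r _ => by rw [hH]
  have h2 : hamField (cubicBracket bc m N α) H y p =
      ∑ s, frame α y p s * ∑ r, bivectorOfList (cubicList α) y r s *
        fderiv ℝ H y (fun p => frame α y p r) := by
    have h3 : ∀ r, fderiv ℝ H y (fun p => frame α y p r) =
        ∑ a, fderiv ℝ H y (Pi.single a 1) * frame α y a r := fun r => clm_apply_eq_sum _ _
    have h4 : ∀ a, fderiv ℝ H y (Pi.single a 1) * cubicBracket bc m N α y a p =
        ∑ s, frame α y p s * ∑ r, bivectorOfList (cubicList α) y r s *
          (fderiv ℝ H y (Pi.single a 1) * frame α y a r) := fun a => by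
      rw [cubicBracket, frameBivector, Finset.sum_comm]
      simp only [Finset.mul_sum]
      exact Finset.sum_congr rfl fun s _ => Finset.sum_congr rfl fun r _ => by ring
    rw [hamField, pb_skew (cubicBracket_skew y), pb_coord_left, ← Finset.sum_neg_distrib]
    have h5 : ∀ a, -(cubicBracket bc m N α y p a * fderiv ℝ H y (Pi.single a 1)) =
        fderiv ℝ H y (Pi.single a 1) * cubicBracket bc m N α y a p := fun a => by
      rw [cubicBracket_skew y p a]; ring
    rw [Finset.sum_congr rfl fun a _ => (h5 a).trans (h4 a), Finset.sum_comm]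
    simp only [h3, ← Finset.mul_sum]
    refine Finset.sum_congr rfl fun s _ => ?_
    rw [Finset.sum_comm]
    simp only [← Finset.mul_sum]
  rw [h2]
  simp only [h1]
  rw [sum_frame_mul (α := α) y (fun s => frameField α y Y s.fieldNo s.site) p]
  congr 2
  refine Finset.sum_congr rfl fun i hi => ?_
  rw [hfl]
  rw [Finset.mem_range] at hi
  exact isSite_of_mem_Icc p.isSite_site p.isSite_site_add (by omega) (by omega)

end Flow

/-! ### Lax triads -/

section LaxTriads

variable {bc : Boundary} {m N : ℕ} {α : ℝ} {e : Expansion}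

theorem fld_hamField_cubicBracket (y : Phase bc m N) {H : Phase bc m N → ℝ} {Y : ℤ → ℤ → ℝ}
    (hY : ∀ a b a' b', SameSite bc N a a' → a - b = a' - b' → Y a b = Y a' b')
    (hH : ∀ r : Label bc m N, fderiv ℝ H y (fun p => frame α y p r) = Y (r.site + r.fieldNo) r.site)
    {j : ℕ} {a : ℤ} (h : HasLabel bc m N j a) :
    fld (hamField (cubicBracket bc m N α) H y) j a = frameField α y Y j a +
      α * fld y j a * ∑ i ∈ Finset.range (j + 1), frameField α y Y 0 (a + i) := by
  obtain ⟨p, rfl, ha⟩ := h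
  rw [fld_eq _ p rfl ha, fld_eq y p rfl ha, hamField_cubicBracket y hY hH,
    frameField_congr y hY _ ha]
  congr 2
  exact Finset.sum_congr rfl fun i _ => frameField_congr y hY 0 (ha.symm.add_right i)

theorem sum_Icc_ite_le {F : ℕ → ℝ} (hF : ∀ n, m < n → F n = 0) {d : ℕ} (hd : 1 ≤ d) :
    (∑ n ∈ Finset.Icc 1 m, if d ≤ n then F n else 0) =
      ∑ i ∈ Finset.range (m + 1), F (i + d) := by
  have h1 := Finset.sum_range_add (fun n => if d ≤ n then F n else 0) d (m + 1)
  rw [Finset.sum_eq_zero (s := Finset.range d), zero_add] at h1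
  · simp only [le_add_iff_nonneg_right, zero_le, if_true] at h1
    simp only [add_comm _ d]
    rw [← h1]
    refine Finset.sum_subset (fun n hn => ?_) fun n _ hn => ?_
    · rw [Finset.mem_Icc] at hn
      rw [Finset.mem_range]
      omega
    · rw [Finset.mem_Icc] at hn
      split_ifs
      · exact hF n (by omega)
      · rfl
  · intro n hn
    rw [Finset.mem_range] at hn
    exact if_neg (by omega)

theorem sum_Icc_one {F : ℕ → ℝ} (hF : ∀ n, m < n → F n = 0) :
    ∑ n ∈ Finset.Icc 1 m, F n = ∑ i ∈ Finset.range (m + 1), F (i + 1) := by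
  rw [← sum_Icc_ite_le hF le_rfl]
  exact Finset.sum_congr rfl fun n hn => (if_pos (Finset.mem_Icc.1 hn).1).symm

theorem sum_range_succ_eq_zero_add {G : ℕ → ℝ} (hG : G (m + 1) = 0) :
    ∑ i ∈ Finset.range (m + 1), G i = G 0 + ∑ i ∈ Finset.range (m + 1), G (i + 1) := by
  rw [add_comm (G 0), ← Finset.sum_range_succ', Finset.sum_range_succ _ (m + 1), hG, add_zero]

section Sums

variable (y : Phase bc m N) (Y : ℤ → ℤ → ℝ) (a : ℤ)

theorem sum_Icc_row :
    ∑ j ∈ Finset.Icc 1 m, fld y j (a - j) * Y a (a - j) =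
      rowSum y Y 0 a - fld y 0 a * Y a a := by
  rw [sum_Icc_one (F := fun j => fld y j (a - j) * Y a (a - j)), rowSum,
    sum_range_succ_eq_zero_add (G := fun i => fld y (i + 0) (a - i) * Y a (a - i))]
  · simp
  · rw [fld_of_lt y _ (by omega), zero_mul]
  · exact fun n hn => by rw [fld_of_lt y _ hn, zero_mul]

theorem sum_Icc_col :
    ∑ j ∈ Finset.Icc 1 m, fld y j a * Y (a + j) a = colSum y Y 0 a - fld y 0 a * Y a a := by
  rw [sum_Icc_one (F := fun j => fld y j a * Y (a + j) a), colSum,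
    sum_range_succ_eq_zero_add
      (G := fun i => fld y (i + 0) a * Y (a + (0 : ℕ) + i) (a + (0 : ℕ)))]
  · simp
  · rw [fld_of_lt y _ (by omega), zero_mul]
  · exact fun n hn => by rw [fld_of_lt y _ hn, zero_mul]

theorem sum_Icc_row_sub_one :
    ∑ j ∈ Finset.Icc 1 m, fld y j (a - j) * Y (a - 1) (a - j) = rowSum y Y 1 (a - 1) := by
  rw [sum_Icc_one (F := fun j => fld y j (a - j) * Y (a - 1) (a - j)), rowSum]
  · refine Finset.sum_congr rfl fun i _ => ?_
    rw [show a - ((i + 1 : ℕ) : ℤ) = a - 1 - i by push_cast; ring]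
  · exact fun n hn => by rw [fld_of_lt y _ hn, zero_mul]

theorem sum_Icc_col_add_one :
    ∑ j ∈ Finset.Icc 1 m, fld y j a * Y (a + j) (a + 1) = colSum y Y 1 a := by
  rw [sum_Icc_one (F := fun j => fld y j a * Y (a + j) (a + 1)), colSum]
  · refine Finset.sum_congr rfl fun i _ => ?_
    rw [show a + ((i + 1 : ℕ) : ℤ) = a + (1 : ℕ) + i by push_cast; ring, Nat.cast_one]
  · exact fun n hn => by rw [fld_of_lt y _ hn, zero_mul]

theorem sum_Icc_row_ite {d : ℕ} (hd : 1 ≤ d) (x z : ℝ) :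
    (∑ j ∈ Finset.Icc 1 m, fld y j (a + d - j) * if a + d - (j : ℤ) ≤ a then
        x * Y a (a + d - j) + z * Y (a - 1) (a + d - j) else 0) =
      x * rowSum y Y d a + z * (fld y d a * Y (a - 1) a + rowSum y Y (d + 1) (a - 1)) := by
  have h1 : ∀ j : ℕ, (fld y j (a + d - j) * if a + d - (j : ℤ) ≤ a then
        x * Y a (a + d - j) + z * Y (a - 1) (a + d - j) else 0) =
      if d ≤ j then fld y j (a + d - j) * (x * Y a (a + d - j) + z * Y (a - 1) (a + d - j))
        else 0 := fun j => by
    rw [mul_ite, mul_zero]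
    exact if_congr (by omega) rfl rfl
  simp only [h1]
  rw [sum_Icc_ite_le (F := fun j => fld y j (a + d - j) *
    (x * Y a (a + d - j) + z * Y (a - 1) (a + d - j))) _ hd]
  · have h2 : fld y d a * Y (a - 1) a + rowSum y Y (d + 1) (a - 1) =
        ∑ i ∈ Finset.range (m + 1), fld y (i + d) (a - i) * Y (a - 1) (a - i) := by
      rw [sum_range_succ_eq_zero_add, rowSum]
      · congr 1
        · simp
        · refine Finset.sum_congr rfl fun i _ => ?_
          rw [show a - ((i + 1 : ℕ) : ℤ) = a - 1 - i by push_cast; ring,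
            show i + 1 + d = i + (d + 1) by ring]
      · rw [fld_of_lt y _ (by omega), zero_mul]
    rw [h2, rowSum, Finset.mul_sum, Finset.mul_sum, ← Finset.sum_add_distrib]
    refine Finset.sum_congr rfl fun i _ => ?_
    rw [show a + d - ((i + d : ℕ) : ℤ) = a - i by push_cast; ring]
    ring
  · exact fun n hn => by rw [fld_of_lt y _ hn, zero_mul]

theorem sum_Icc_col_ite {d : ℕ} (hd : 1 ≤ d) (x z : ℝ) :
    (∑ j ∈ Finset.Icc 1 m, fld y j a * if a + d ≤ a + (j : ℤ) then
        Y (a + j) (a + d) * x + z * Y (a + j) (a + d + 1) else 0) =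
      x * colSum y Y d a + z * (fld y d a * Y (a + d) (a + d + 1) + colSum y Y (d + 1) a) := by
  have h1 : ∀ j : ℕ, (fld y j a * if a + d ≤ a + (j : ℤ) then
        Y (a + j) (a + d) * x + z * Y (a + j) (a + d + 1) else 0) =
      if d ≤ j then fld y j a * (Y (a + j) (a + d) * x + z * Y (a + j) (a + d + 1))
        else 0 := fun j => by
    rw [mul_ite, mul_zero]
    exact if_congr (by omega) rfl rfl
  simp only [h1]
  rw [sum_Icc_ite_le (F := fun j => fld y j a *
    (Y (a + j) (a + d) * x + z * Y (a + j) (a + d + 1))) _ hd]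
  · have h2 : fld y d a * Y (a + d) (a + d + 1) + colSum y Y (d + 1) a =
        ∑ i ∈ Finset.range (m + 1), fld y (i + d) a * Y (a + d + i) (a + d + 1) := by
      rw [sum_range_succ_eq_zero_add, colSum]
      · congr 1
        · simp
        · refine Finset.sum_congr rfl fun i _ => ?_
          rw [show a + d + ((i + 1 : ℕ) : ℤ) = a + (d + 1 : ℕ) + i by push_cast; ring,
            show a + (d : ℤ) + 1 = a + (d + 1 : ℕ) by push_cast; ring,
            show i + 1 + d = i + (d + 1) by ring]
      · rw [fld_of_lt y _ (by omega), zero_mul]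
    rw [h2, colSum, Finset.mul_sum, Finset.mul_sum, ← Finset.sum_add_distrib]
    refine Finset.sum_congr rfl fun i _ => ?_
    rw [show a + ((i + d : ℕ) : ℤ) = a + d + i by push_cast; ring]
    ring
  · exact fun n hn => by rw [fld_of_lt y _ hn, zero_mul]

end Sums

variable {y : Phase bc m N} {X : LaxMatrix N}

/-- The diagonal of the equation `L X U = U X L`. -/
theorem band_lax_comm (hX : laxL e α y * X * laxU e α y = laxU e α y * X * laxL e α y) {a : ℤ}
    (ha : IsSite bc N a) :
    (1 + α * fld y 0 a) * (band bc e X a a - α *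
        (rowSum y (band bc e X) 0 a - fld y 0 a * band bc e X a a)) +
      α * (band bc e X (a - 1) a - α * rowSum y (band bc e X) 1 (a - 1)) =
    (band bc e X a a - α *
        (colSum y (band bc e X) 0 a - fld y 0 a * band bc e X a a)) * (1 + α * fld y 0 a) +
      α * (band bc e X a (a + 1) - α * colSum y (band bc e X) 1 a) := by
  have h := congrArg (fun X => band bc e X a a) hX
  beta_reduce at h
  rw [mul_assoc, band_laxL_mul _ _ ha, band_mul_laxU, band_mul_laxU, band_mul_laxL _ _ _ ha,
    band_laxU_mul, band_laxU_mul, sum_Icc_row, sum_Icc_col, sum_Icc_row_sub_one,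
    sum_Icc_col_add_one] at h
  exact h

/-- By the diagonal of `L X U = U X L`, the components of the flow in the directions of the `0`-th
field are differences of entries of `X` above the diagonal. -/
theorem frameField_band_zero (hα : α ≠ 0)
    (hX : laxL e α y * X * laxU e α y = laxU e α y * X * laxL e α y) {a : ℤ}
    (ha : IsSite bc N a) :
    frameField α y (band bc e X) 0 a = band bc e X a (a + 1) - band bc e X (a - 1) a := by
  have h := band_lax_comm hX ha
  rw [frameField, Nat.cast_zero, add_zero, zero_add]
  refine mul_left_cancel₀ hα ?_
  linear_combination h

/-- The differences telescope along an interval. -/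
theorem sum_frameField_band (hα : α ≠ 0)
    (hX : laxL e α y * X * laxU e α y = laxU e α y * X * laxL e α y) {a : ℤ} {d : ℕ}
    (ha : IsSite bc N a) (hd : IsSite bc N (a + d)) :
    ∑ i ∈ Finset.range (d + 1), frameField α y (band bc e X) 0 (a + i) =
      band bc e X (a + d) (a + d + 1) - band bc e X (a - 1) a := by
  have h : ∀ i ∈ Finset.range (d + 1), frameField α y (band bc e X) 0 (a + i) =
      band bc e X (a + (i + 1 : ℕ) - 1) (a + (i + 1 : ℕ)) - band bc e X (a + i - 1) (a + i) := by
    intro i hi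
    rw [Finset.mem_range] at hi
    rw [frameField_band_zero hα hX (isSite_of_mem_Icc ha hd (by omega) (by omega))]
    congr 2
    · push_cast; ring
    · push_cast; ring
  rw [Finset.sum_congr rfl h, Finset.sum_range_sub fun i : ℕ => band bc e X (a + i - 1) (a + i)]
  congr 2
  · push_cast; ring
  · push_cast; ring
  · simp
  · simp

/-- The right-hand side of the Lax equation of `L` has no entries outside of the diagonal. -/
theorem band_lax_triad_L (hα : α ≠ 0)
    (hX : laxL e α y * X * laxU e α y = laxU e α y * X * laxL e α y) {a b : ℤ}
    (ha : IsSite bc N a) (hb : IsSite bc N b) :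
    band bc e (laxL e α y * piPlus e (X * laxL e α y) - piPlus e (laxL e α y * X) * laxL e α y)
      a b = if a = b then α * ((1 + α * fld y 0 a) * frameField α y (band bc e X) 0 a) else 0 := by
  rw [band_sub, band_laxL_mul _ _ ha, band_mul_laxL _ _ _ hb]
  simp only [band_piPlus, band_mul_laxL y X _ hb, band_laxL_mul y X ha]
  rcases lt_trichotomy a b with h | rfl | h
  · rw [if_neg (by omega), if_neg (by omega), if_neg (by omega), if_neg (by omega),
      if_neg (by omega)]
    ring
  · rw [if_pos le_rfl, if_neg (by omega), if_pos le_rfl, if_neg (by omega), if_pos rfl,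
      frameField_band_zero hα hX ha]
    ring
  · rw [if_pos (by omega), if_pos (by omega), if_pos (by omega), if_pos (by omega),
      if_neg (by omega), add_sub_assoc]
    ring_nf

/-- The right-hand side of the Lax equation of `U` has only entries above the diagonal; those on and
below the diagonal vanish by `L X U = U X L`. -/
theorem band_lax_triad_U (hα : α ≠ 0)
    (hX : laxL e α y * X * laxU e α y = laxU e α y * X * laxL e α y) {a b : ℤ}
    (ha : IsSite bc N a) (hb : IsSite bc N b) :
    band bc e (laxU e α y * piPlus e (X * laxL e α y) - piPlus e (laxL e α y * X) * laxU e α y)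
      a b = if a < b then -(α * (frameField α y (band bc e X) (b - a).toNat a +
        α * fld y (b - a).toNat a *
          ∑ i ∈ Finset.range ((b - a).toNat + 1), frameField α y (band bc e X) 0 (a + i)))
      else 0 := by
  rw [band_sub, band_laxU_mul, band_mul_laxU]
  simp only [band_piPlus, band_mul_laxL y X _ hb, band_laxL_mul y X ha]
  rcases lt_trichotomy a b with h | rfl | h
  · obtain ⟨d, rfl⟩ : ∃ d : ℕ, b = a + d := ⟨(b - a).toNat, by omega⟩
    rw [if_neg (by omega), if_neg (by omega), if_pos h, show (a + d - a : ℤ).toNat = d by omega,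
      sum_Icc_row_ite y (band bc e X) a (by omega), sum_Icc_col_ite y (band bc e X) a (by omega),
      sum_frameField_band hα hX ha hb, frameField]
    ring
  · have h := band_lax_comm hX ha
    have h1 : ∀ j : ℕ, (a ≤ a + (j : ℤ)) := fun j => by omega
    have h2 : ∀ j : ℕ, (a - (j : ℤ) ≤ a) := fun j => by omega
    simp only [h1, h2, if_true, le_refl, lt_irrefl, if_false]
    have h3 : ∑ j ∈ Finset.Icc 1 m, fld y j a * (band bc e X (a + j) a * (1 + α * fld y 0 a) +
        α * band bc e X (a + j) (a + 1)) =
        (1 + α * fld y 0 a) * ∑ j ∈ Finset.Icc 1 m, fld y j a * band bc e X (a + j) a +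
          α * ∑ j ∈ Finset.Icc 1 m, fld y j a * band bc e X (a + j) (a + 1) := by
      simp only [Finset.mul_sum, ← Finset.sum_add_distrib]
      exact Finset.sum_congr rfl fun j _ => by ring
    have h4 : ∑ j ∈ Finset.Icc 1 m, fld y j (a - j) * ((1 + α * fld y 0 a) *
        band bc e X a (a - j) + α * band bc e X (a - 1) (a - j)) =
        (1 + α * fld y 0 a) * ∑ j ∈ Finset.Icc 1 m, fld y j (a - j) * band bc e X a (a - j) +
          α * ∑ j ∈ Finset.Icc 1 m, fld y j (a - j) * band bc e X (a - 1) (a - j) := by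
      simp only [Finset.mul_sum, ← Finset.sum_add_distrib]
      exact Finset.sum_congr rfl fun j _ => by ring
    rw [h3, h4, sum_Icc_row, sum_Icc_col, sum_Icc_row_sub_one, sum_Icc_col_add_one]
    linear_combination -h
  -- Below the diagonal the projections have no effect, and the entry vanishes by `L X U = U X L`.
  · have hc := congrArg (fun X => band bc e X a b) hX
    beta_reduce at hc
    rw [mul_assoc (laxU e α y), band_laxU_mul, band_mul_laxU] at hc
    simp only [band_mul_laxL y X _ hb, band_laxL_mul y X ha] at hc
    have h1 : ∀ j : ℕ, (b ≤ a + (j : ℤ)) := fun j => by omega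
    have h2 : ∀ j : ℕ, (b - (j : ℤ) ≤ a) := fun j => by omega
    simp only [h1, h2, if_true, if_pos h.le, if_neg h.not_gt]
    linear_combination -hc

/-- The derivatives of graded matrices may be compared on the level of infinite matrices. -/
theorem hasMatrixDeriv_of_isGraded {M : Phase bc m N → LaxMatrix N} {v : Phase bc m N}
    {W : LaxMatrix N} (hW : IsGraded bc e W) {F : Fin N → Fin N → ℤ → ℝ}
    (hF : ∀ r c p, F r c p ≠ 0 → SameSite bc N p ((r : ℕ) - (c : ℕ)))
    (hM : ∀ r c p, HasDerivAt (fun t : ℝ => lamCoeff e (M (y + t • v) r c) p) (F r c p) 0)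
    (h : ∀ (r c : Fin N) p, SameSite bc N (c + p) (r : ℕ) →
      F r c p = band bc e W (c + p) c) : HasMatrixDeriv e M y v W := by
  intro r c p
  have h1 := hM r c p
  by_cases hs : SameSite bc N p ((r : ℕ) - (c : ℕ))
  · have hs' : SameSite bc N (c + p) (r : ℕ) := (sameSite_congr_sub (by ring)).1 hs
    rw [h r c p hs', band_eq W hs' (sameSite_refl _), add_sub_cancel_left] at h1
    exact h1
  · have h2 : F r c p = 0 := by_contra fun h0 => hs (hF r c p h0)
    have h3 : lamCoeff e (W r c) p = 0 := by_contra fun h0 => hs (hW r c p h0)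
    rw [h3.trans h2.symm]
    exact h1

theorem hasDerivAt_fld_line (y v : Phase bc m N) (j : ℕ) (k : ℤ) :
    HasDerivAt (fun t : ℝ => fld (y + t • v) j k) (fld v j k) 0 := by
  have h : (fun t : ℝ => fld (y + t • v) j k) = fun t => fld y j k + t * fld v j k := by
    funext t
    rw [fld_add, fld_smul]
  rw [h]
  simpa using ((hasDerivAt_id (0 : ℝ)).mul_const (fld v j k)).const_add (fld y j k)

/-- If the derivatives of a function along the moving frame are the entries, on and below the
diagonal, of a matrix `X` which satisfies `L X U = U X L`, then its Hamiltonian vector field is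
given by the Lax triads with `B₁ = π₊(L X)` and `B₂ = π₊(X L)`. -/
theorem satisfiesLaxTriads_of_fderiv (hα : α ≠ 0) {H : Phase bc m N → ℝ} {n : ℕ} {q : ℤ}
    (hg : IsGraded bc e X)
    (hX : laxL e α y * X * laxU e α y = laxU e α y * X * laxL e α y)
    (hB₁ : piPlus e (covFun e α n q y (laxT₁ e α y)) = piPlus e (laxL e α y * X))
    (hB₂ : piPlus e (covFun e α n q y (laxT₂ e α y)) = piPlus e (X * laxL e α y))
    (hH : ∀ r : Label bc m N, fderiv ℝ H y (fun p => frame α y p r) =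
      band bc e X (r.site + r.fieldNo) r.site) :
    SatisfiesLaxTriads e α n q y (hamField (cubicBracket bc m N α) H y) := by
  have hY := fun a b a' b' => band_congr (bc := bc) (e := e) X (a := a) (b := b) (a' := a')
    (b' := b')
  have hL := isGraded_laxL (e := e) (α := α) y
  have hU := isGraded_laxU (e := e) (α := α) y
  have hfl := fun {j a} => fld_hamField_cubicBracket (α := α) y hY hH (j := j) (a := a)
  unfold SatisfiesLaxTriads
  simp only
  rw [hB₁, hB₂]
  set v := hamField (cubicBracket bc m N α) H y
  constructor
  · refine hasMatrixDeriv_of_isGraded (F := fun r c p => if r = c ∧ p = 0 then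
      α * fld v 0 (r : ℕ) else 0) ((hL.mul (hg.mul hL).piPlus).sub ((hL.mul hg).piPlus.mul hL))
      ?_ ?_ ?_
    · intro r c p h
      obtain ⟨rfl, rfl⟩ := (ite_ne_right_iff.1 h).1
      rw [sub_self]
      exact sameSite_refl _
    · intro r c p
      have h1 : ∀ t : ℝ, lamCoeff e (laxL e α (y + t • v) r c) p =
          (if r = c ∧ p = 0 then 1 + α * fld (y + t • v) 0 (r : ℕ) else 0) +
            lamCoeff e (if SameSite bc N ((c : ℕ) + 1) (r : ℕ) then lamMono e 1 α else 0) p := by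
        intro t
        rw [laxL, lamCoeff_add, lamCoeff_ite, lamCoeff_lamMono, lamCoeff_zero, ite_and]
      simp only [h1]
      refine HasDerivAt.add_const _ ?_
      split_ifs
      · exact ((hasDerivAt_fld_line y v 0 _).const_mul α).const_add 1
      · exact hasDerivAt_const _ _
    · intro r c p hs
      rw [band_lax_triad_L hα hX ⟨r, hs⟩ (isSite_fin c)]
      by_cases hp : p = 0
      · subst hp
        rw [add_zero] at hs
        obtain rfl := sameSite_natCast_iff.1 hs
        rw [if_pos ⟨rfl, rfl⟩, if_pos (add_zero _), add_zero, hfl (hasLabel_iff.2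
          ⟨Nat.zero_le _, isSite_fin _, by simpa using isSite_fin (bc := bc) c⟩)]
        simp only [zero_add, Finset.range_one, Finset.sum_singleton, Nat.cast_zero, add_zero]
        ring
      · rw [if_neg fun h => hp h.2, if_neg (by omega)]
  · refine hasMatrixDeriv_of_isGraded (F := fun r c p => -∑ j ∈ Finset.Icc 1 m,
      if SameSite bc N ((r : ℕ) + j) (c : ℕ) ∧ p = -j then α * fld v j (r : ℕ) else 0)
      ((hU.mul (hg.mul hL).piPlus).sub ((hL.mul hg).piPlus.mul hU)) ?_ ?_ ?_
    · intro r c p h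
      obtain ⟨j, -, hj⟩ := Finset.exists_ne_zero_of_sum_ne_zero (neg_ne_zero.1 h)
      obtain ⟨h1, rfl⟩ := (ite_ne_right_iff.1 hj).1
      exact ((sameSite_congr_sub (by ring)).1 h1).symm
    · intro r c p
      have h1 : ∀ t : ℝ, lamCoeff e (laxU e α (y + t • v) r c) p =
          lamCoeff e (if r = c then 1 else 0) p - ∑ j ∈ Finset.Icc 1 m,
            if SameSite bc N ((r : ℕ) + j) (c : ℕ) ∧ p = -j then
              α * fld (y + t • v) j (r : ℕ) else 0 := by
        intro t
        rw [laxU, lamCoeff_sub, lamCoeff_sum]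
        congr 1
        refine Finset.sum_congr rfl fun j _ => ?_
        rw [lamCoeff_ite, lamCoeff_lamMono, lamCoeff_zero, ite_and]
      simp only [h1]
      refine HasDerivAt.const_sub _ (HasDerivAt.fun_sum fun j _ => ?_)
      split_ifs
      · exact (hasDerivAt_fld_line y v j _).const_mul α
      · exact hasDerivAt_const _ _
    · intro r c p hs
      have ha : IsSite bc N ((c : ℕ) + p) := ⟨r, hs⟩
      rw [band_lax_triad_U hα hX ha (isSite_fin c)]
      have hval : ∀ j : ℕ, p = -j → SameSite bc N ((r : ℕ) + j) (c : ℕ) := by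
        rintro j rfl
        exact ((sameSite_congr_sub (by ring)).1 hs).symm
      by_cases hp : p < 0
      · obtain ⟨j, rfl⟩ : ∃ j : ℕ, p = -j := ⟨(-p).toNat, by omega⟩
        have ej : ((c : ℕ) - ((c : ℕ) + -(j : ℤ)) : ℤ).toNat = j := by omega
        rw [if_pos (by omega), ej]
        by_cases hjm : j ≤ m
        · have hl : HasLabel bc m N j ((c : ℕ) + -(j : ℤ)) :=
            hasLabel_iff.2 ⟨hjm, ha, by simpa using isSite_fin (bc := bc) c⟩
          rw [Finset.sum_eq_single j, if_pos ⟨hval j rfl, rfl⟩, ← hfl hl,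
            fld_congr v j hs]
          · intro i _ hij
            exact if_neg fun h => hij (by have := h.2; omega)
          · intro h
            exact absurd (Finset.mem_Icc.2 ⟨by omega, hjm⟩) h
        · rw [Finset.sum_eq_zero, fld_of_lt y _ (by omega), frameField, rowSum, rowSum, colSum,
            colSum]
          · have h0 : ∀ n i a, j ≤ n → fld y (i + n) a = 0 := fun n i a hn =>
              fld_of_lt y a (by omega)
            simp only [h0 j _ _ le_rfl, h0 (j + 1) _ _ (Nat.le_succ j), zero_mul,
              Finset.sum_const_zero, mul_zero, sub_self, add_zero]
          · intro i hi
            rw [Finset.mem_Icc] at hi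
            exact if_neg fun h => by have := h.2; omega
      · rw [if_neg (by omega), Finset.sum_eq_zero, neg_zero]
        intro i hi
        rw [Finset.mem_Icc] at hi
        exact if_neg fun h => by have := h.2; omega

end LaxTriads

/-! ### Rings of smooth functions -/

section SmoothFunctions

section ExtendZero

variable {V : Type*} {s : Set V}

/-- The extension by zero of a function on a subset. -/
def extendZero (f : s → ℝ) (y : V) : ℝ := if h : y ∈ s then f ⟨y, h⟩ else 0

theorem extendZero_of_mem (f : s → ℝ) {y : V} (h : y ∈ s) : extendZero f y = f ⟨y, h⟩ := dif_pos h

theorem extendZero_restrict (f : V → ℝ) {y : V} (h : y ∈ s) :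
    extendZero (fun z : s => f z) y = f y := extendZero_of_mem _ h

end ExtendZero

variable {V : Type*} [NormedAddCommGroup V] [NormedSpace ℝ V] {s : Set V}

/-- The ring of smooth functions on a subset. -/
def smoothRing (s : Set V) : Subring (s → ℝ) where
  -- Smoothness refers to the values in the subset only, hence the choice of the extension is
  -- irrelevant.
  carrier := {f | ContDiffOn ℝ ∞ (extendZero f) s}
  mul_mem' {f g} hf hg := (ContDiffOn.mul hf hg).congr fun y hy => by
    simp only [extendZero_of_mem _ hy]; rfl
  one_mem' := (contDiffOn_const (c := (1 : ℝ))).congr fun y hy => extendZero_of_mem _ hy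
  add_mem' {f g} hf hg := (ContDiffOn.add hf hg).congr fun y hy => by
    simp only [extendZero_of_mem _ hy, Pi.add_apply]
  zero_mem' := (contDiffOn_const (c := (0 : ℝ))).congr fun y hy => extendZero_of_mem _ hy
  neg_mem' {f} hf := (ContDiffOn.neg hf).congr fun y hy => by
    simp only [extendZero_of_mem _ hy]; rfl

/-- The restriction of a smooth function. -/
def smoothRing.of (f : V → ℝ) (hf : ContDiffOn ℝ ∞ f s) : smoothRing s :=
  ⟨fun z => f z, hf.congr fun _ hy => extendZero_restrict f hy⟩

/-- The evaluation at a point. -/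
def smoothRing.eval (y : s) : smoothRing s →+* ℝ :=
  (Pi.evalRingHom (fun _ => ℝ) y).comp (smoothRing s).subtype

theorem smoothRing.eval_of (f : V → ℝ) (hf : ContDiffOn ℝ ∞ f s) (y : s) :
    smoothRing.eval y (smoothRing.of f hf) = f y := rfl

theorem smoothRing.ext_eval {f g : smoothRing s}
    (h : ∀ y, smoothRing.eval y f = smoothRing.eval y g) : f = g :=
  Subtype.ext (funext h)

theorem smoothRing.extendZero_eq (f : smoothRing s) {y : V} (h : y ∈ s) :
    extendZero (f : s → ℝ) y = smoothRing.eval ⟨y, h⟩ f := extendZero_of_mem _ h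

theorem smoothRing.isUnit_of {f : V → ℝ} (hf : ContDiffOn ℝ ∞ f s) (h0 : ∀ y ∈ s, f y ≠ 0) :
    IsUnit (smoothRing.of f hf) := by
  refine IsUnit.of_mul_eq_one (smoothRing.of (fun y => (f y)⁻¹) (hf.inv h0)) ?_
  refine smoothRing.ext_eval fun y => ?_
  rw [map_mul, smoothRing.eval_of, smoothRing.eval_of, map_one, mul_inv_cancel₀ (h0 y y.2)]

theorem smoothRing.differentiableAt (hs : IsOpen s) (f : smoothRing s) (y : s) :
    DifferentiableAt ℝ (extendZero (f : s → ℝ)) y :=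
  (f.2.contDiffAt (hs.mem_nhds y.2)).differentiableAt (by simp)

theorem smoothRing.fderiv_congr (hs : IsOpen s) {f g : V → ℝ} (h : Set.EqOn f g s) (y : s) :
    fderiv ℝ f y = fderiv ℝ g y :=
  (h.eventuallyEq_of_mem (hs.mem_nhds y.2)).fderiv_eq

/-- The derivative at a point along a vector. -/
def smoothRing.deriv (hs : IsOpen s) (y : s) (w : V) : smoothRing s →+ ℝ where
  toFun f := fderiv ℝ (extendZero (f : s → ℝ)) y w
  map_zero' := by
    rw [smoothRing.fderiv_congr hs (g := fun _ => 0) fun z hz => extendZero_of_mem _ hz]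
    simp
  map_add' f g := by
    rw [smoothRing.fderiv_congr hs
      (g := extendZero (f : s → ℝ) + extendZero (g : s → ℝ)) fun z hz => by
        simp only [Pi.add_apply, extendZero_of_mem _ hz, Subring.coe_add],
      fderiv_add (smoothRing.differentiableAt hs f y) (smoothRing.differentiableAt hs g y)]
    rfl

theorem smoothRing.deriv_of (hs : IsOpen s) (y : s) (w : V) (f : V → ℝ)
    (hf : ContDiffOn ℝ ∞ f s) :
    smoothRing.deriv hs y w (smoothRing.of f hf) = fderiv ℝ f y w :=
  congrArg (fun l => l w)
    (smoothRing.fderiv_congr hs (fun _ hz => extendZero_restrict f hz) y)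

theorem smoothRing.isDerivationOver_deriv (hs : IsOpen s) (y : s) (w : V) :
    IsDerivationOver (smoothRing.eval y) (smoothRing.deriv hs y w) := fun f g => by
  change fderiv ℝ (extendZero ((f * g : smoothRing s) : s → ℝ)) y w =
    fderiv ℝ (extendZero (f : s → ℝ)) y w * _ + _ * fderiv ℝ (extendZero (g : s → ℝ)) y w
  rw [smoothRing.fderiv_congr hs
    (g := extendZero (f : s → ℝ) * extendZero (g : s → ℝ)) fun z hz => by
      simp only [Pi.mul_apply, extendZero_of_mem _ hz, Subring.coe_mul],
    fderiv_mul (smoothRing.differentiableAt hs f y) (smoothRing.differentiableAt hs g y)]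
  simp only [_root_.add_apply, _root_.smul_apply, smul_eq_mul, smoothRing.extendZero_eq _ y.2]
  ring

end SmoothFunctions

/-! ### Twisted derivations of Laurent matrices -/

section LogarithmicDerivative

variable {A : Type*} [CommRing A] {φ : A →+* ℝ} {d : A →+ ℝ}

/-- The logarithmic derivative of units. -/
def IsDerivationOver.logDeriv (h : IsDerivationOver φ d) : Aˣ →* Multiplicative ℝ where
  toFun u := Multiplicative.ofAdd (d u * φ (u⁻¹ : Aˣ))
  map_one' := by simp [h.map_one]
  map_mul' u v := by
    rw [← ofAdd_add]
    congr 1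
    have h1 : φ u * φ (u⁻¹ : Aˣ) = 1 := by rw [← map_mul, u.mul_inv, _root_.map_one]
    have h2 : φ v * φ (v⁻¹ : Aˣ) = 1 := by rw [← map_mul, v.mul_inv, _root_.map_one]
    rw [Units.val_mul, h, mul_inv, Units.val_mul, map_mul]
    linear_combination (d u * φ (u⁻¹ : Aˣ)) * h2 + (d v * φ (v⁻¹ : Aˣ)) * h1

theorem IsDerivationOver.map_unit (h : IsDerivationOver φ d) (u : Aˣ) :
    d u = Multiplicative.toAdd (h.logDeriv u) * φ u := by
  have h1 : φ (u⁻¹ : Aˣ) * φ u = 1 := by rw [← map_mul, u.inv_mul, _root_.map_one]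
  change d u = d u * φ (u⁻¹ : Aˣ) * φ u
  rw [mul_assoc, h1, mul_one]

/-- The derivative of an integral power of a product of units. -/
theorem IsDerivationOver.map_prod_zpow (h : IsDerivationOver φ d) {ι : Type*} [Fintype ι]
    (u : ι → Aˣ) {x : ι → ℝ} (hx : ∀ i, d (u i) = x i * φ (u i)) (q : ℤ) :
    d (((∏ i, u i) ^ q : Aˣ) : A) = q * (∑ i, x i) * φ ((∏ i, u i) ^ q : Aˣ) := by
  have h1 : ∀ i, Multiplicative.toAdd (h.logDeriv (u i)) = x i := fun i => by
    have h2 : φ (u i) * φ ((u i)⁻¹ : Aˣ) = 1 := by rw [← map_mul, (u i).mul_inv, _root_.map_one]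
    change d (u i) * φ ((u i)⁻¹ : Aˣ) = x i
    rw [hx, mul_assoc, h2, mul_one]
  rw [h.map_unit, map_zpow, map_prod, toAdd_zpow, toAdd_prod, zsmul_eq_mul]
  simp only [h1]

end LogarithmicDerivative

section TwistedDerivations

variable {A B : Type*} [CommRing A] [CommRing B] {N : ℕ} {e : Expansion}

/-- The map `a ↦ d a - x φ a`. -/
def shiftDeriv (φ : A →+* ℝ) (d : A →+ ℝ) (x : ℝ) : A →+ ℝ :=
  d - (AddMonoidHom.mulLeft x).comp (φ : A →+ ℝ)

@[simp] theorem shiftDeriv_apply (φ : A →+* ℝ) (d : A →+ ℝ) (x : ℝ) (a : A) :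
    shiftDeriv φ d x a = d a - x * φ a := rfl

/-- The difference of the coefficientwise extension of `d` and of the derivation which multiplies
`λᵖ E_{rc}` by `z c - z r - ν p`; the latter is the sum of an inner derivation and of a multiple of
`λ d/dλ`. -/
def twistedDeriv (e : Expansion) (φ : A →+* ℝ) (d : A →+ ℝ) (z : Fin N → ℝ) (ν : ℝ) :
    Matrix (Fin N) (Fin N) (LaurentSeries A) →+ LaxMatrix N where
  toFun X := fun r c =>
    termwise (fun n => shiftDeriv φ d (z c - z r - ν * (e.sign * n : ℤ))) (X r c)
  map_zero' := Matrix.ext fun _ _ => map_zero (termwise _)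
  map_add' X Y := Matrix.ext fun r c => map_add (termwise _) (X r c) (Y r c)

theorem twistedDeriv_apply (φ : A →+* ℝ) (d : A →+ ℝ) (z : Fin N → ℝ) (ν : ℝ)
    (X : Matrix (Fin N) (Fin N) (LaurentSeries A)) (r c : Fin N) :
    twistedDeriv e φ d z ν X r c =
      termwise (fun n => shiftDeriv φ d (z c - z r - ν * (e.sign * n : ℤ))) (X r c) := rfl

/-- The weight `z c - z r - ν p` is additive under multiplication of the monomials `λᵖ E_{rc}`. -/
theorem isDerivationOver_twistedDeriv {φ : A →+* ℝ} {d : A →+ ℝ} (h : IsDerivationOver φ d)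
    (z : Fin N → ℝ) (ν : ℝ) :
    IsDerivationOver ((mapLaurent φ).mapMatrix) (twistedDeriv e φ d z ν) := fun X Y => by
  refine Matrix.ext fun r c => ?_
  rw [twistedDeriv_apply, Matrix.mul_apply, map_sum, Matrix.add_apply, Matrix.mul_apply,
    Matrix.mul_apply, ← Finset.sum_add_distrib]
  refine Finset.sum_congr rfl fun s _ => ?_
  refine termwise_mul (fun i j a b => ?_) (X r s) (Y s c)
  simp only [shiftDeriv_apply, h a b, map_mul]
  push_cast
  ring

/-- The residue of the trace with respect to `dλ / λ`, i.e. the constant coefficient. -/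
def traceRes (A : Type*) [CommRing A] (N : ℕ) :
    Matrix (Fin N) (Fin N) (LaurentSeries A) →+ A where
  toFun X := X.trace.coeff 0
  map_zero' := by simp
  map_add' X Y := by simp [Matrix.trace_add]

theorem traceRes_mul_comm (X Y : Matrix (Fin N) (Fin N) (LaurentSeries A)) :
    traceRes A N (X * Y) = traceRes A N (Y * X) := by
  change (X * Y).trace.coeff 0 = (Y * X).trace.coeff 0
  rw [Matrix.trace_mul_comm]

theorem traceRes_eq_sum (X : Matrix (Fin N) (Fin N) (LaurentSeries A)) :
    traceRes A N X = ∑ r, (X r r).coeff 0 := by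
  change X.trace.coeff 0 = _
  simp [Matrix.trace]

/-- The twist has no effect on the residue of the trace, where `r = c` and `p = 0`. -/
theorem traceRes_twistedDeriv (φ : A →+* ℝ) (d : A →+ ℝ) (z : Fin N → ℝ) (ν : ℝ)
    (X : Matrix (Fin N) (Fin N) (LaurentSeries A)) :
    traceRes ℝ N (twistedDeriv e φ d z ν X) = d (traceRes A N X) := by
  simp only [traceRes_eq_sum, map_sum, twistedDeriv_apply, coeff_termwise, shiftDeriv_apply]
  simp

/-- The residue of a derivative is zero. -/
theorem traceRes_eulerOp (X : Matrix (Fin N) (Fin N) (LaurentSeries A)) :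
    traceRes A N ((eulerOp A e.sign).mapMatrix X) = 0 := by
  simp [traceRes_eq_sum]

theorem mapMatrix_eulerOp (φ : A →+* ℝ) (X : Matrix (Fin N) (Fin N) (LaurentSeries A)) :
    (mapLaurent φ).mapMatrix ((eulerOp A e.sign).mapMatrix X) =
      (eulerOp ℝ e.sign).mapMatrix ((mapLaurent φ).mapMatrix X) :=
  Matrix.ext fun r c => by
    ext n
    simp [eulerOp]

theorem twistedDeriv_eulerOp (φ : A →+* ℝ) (d : A →+ ℝ) (z : Fin N → ℝ) (ν : ℝ)
    (X : Matrix (Fin N) (Fin N) (LaurentSeries A)) :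
    twistedDeriv e φ d z ν ((eulerOp A e.sign).mapMatrix X) =
      (eulerOp ℝ e.sign).mapMatrix (twistedDeriv e φ d z ν X) :=
  Matrix.ext fun r c => by
    ext n
    rw [twistedDeriv_apply, coeff_termwise, AddMonoidHom.mapMatrix_apply, Matrix.map_apply,
      AddMonoidHom.mapMatrix_apply, Matrix.map_apply, coeff_eulerOp, coeff_eulerOp,
      twistedDeriv_apply, coeff_termwise, ← zsmul_eq_mul, map_zsmul, zsmul_eq_mul]

end TwistedDerivations

/-! ### Lax matrices over commutative rings -/

section GenericLaxMatrices

variable {bc : Boundary} {m N : ℕ} {e : Expansion} {A : Type*} [CommRing A]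

/-- The matrix `L` with coefficients in a commutative ring: the diagonal entries are `D`, and `a`
is the coefficient of `λ`. -/
def genL (bc : Boundary) (e : Expansion) (a : A) (D : Fin N → A) :
    Matrix (Fin N) (Fin N) (LaurentSeries A) :=
  fun r c => (if r = c then HahnSeries.single (e.sign * 0) (D r) else 0) +
    (if SameSite bc N ((c : ℕ) + 1) (r : ℕ) then HahnSeries.single (e.sign * 1) a else 0)

/-- The matrix `U` with coefficients in a commutative ring: `-C j` is the `j`-th diagonal. -/
def genU (bc : Boundary) (m : ℕ) (e : Expansion) (C : ℕ → Fin N → A) :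
    Matrix (Fin N) (Fin N) (LaurentSeries A) :=
  fun r c => (if r = c then 1 else 0) - ∑ j ∈ Finset.Icc 1 m,
    if SameSite bc N ((r : ℕ) + j) (c : ℕ) then HahnSeries.single (e.sign * -j) (C j r) else 0

/-- The scalar matrix `u λ^(N q)`. -/
def genScalar (N : ℕ) (e : Expansion) (q : ℤ) (u : A) : Matrix (Fin N) (Fin N) (LaurentSeries A) :=
  Matrix.diagonal fun _ => HahnSeries.single (e.sign * (N * q)) u

theorem laxL_eq_genL (α : ℝ) (y : Phase bc m N) :
    laxL e α y = genL bc e α fun r => 1 + α * fld y 0 (r : ℕ) := rfl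

theorem laxU_eq_genU (α : ℝ) (y : Phase bc m N) :
    laxU e α y = genU bc m e fun j r => α * fld y j (r : ℕ) := rfl

theorem genScalar_mul (q : ℤ) (u : ℝ) (X : LaxMatrix N) :
    genScalar N e q u * X = lamMono e (N * q) u • X := by
  rw [genScalar, ← Matrix.smul_one_eq_diagonal, smul_mul_assoc, one_mul, lamMono]

theorem genScalar_mul_comm (q : ℤ) (u : A) (X : Matrix (Fin N) (Fin N) (LaurentSeries A)) :
    genScalar N e q u * X = X * genScalar N e q u := by
  refine Matrix.ext fun r c => ?_
  rw [genScalar, Matrix.diagonal_mul, Matrix.mul_diagonal, mul_comm]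

section Map

variable {B : Type*} [CommRing B] (φ : A →+* B)

theorem mapMatrix_genL (a : A) (D : Fin N → A) :
    (mapLaurent φ).mapMatrix (genL bc e a D) = genL bc e (φ a) fun r => φ (D r) := by
  refine Matrix.ext fun r c => ?_
  simp only [RingHom.mapMatrix_apply, Matrix.map_apply, genL, map_add, apply_ite (mapLaurent φ),
    mapLaurent_single, map_zero]

theorem mapMatrix_genU (C : ℕ → Fin N → A) :
    (mapLaurent φ).mapMatrix (genU bc m e C) = genU bc m e fun j r => φ (C j r) := by
  refine Matrix.ext fun r c => ?_
  simp only [RingHom.mapMatrix_apply, Matrix.map_apply, genU, map_sub, map_sum,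
    apply_ite (mapLaurent φ), mapLaurent_single, map_zero, map_one]

theorem mapMatrix_genScalar (q : ℤ) (u : A) :
    (mapLaurent φ).mapMatrix (genScalar N e q u) = genScalar N e q (φ u) := by
  refine Matrix.ext fun r c => ?_
  simp only [RingHom.mapMatrix_apply, Matrix.map_apply, genScalar, Matrix.diagonal_apply,
    apply_ite (mapLaurent φ), mapLaurent_single, map_zero]

end Map

section Derivative

variable {φ : A →+* ℝ} {d : A →+ ℝ}

/-- The diagonal of the inner part of the twist which makes the derivatives of `L` along the moving
frame multiples of `L` from the right. It jumps by `x` behind the site `k`; the linear part makes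
it compatible with periodic boundary conditions, in combination with the multiple `x / N` of
`λ d/dλ`. -/
def twistWeight (k : Fin N) (x : ℝ) (c : Fin N) : ℝ :=
  x * ((if k < c then 1 else 0) - (c : ℕ) / N)

/-- On the subdiagonal entries of `L`, the weight of the twist is concentrated in the column `k`.
-/
theorem twistWeight_succ (k : Fin N) (x : ℝ) {r c : Fin N}
    (h : SameSite bc N ((c : ℕ) + 1) (r : ℕ)) :
    twistWeight k x r - twistWeight k x c + x / N = if c = k then x else 0 := by
  have hN : (N : ℝ) ≠ 0 := by
    have := c.isLt
    exact_mod_cast (by omega : N ≠ 0)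
  have hcases : (r : ℕ) = c + 1 ∨ (r : ℕ) = 0 ∧ (c : ℕ) + 1 = N := by
    have hr := r.isLt
    have hc := c.isLt
    cases bc
    · have h1 : (((c : ℕ) : ℤ) + 1) % N = ((r : ℕ) : ℤ) % N := h
      rw [Int.emod_eq_of_lt (b := (N : ℤ)) (a := ((r : ℕ) : ℤ)) (by omega) (by omega)] at h1
      by_cases h2 : (c : ℕ) + 1 = N
      · right
        rw [← Nat.cast_succ, Nat.succ_eq_add_one, h2, Int.emod_self] at h1
        omega
      · left
        rw [Int.emod_eq_of_lt (by omega) (by omega)] at h1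
        omega
    · have h1 : ((c : ℕ) : ℤ) + 1 = ((r : ℕ) : ℤ) := h
      omega
  have hk := k.isLt
  rcases hcases with h1 | ⟨h1, h2⟩
  · have h3 : (if k < r then (1 : ℝ) else 0) =
        (if k < c then 1 else 0) + if c = k then 1 else 0 := by
      simp only [Fin.lt_def, Fin.ext_iff, h1]
      split_ifs <;> first | omega | norm_num
    rw [twistWeight, twistWeight, h3, h1]
    push_cast
    split_ifs <;> field_simp <;> ring
  · have h3 : (if k < c then (1 : ℝ) else 0) = 1 - if c = k then 1 else 0 := by
      simp only [Fin.lt_def, Fin.ext_iff]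
      split_ifs <;> first | omega | norm_num
    have h4 : ((c : ℕ) : ℝ) = N - 1 := eq_sub_of_add_eq (by exact_mod_cast h2)
    have h5 : (if k < r then (1 : ℝ) else 0) = 0 := if_neg (by rw [Fin.lt_def]; omega)
    rw [twistWeight, twistWeight, h3, h5, h4, h1]
    push_cast
    split_ifs <;> field_simp <;> ring

/-- On the `j`-th diagonal, the weight of the twist counts how often the site `k` occurs in an
interval of length `j`. -/
theorem twistWeight_add (k : Fin N) (x : ℝ) {r c : Fin N} {j : ℕ}
    (h : SameSite bc N ((r : ℕ) + j) (c : ℕ)) :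
    twistWeight k x c - twistWeight k x r + x / N * j =
      x * ∑ i ∈ Finset.range j, if SameSite bc N ((r : ℕ) + i) (k : ℕ) then 1 else 0 := by
  induction j generalizing c with
  | zero =>
    rw [Nat.cast_zero, add_zero, sameSite_natCast_iff] at h
    simp [h]
  | succ j ih =>
    obtain ⟨s, hs⟩ : IsSite bc N ((r : ℕ) + j) :=
      isSite_of_mem_Icc (isSite_fin r) ⟨c, h⟩ (by omega) (by push_cast; omega)
    have h1 : SameSite bc N ((s : ℕ) + 1) (c : ℕ) := by
      refine (hs.symm.add_right 1).trans ?_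
      rw [add_assoc]
      exact_mod_cast h
    have h2 : (if SameSite bc N ((r : ℕ) + j) (k : ℕ) then (1 : ℝ) else 0) =
        if s = k then 1 else 0 :=
      if_congr ((sameSite_left_congr hs).trans sameSite_natCast_iff) rfl rfl
    have h3 := twistWeight_succ k x h1
    rw [Finset.sum_range_succ, mul_add, ← ih hs, h2, mul_ite, mul_one, mul_zero, ← h3]
    push_cast
    ring

/-- The derivation used for the derivatives along the column of the moving frame which belongs to
the site `k`. -/
abbrev siteDeriv (e : Expansion) (φ : A →+* ℝ) (d : A →+ ℝ) (k : Fin N) (x : ℝ) :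
    Matrix (Fin N) (Fin N) (LaurentSeries A) →+ LaxMatrix N :=
  twistedDeriv e φ d (twistWeight k x) (x / N)

/-- The matrix `x E_{kk}`. -/
def siteUnit (e : Expansion) (k : Fin N) (x : ℝ) : LaxMatrix N :=
  Matrix.diagonal fun c => if c = k then lamMono e 0 x else 0

/-- The matrix `x λ^{-j} E_{k,k+j}`. -/
def bandUnit (bc : Boundary) (e : Expansion) (k : Fin N) (j : ℕ) (x : ℝ) : LaxMatrix N :=
  fun r c => if r = k ∧ SameSite bc N ((k : ℕ) + j) (c : ℕ) then lamMono e (-j) x else 0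

/-- The derivative of `L` is `L E` with the diagonal matrix `E = x E_{kk}`. -/
theorem siteDeriv_genL (k : Fin N) (x : ℝ) {a : A} {D : Fin N → A} (ha : d a = 0)
    (hD : ∀ r, d (D r) = if r = k then x * φ (D r) else 0) :
    siteDeriv e φ d k x (genL bc e a D) =
      (mapLaurent φ).mapMatrix (genL bc e a D) * siteUnit e k x := by
  refine Matrix.ext fun r c => ?_
  rw [mapMatrix_genL, siteUnit, Matrix.mul_diagonal, twistedDeriv_apply, genL, genL, map_add,
    add_mul]
  congr 1
  · by_cases h : r = c
    · subst h
      rw [if_pos rfl, if_pos rfl, termwise_single, shiftDeriv_apply, e.sign_mul_sign_mul, hD]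
      split_ifs
      · rw [lamMono, HahnSeries.single_mul_single]
        simp [mul_comm]
      · simp
    · rw [if_neg h, if_neg h, map_zero, zero_mul]
  · split_ifs with h hc
    · have h1 := twistWeight_succ k x h
      rw [if_pos hc] at h1
      rw [termwise_single, shiftDeriv_apply, e.sign_mul_sign_mul, ha, lamMono,
        HahnSeries.single_mul_single, mul_zero, add_zero]
      congr 1
      push_cast
      linear_combination φ a * h1
    · have h1 := twistWeight_succ k x h
      rw [if_neg hc] at h1
      rw [termwise_single, shiftDeriv_apply, e.sign_mul_sign_mul, ha, mul_zero,
        HahnSeries.single_eq_zero_iff]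
      push_cast
      linear_combination φ a * h1
    · rw [map_zero, zero_mul]
    · rw [map_zero, zero_mul]

/-- The derivative of `U` is `U E - Λ`, with the same matrix `E` as for `L` and
`Λ = κ λ^{-j} E_{k,k+j}`. -/
theorem siteDeriv_genU (h : IsDerivationOver φ d) (k : Fin N) {x κ : ℝ} {j : ℕ} (hj : j ≤ m)
    (hx : x = if j = 0 then κ else 0) {C : ℕ → Fin N → A}
    (hC : ∀ i ∈ Finset.Icc 1 m, ∀ r, d (C i r) = (if i = j ∧ r = k then κ else 0) +
      φ (C i r) * (x * ∑ l ∈ Finset.range (i + 1),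
        if SameSite bc N ((r : ℕ) + l) (k : ℕ) then 1 else 0)) :
    siteDeriv e φ d k x (genU bc m e C) =
      (mapLaurent φ).mapMatrix (genU bc m e C) * siteUnit e k x - bandUnit bc e k j κ := by
  refine Matrix.ext fun r c => ?_
  rw [Matrix.sub_apply, mapMatrix_genU, siteUnit, Matrix.mul_diagonal, twistedDeriv_apply, genU,
    genU, map_sub, sub_mul, map_sum, Finset.sum_mul]
  have h1 : termwise (fun n => shiftDeriv φ d (twistWeight k x c - twistWeight k x r -
      x / N * (e.sign * n : ℤ))) (if r = c then 1 else 0) = 0 := by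
    split_ifs with hrc
    · rw [← HahnSeries.single_zero_one, termwise_single, shiftDeriv_apply, h.map_one, hrc]
      simp
    · exact map_zero _
  have h2 : ∀ i ∈ Finset.Icc 1 m, termwise (fun n => shiftDeriv φ d (twistWeight k x c -
      twistWeight k x r - x / N * (e.sign * n : ℤ))) (if SameSite bc N ((r : ℕ) + i) (c : ℕ) then
        HahnSeries.single (e.sign * -i) (C i r) else 0) =
      (if SameSite bc N ((r : ℕ) + i) (c : ℕ) then
        HahnSeries.single (e.sign * -i) (φ (C i r)) else 0) * (if c = k then lamMono e 0 x else 0) +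
      if i = j then (if r = k ∧ SameSite bc N ((k : ℕ) + j) (c : ℕ) then lamMono e (-j) κ else 0)
        else 0 := by
    intro i hi
    by_cases hs : SameSite bc N ((r : ℕ) + i) (c : ℕ)
    · have h3 := twistWeight_add k x hs
      have h4 : (if SameSite bc N ((r : ℕ) + i) (k : ℕ) then (1 : ℝ) else 0) =
          if c = k then 1 else 0 :=
        if_congr ((sameSite_left_congr hs).trans sameSite_natCast_iff) rfl rfl
      have h5 : (if i = j then (if r = k ∧ SameSite bc N ((k : ℕ) + j) (c : ℕ) then
          lamMono e (-j) κ else 0) else 0) =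
          HahnSeries.single (e.sign * -i) (if i = j ∧ r = k then κ else 0) := by
        by_cases hij : i = j
        · subst hij
          by_cases hr : r = k
          · subst hr
            rw [if_pos rfl, if_pos ⟨rfl, hs⟩, if_pos ⟨rfl, rfl⟩, lamMono]
          · rw [if_pos rfl, if_neg fun h => hr h.1, if_neg fun h => hr h.2,
              HahnSeries.single_eq_zero]
        · rw [if_neg hij, if_neg fun h => hij h.1, HahnSeries.single_eq_zero]
      have h6 : HahnSeries.single (e.sign * -(i : ℤ)) (φ (C i r)) *
          (if c = k then lamMono e 0 x else 0) =
          HahnSeries.single (e.sign * -(i : ℤ)) (φ (C i r) * if c = k then x else 0) := by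
        split_ifs
        · rw [lamMono, HahnSeries.single_mul_single, mul_zero, add_zero]
        · rw [mul_zero, mul_zero, HahnSeries.single_eq_zero]
      rw [if_pos hs, if_pos hs, h5, h6, termwise_single, ← HahnSeries.single_add, shiftDeriv_apply,
        e.sign_mul_sign_mul, hC i hi r, Finset.sum_range_succ, h4]
      congr 1
      have h7 : (if c = k then x else 0) = x * if c = k then 1 else 0 := by
        rw [mul_ite, mul_one, mul_zero]
      rw [h7]
      push_cast
      linear_combination -φ (C i r) * h3
    · rw [if_neg hs, if_neg hs, map_zero, zero_mul, zero_add]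
      symm
      rw [ite_eq_right_iff]
      rintro rfl
      exact if_neg fun h => hs (by rw [h.1]; exact h.2)
  rw [h1, Finset.sum_congr rfl h2, Finset.sum_add_distrib, Finset.sum_ite_eq', ite_mul, one_mul,
    zero_mul, bandUnit]
  -- For `j = 0` the term `Λ` is cancelled by the contribution of the unit diagonal of `U` to
  -- `U E`.
  by_cases hj0 : j = 0
  · subst hj0
    rw [if_pos rfl] at hx
    subst hx
    rw [if_neg (show 0 ∉ Finset.Icc 1 m by simp), add_zero, Nat.cast_zero, add_zero, neg_zero,
      sameSite_natCast_iff]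
    by_cases hr : r = c
    · subst hr
      rw [if_pos rfl]
      by_cases hk : r = k
      · rw [if_pos hk, if_pos ⟨hk, hk.symm⟩]; abel
      · rw [if_neg hk, if_neg (show ¬(r = k ∧ k = r) from fun h => hk h.1)]; abel
    · rw [if_neg hr, if_neg (show ¬(r = k ∧ k = c) from fun h => hr (h.1.trans h.2))]; abel
  · rw [if_neg hj0] at hx
    subst hx
    rw [if_pos (Finset.mem_Icc.2 ⟨by omega, hj⟩)]
    simp [lamMono]

/-- The normalization of the spectral parameter by `∏ (1 + α d_k)` makes it a constant of the
twisted derivations. -/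
theorem siteDeriv_genScalar (k : Fin N) (x : ℝ) {q : ℤ} {u : A} (hu : d u = -(q * x * φ u)) :
    siteDeriv e φ d k x (genScalar N e q u) = 0 := by
  have hN : (N : ℝ) ≠ 0 := by
    have := k.isLt
    exact_mod_cast (by omega : N ≠ 0)
  refine Matrix.ext fun r c => ?_
  rw [twistedDeriv_apply, genScalar, Matrix.diagonal_apply]
  split_ifs with hrc
  · rw [termwise_single, shiftDeriv_apply, e.sign_mul_sign_mul, hu, hrc, sub_self, zero_sub,
      Matrix.zero_apply, HahnSeries.single_eq_zero_iff]
    push_cast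
    field_simp
    ring
  · exact map_zero _

end Derivative

/-- The residue of the trace against `x λ^{-j} E_{k,k+j}` extracts an entry on or below the
diagonal. -/
theorem traceRes_bandUnit_mul (k : Fin N) (j : ℕ) (x : ℝ) (X : LaxMatrix N)
    (hs : IsSite bc N ((k : ℕ) + j)) :
    traceRes ℝ N (bandUnit bc e k j x * X) = x * band bc e X ((k : ℕ) + j) (k : ℕ) := by
  obtain ⟨c, hc⟩ := hs
  rw [band_eq X hc (sameSite_refl _), traceRes_eq_sum, Finset.sum_eq_single k]
  · rw [Matrix.mul_apply, Finset.sum_eq_single c]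
    · rw [bandUnit, if_pos ⟨rfl, hc⟩, ← mul_zero e.sign]
      change lamCoeff e _ 0 = _
      rw [lamCoeff_lamMono_mul]
      congr 2
      ring
    · intro s _ hs
      rw [bandUnit, if_neg fun h => hs (sameSite_natCast_iff.1 (h.2.symm.trans hc)), zero_mul]
    · exact fun h => absurd (Finset.mem_univ _) h
  · intro r _ hr
    rw [Matrix.mul_apply, HahnSeries.coeff_sum]
    refine Finset.sum_eq_zero fun s _ => ?_
    rw [bandUnit, if_neg fun h => hr h.1, zero_mul, HahnSeries.coeff_zero]
  · exact fun h => absurd (Finset.mem_univ _) h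

end GenericLaxMatrices

/-! ### Invertibility of the Lax matrices -/

section Invertibility

variable {bc : Boundary} {m N : ℕ} {e : Expansion} {A : Type*} [CommRing A]

/-- A matrix of power series is invertible if its constant term is. -/
theorem isUnit_of_constantCoeff {M : Matrix (Fin N) (Fin N) (PowerSeries A)}
    (h : IsUnit (PowerSeries.constantCoeff.mapMatrix M)) : IsUnit M := by
  rw [Matrix.isUnit_iff_isUnit_det, ← RingHom.map_det] at h
  rw [Matrix.isUnit_iff_isUnit_det]
  exact PowerSeries.isUnit_iff_constantCoeff.2 h

/-- At zero, `L` is a matrix of power series whose value at zero is the diagonal matrix `D`. -/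
theorem isUnit_genL (a : A) {D : Fin N → A} (hD : ∀ r, IsUnit (D r)) :
    IsUnit (genL bc .atZero a D) := by
  obtain ⟨M, hM⟩ : ∃ M : Matrix (Fin N) (Fin N) (PowerSeries A), ∀ r c, M r c =
      (if r = c then PowerSeries.C (D r) else 0) +
        (if SameSite bc N ((c : ℕ) + 1) (r : ℕ) then PowerSeries.C a * PowerSeries.X else 0) :=
    ⟨fun _ _ => _, fun _ _ => rfl⟩
  have h1 : (HahnSeries.ofPowerSeries ℤ A).mapMatrix M = genL bc .atZero a D := by
    refine Matrix.ext fun r c => ?_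
    simp only [RingHom.mapMatrix_apply, Matrix.map_apply, hM, genL, map_add,
      apply_ite (HahnSeries.ofPowerSeries ℤ A), map_mul, HahnSeries.ofPowerSeries_C,
      HahnSeries.ofPowerSeries_X, map_zero, HahnSeries.C_apply, HahnSeries.single_mul_single,
      mul_one, Expansion.sign, mul_zero, zero_add]
  have h2 : PowerSeries.constantCoeff.mapMatrix M = Matrix.diagonal D := by
    refine Matrix.ext fun r c => ?_
    simp only [RingHom.mapMatrix_apply, Matrix.map_apply, hM, map_add,
      apply_ite PowerSeries.constantCoeff, map_mul, PowerSeries.constantCoeff_C,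
      PowerSeries.constantCoeff_X, map_zero, mul_zero, ite_self, add_zero, Matrix.diagonal_apply]
  rw [← h1]
  refine (isUnit_of_constantCoeff ?_).map _
  rw [h2, Matrix.isUnit_iff_isUnit_det, Matrix.det_diagonal]
  exact Finset.prod_induction _ IsUnit (fun _ _ => IsUnit.mul) isUnit_one fun r _ => hD r

/-- The matrix `U` as a matrix of power series in `λ⁻¹`. -/
def genUPow (bc : Boundary) (m : ℕ) (C : ℕ → Fin N → A) :
    Matrix (Fin N) (Fin N) (PowerSeries A) :=
  fun r c => (if r = c then 1 else 0) - ∑ j ∈ Finset.Icc 1 m,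
    if SameSite bc N ((r : ℕ) + j) (c : ℕ) then PowerSeries.C (C j r) * PowerSeries.X ^ j else 0

theorem mapMatrix_genUPow (C : ℕ → Fin N → A) :
    (HahnSeries.ofPowerSeries ℤ A).mapMatrix (genUPow bc m C) = genU bc m .atInfinity C := by
  refine Matrix.ext fun r c => ?_
  simp only [RingHom.mapMatrix_apply, Matrix.map_apply, genUPow, genU, map_sub, map_sum,
    apply_ite (HahnSeries.ofPowerSeries ℤ A), map_mul, HahnSeries.ofPowerSeries_C, map_one,
    HahnSeries.ofPowerSeries_X_pow, map_zero, HahnSeries.C_apply, HahnSeries.single_mul_single,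
    mul_one, Expansion.sign, neg_mul_neg, one_mul, zero_add]

theorem constantCoeff_genUPow (C : ℕ → Fin N → A) :
    PowerSeries.constantCoeff.mapMatrix (genUPow bc m C) = 1 := by
  refine Matrix.ext fun r c => ?_
  rw [RingHom.mapMatrix_apply, Matrix.map_apply, genUPow, map_sub, map_sum, Finset.sum_eq_zero,
    sub_zero, apply_ite PowerSeries.constantCoeff, map_one, map_zero, Matrix.one_apply]
  intro j hj
  rw [Finset.mem_Icc] at hj
  rw [apply_ite PowerSeries.constantCoeff, map_mul, map_pow, PowerSeries.constantCoeff_X,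
    zero_pow (by omega), mul_zero, map_zero, ite_self]

/-- At infinity, `U` is a matrix of power series whose value at infinity is the unit matrix. -/
theorem isUnit_genU_atInfinity (C : ℕ → Fin N → A) : IsUnit (genU bc m .atInfinity C) := by
  rw [← mapMatrix_genUPow]
  refine (isUnit_of_constantCoeff ?_).map _
  rw [constantCoeff_genUPow]
  exact isUnit_one

/-- On and below the diagonal, the inverse of `U` at infinity coincides with the unit matrix. -/
theorem band_of_genU_mul_eq_one {C : ℕ → Fin N → ℝ} {X : LaxMatrix N}
    (h : genU bc m .atInfinity C * X = 1) (k : Fin N) (j : ℕ) (hs : IsSite bc N ((k : ℕ) + j)) :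
    band bc .atInfinity X ((k : ℕ) + j) (k : ℕ) = if j = 0 then 1 else 0 := by
  have h0 : IsUnit (genUPow bc m C) := by
    refine isUnit_of_constantCoeff ?_
    rw [constantCoeff_genUPow]
    exact isUnit_one
  obtain ⟨W, hW⟩ := h0.exists_right_inv
  have h1 : X = (HahnSeries.ofPowerSeries ℤ ℝ).mapMatrix W := by
    have h2 := congrArg (HahnSeries.ofPowerSeries ℤ ℝ).mapMatrix hW
    rw [map_mul, mapMatrix_genUPow, map_one] at h2
    have h3 := mul_eq_one_comm.1 h
    calc X = X * (genU bc m .atInfinity C * (HahnSeries.ofPowerSeries ℤ ℝ).mapMatrix W) := by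
          rw [h2, mul_one]
      _ = _ := by rw [← mul_assoc, h3, one_mul]
  have h4 : PowerSeries.constantCoeff.mapMatrix W = 1 := by
    have h5 := congrArg PowerSeries.constantCoeff.mapMatrix hW
    rwa [map_mul, constantCoeff_genUPow, one_mul, map_one] at h5
  obtain ⟨r, hr⟩ := hs
  rw [band_eq X hr (sameSite_refl _), h1, RingHom.mapMatrix_apply, Matrix.map_apply, lamCoeff]
  split_ifs with hj
  · subst hj
    rw [Nat.cast_zero, add_zero, sameSite_natCast_iff] at hr
    subst hr
    have h6 : (W k k).constantCoeff = 1 := by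
      have h7 := congrFun (congrFun h4 k) k
      rwa [Matrix.one_apply_eq] at h7
    have h8 := HahnSeries.ofPowerSeries_apply_coeff (Γ := ℤ) (W k k) 0
    rw [PowerSeries.coeff_zero_eq_constantCoeff_apply, h6] at h8
    simpa using h8
  · rw [HahnSeries.ofPowerSeries_apply]
    refine HahnSeries.embDomain_of_notMem_range ?_
    rintro ⟨n, hn⟩
    change (n : ℤ) = Expansion.sign .atInfinity * _ at hn
    simp only [Expansion.sign] at hn
    omega

/-- At zero, the determinant of `U` is a polynomial in `λ⁻¹` with the constant term `1`. -/
theorem isUnit_genU_atZero (C : ℕ → Fin N → ℝ) : IsUnit (genU bc m .atZero C) := by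
  let f : Polynomial ℝ →+* LaurentSeries ℝ :=
    Polynomial.eval₂RingHom HahnSeries.C (HahnSeries.single (-1) 1)
  obtain ⟨M, hM⟩ : ∃ M : Matrix (Fin N) (Fin N) (Polynomial ℝ), ∀ r c, M r c =
      (if r = c then 1 else 0) - ∑ j ∈ Finset.Icc 1 m,
        if SameSite bc N ((r : ℕ) + j) (c : ℕ) then
          Polynomial.C (C j r) * Polynomial.X ^ j else 0 :=
    ⟨fun _ _ => _, fun _ _ => rfl⟩
  have hC : ∀ x, f (Polynomial.C x) = HahnSeries.C x := fun x => Polynomial.eval₂_C _ _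
  have hX : ∀ j : ℕ, f Polynomial.X ^ j = HahnSeries.single (-(j : ℤ)) 1 := fun j => by
    rw [show f Polynomial.X = HahnSeries.single (-1) 1 from Polynomial.eval₂_X _ _,
      HahnSeries.single_pow, one_pow]
    simp
  have h1 : f.mapMatrix M = genU bc m .atZero C := by
    refine Matrix.ext fun r c => ?_
    simp only [RingHom.mapMatrix_apply, Matrix.map_apply, hM, genU, map_sub, map_sum,
      apply_ite f, map_mul, hC, map_one, map_pow, hX, map_zero, HahnSeries.C_apply,
      HahnSeries.single_mul_single, mul_one, Expansion.sign, one_mul, zero_add]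
  have h2 : (Polynomial.evalRingHom (0 : ℝ)).mapMatrix M = 1 := by
    refine Matrix.ext fun r c => ?_
    rw [RingHom.mapMatrix_apply, Matrix.map_apply, hM, map_sub, map_sum, Finset.sum_eq_zero,
      sub_zero, apply_ite (Polynomial.evalRingHom (0 : ℝ)), map_one, map_zero, Matrix.one_apply]
    intro j hj
    rw [Finset.mem_Icc] at hj
    rw [apply_ite (Polynomial.evalRingHom (0 : ℝ)), map_mul, map_pow, Polynomial.coe_evalRingHom,
      Polynomial.eval_X, zero_pow (by omega), mul_zero, Polynomial.eval_zero, ite_self]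
  have h3 : M.det.coeff 0 = 1 := by
    have h4 := (Polynomial.evalRingHom (0 : ℝ)).map_det M
    rw [h2, Matrix.det_one] at h4
    rwa [Polynomial.coeff_zero_eq_eval_zero]
  -- The substitution of `λ⁻¹` into a polynomial preserves the constant term.
  have h5 : ∀ p : Polynomial ℝ, (f p).coeff 0 = p.coeff 0 := fun p => by
    induction p using Polynomial.induction_on' with
    | add p q hp hq => rw [map_add, HahnSeries.coeff_add, hp, hq, Polynomial.coeff_add]
    | monomial n a =>
      rw [← Polynomial.C_mul_X_pow_eq_monomial, map_mul, map_pow, hX, hC, HahnSeries.C_apply,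
        HahnSeries.single_mul_single, HahnSeries.coeff_single, Polynomial.coeff_C_mul_X_pow]
      simp [eq_comm]
  rw [Matrix.isUnit_iff_isUnit_det, ← h1, ← RingHom.map_det, isUnit_iff_ne_zero]
  intro h0
  have h6 := h5 M.det
  rw [h0, h3] at h6
  simp at h6

end Invertibility

/-! ### Lax matrices of smooth functions -/

section SmoothLaxMatrices

variable {bc : Boundary} {m N : ℕ} {α : ℝ} {e : Expansion}

/-- The columns of the moving frame, in terms of the fields. -/
theorem fld_frame (y : Phase bc m N) (r : Label bc m N) (j : ℕ) (x : ℤ) :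
    fld (fun p => frame α y p r) j x =
      (if r.fieldNo = j ∧ SameSite bc N x r.site then 1 else 0) +
        α * fld y j x * ∑ i ∈ Finset.range (j + 1),
          if r.fieldNo = 0 ∧ SameSite bc N (x + i) r.site then 1 else 0 := by
  by_cases h : HasLabel bc m N j x
  · obtain ⟨p, rfl, hp⟩ := h
    rw [fld_eq _ p rfl hp, fld_eq y p rfl hp, frame]
    congr 1
    · refine if_congr ⟨?_, fun h => Label.ext_of_sameSite h.1.symm (hp.symm.trans h.2)⟩ rfl rfl
      rintro rfl
      exact ⟨rfl, hp⟩
    · congr 1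
      exact Finset.sum_congr rfl fun i _ =>
        if_congr (and_congr_right fun _ => sameSite_left_congr (hp.symm.add_right i)) rfl rfl
  · rw [fld_of_not _ h, fld_of_not y h, if_neg]
    · simp
    · rintro ⟨rfl, h2⟩
      exact h ⟨r, rfl, h2⟩

/-- The logarithmic derivative of `1 + α d_k` along the column `r` of the moving frame, where `k` is
the site of `r`. -/
def siteWeight (α : ℝ) (r : Label bc m N) : ℝ := if r.fieldNo = 0 then α else 0

theorem fld_frame_zero (y : Phase bc m N) (r : Label bc m N) (c : Fin N) :
    α * fld (fun p => frame α y p r) 0 (c : ℕ) =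
      if c = r.1.2 then siteWeight α r * (1 + α * fld y 0 (c : ℕ)) else 0 := by
  have h : SameSite bc N ((c : ℕ) : ℤ) r.site ↔ c = r.1.2 := sameSite_natCast_iff
  rw [fld_frame, siteWeight, zero_add, Finset.sum_range_one, Nat.cast_zero, add_zero, h]
  by_cases h1 : r.fieldNo = 0 <;> by_cases h2 : c = r.1.2 <;> simp [h1, h2]

theorem hasFDerivAt_one_add_fld (y : Phase bc m N) (k : ℤ) :
    HasFDerivAt (fun y : Phase bc m N => 1 + α * fld y 0 k) (α • fldL bc m N 0 k) y :=
  ((hasFDerivAt_fld 0 k y).const_mul α).const_add 1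

/-- The logarithm of the product of all `|1 + α d_k|`; the values of `Real.log` at negative numbers
are the logarithms of the absolute values. -/
def logSiteProd (α : ℝ) (y : Phase bc m N) : ℝ := ∑ k : Fin N, Real.log (1 + α * fld y 0 (k : ℕ))

theorem contDiffOn_logSiteProd : ContDiffOn ℝ ∞ (logSiteProd α) (domPlus bc m N α) :=
  ContDiffOn.sum fun _ _ => ContDiffOn.log (by fun_prop) fun _ hy => hy _

/-- Along the moving frame, the logarithm of the product of all `|1 + α d_k|` has constant
derivatives. -/
theorem fderiv_logSiteProd {y : Phase bc m N} (hy : y ∈ domPlus bc m N α) (r : Label bc m N) :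
    fderiv ℝ (logSiteProd α) y (fun p => frame α y p r) = siteWeight α r := by
  have h : HasFDerivAt (logSiteProd α) (∑ k : Fin N,
      (1 + α * fld y 0 (k : ℕ))⁻¹ • α • fldL bc m N 0 (k : ℕ)) y :=
    HasFDerivAt.fun_sum fun k _ => (hasFDerivAt_one_add_fld y k).log (hy k)
  rw [h.fderiv, _root_.sum_apply, Finset.sum_eq_single r.1.2]
  · rw [_root_.smul_apply, _root_.smul_apply, smul_eq_mul, smul_eq_mul, fldL_apply,
      fld_frame_zero, if_pos rfl, mul_comm, mul_assoc, mul_inv_cancel₀ (hy _), mul_one]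
  · intro k _ hk
    rw [_root_.smul_apply, _root_.smul_apply, smul_eq_mul, smul_eq_mul, fldL_apply,
      fld_frame_zero, if_neg hk, mul_zero]
  · exact fun h => absurd (Finset.mem_univ _) h

/-- The smooth functions on the domain `1 + α d_k ≠ 0`. -/
abbrev SmoothFun (bc : Boundary) (m N : ℕ) (α : ℝ) : Type := smoothRing (domPlus bc m N α)

/-- The function `1 + α d_k`, which is invertible. -/
def siteFun (bc : Boundary) (m N : ℕ) (α : ℝ) (k : Fin N) : (SmoothFun bc m N α)ˣ :=
  (smoothRing.isUnit_of (f := fun y : Phase bc m N => 1 + α * fld y 0 (k : ℕ))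
    (s := domPlus bc m N α) (by fun_prop) fun _ hy => hy k).unit

theorem siteFun_val (k : Fin N) : (siteFun bc m N α k : SmoothFun bc m N α) =
    smoothRing.of (fun y : Phase bc m N => 1 + α * fld y 0 (k : ℕ)) (by fun_prop) :=
  IsUnit.unit_spec _

/-- The matrix `L` as a function on the phase space. -/
def smoothL (bc : Boundary) (m N : ℕ) (e : Expansion) (α : ℝ) :
    Matrix (Fin N) (Fin N) (LaurentSeries (SmoothFun bc m N α)) :=
  genL bc e (smoothRing.of (fun _ => α) contDiffOn_const) fun k => siteFun bc m N α k

/-- The matrix `U` as a function on the phase space. -/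
def smoothU (bc : Boundary) (m N : ℕ) (e : Expansion) (α : ℝ) :
    Matrix (Fin N) (Fin N) (LaurentSeries (SmoothFun bc m N α)) :=
  genU bc m e fun j k => smoothRing.of (fun y => α * fld y j (k : ℕ)) (by fun_prop)

/-- The scalar matrix `(λᴺ / ∏ (1 + α d_k))^q` as a function on the phase space. -/
def smoothScalar (bc : Boundary) (m N : ℕ) (e : Expansion) (α : ℝ) (q : ℤ) :
    Matrix (Fin N) (Fin N) (LaurentSeries (SmoothFun bc m N α)) :=
  genScalar N e q ((∏ k, siteFun bc m N α k) ^ (-q) : (SmoothFun bc m N α)ˣ)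

/-- The evaluation at a point of matrices of smooth functions. -/
def evalMatrix (y : domPlus bc m N α) :
    Matrix (Fin N) (Fin N) (LaurentSeries (SmoothFun bc m N α)) →+* LaxMatrix N :=
  (mapLaurent (smoothRing.eval y)).mapMatrix

theorem evalMatrix_smoothL (y : domPlus bc m N α) :
    evalMatrix y (smoothL bc m N e α) = laxL e α (y : Phase bc m N) := by
  rw [evalMatrix, smoothL, mapMatrix_genL, laxL_eq_genL]
  simp only [siteFun_val, smoothRing.eval_of]

theorem evalMatrix_smoothU (y : domPlus bc m N α) :
    evalMatrix y (smoothU bc m N e α) = laxU e α (y : Phase bc m N) := by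
  rw [evalMatrix, smoothU, mapMatrix_genU, laxU_eq_genU]
  simp only [smoothRing.eval_of]

theorem evalMatrix_smoothScalar (y : domPlus bc m N α) (q : ℤ) :
    evalMatrix y (smoothScalar bc m N e α q) =
      genScalar N e q ((∏ k : Fin N, (1 + α * fld (y : Phase bc m N) 0 (k : ℕ))) ^ (-q)) := by
  have h : smoothRing.eval y ((∏ k, siteFun bc m N α k) ^ (-q) : (SmoothFun bc m N α)ˣ) =
      (∏ k : Fin N, (1 + α * fld (y : Phase bc m N) 0 (k : ℕ))) ^ (-q) := by
    have h1 := congrArg Units.val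
      (map_zpow (Units.map (smoothRing.eval y : SmoothFun bc m N α →* ℝ))
        (∏ k, siteFun bc m N α k) (-q))
    rw [Units.val_zpow_eq_zpow_val, Units.coe_map, Units.coe_map] at h1
    refine h1.trans (congrArg (fun x : ℝ => x ^ (-q)) ?_)
    change smoothRing.eval y (∏ k, siteFun bc m N α k : (SmoothFun bc m N α)ˣ) = _
    rw [Units.coe_prod, map_prod]
    exact Finset.prod_congr rfl fun k _ => by rw [siteFun_val, smoothRing.eval_of]
  rw [evalMatrix, smoothScalar, mapMatrix_genScalar, h]

/-- The derivation for the derivatives along the column `r` of the moving frame. -/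
def labelDeriv (e : Expansion) (y : domPlus bc m N α) (r : Label bc m N) :
    Matrix (Fin N) (Fin N) (LaurentSeries (SmoothFun bc m N α)) →+ LaxMatrix N :=
  siteDeriv e (smoothRing.eval y)
    (smoothRing.deriv isOpen_domPlus y fun p => frame α (y : Phase bc m N) p r) r.1.2
    (siteWeight α r)

theorem isDerivationOver_labelDeriv (y : domPlus bc m N α) (r : Label bc m N) :
    IsDerivationOver (evalMatrix y) (labelDeriv e y r) :=
  isDerivationOver_twistedDeriv (smoothRing.isDerivationOver_deriv _ _ _) _ _

theorem traceRes_labelDeriv (y : domPlus bc m N α) (r : Label bc m N)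
    (X : Matrix (Fin N) (Fin N) (LaurentSeries (SmoothFun bc m N α))) :
    traceRes ℝ N (labelDeriv e y r X) =
      fderiv ℝ (extendZero (traceRes (SmoothFun bc m N α) N X).1) (y : Phase bc m N)
        (fun p => frame α (y : Phase bc m N) p r) :=
  traceRes_twistedDeriv _ _ _ _ X

theorem deriv_siteFun (y : domPlus bc m N α) (r : Label bc m N) (c : Fin N) :
    smoothRing.deriv isOpen_domPlus y (fun p => frame α (y : Phase bc m N) p r)
      (siteFun bc m N α c) =
      if c = r.1.2 then siteWeight α r * smoothRing.eval y (siteFun bc m N α c) else 0 := by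
  rw [siteFun_val, smoothRing.deriv_of, smoothRing.eval_of,
    (hasFDerivAt_one_add_fld (y : Phase bc m N) (c : ℕ)).fderiv, _root_.smul_apply, smul_eq_mul,
    fldL_apply, fld_frame_zero]

/-- Along the moving frame, `L` changes by a factor from the right. -/
theorem labelDeriv_smoothL (y : domPlus bc m N α) (r : Label bc m N) :
    labelDeriv e y r (smoothL bc m N e α) =
      evalMatrix y (smoothL bc m N e α) * siteUnit e r.1.2 (siteWeight α r) := by
  refine siteDeriv_genL _ _ ?_ fun c => deriv_siteFun y r c
  rw [smoothRing.deriv_of]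
  simp

/-- Along the moving frame, `U` changes by the same factor from the right and by one additional
entry, through which the derivatives of spectral invariants become entries of matrices. -/
theorem labelDeriv_smoothU (y : domPlus bc m N α) (r : Label bc m N) :
    labelDeriv e y r (smoothU bc m N e α) =
      evalMatrix y (smoothU bc m N e α) * siteUnit e r.1.2 (siteWeight α r) -
        bandUnit bc e r.1.2 r.fieldNo α := by
  refine siteDeriv_genU (smoothRing.isDerivationOver_deriv _ _ _) _ r.fieldNo_le rfl
    fun j _ c => ?_
  have h : SameSite bc N ((c : ℕ) : ℤ) r.site ↔ c = r.1.2 := sameSite_natCast_iff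
  rw [smoothRing.deriv_of, smoothRing.eval_of,
    ((hasFDerivAt_fld j (c : ℕ) (y : Phase bc m N)).const_mul α).fderiv, _root_.smul_apply,
    smul_eq_mul, fldL_apply, fld_frame, h, mul_add]
  congr 1
  · rw [mul_ite, mul_one, mul_zero]
    by_cases hj : r.fieldNo = j ∧ c = r.1.2
    · rw [if_pos hj, if_pos ⟨hj.1.symm, hj.2⟩]
    · rw [if_neg hj, if_neg fun h => hj ⟨h.1.symm, h.2⟩]
  · by_cases h0 : r.fieldNo = 0
    · simp only [h0, true_and, if_true]
      rw [Label.site]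
      ring
    · simp [h0]

theorem labelDeriv_smoothScalar (y : domPlus bc m N α) (r : Label bc m N) (q : ℤ) :
    labelDeriv e y r (smoothScalar bc m N e α q) = 0 := by
  refine siteDeriv_genScalar _ _ ?_
  rw [(smoothRing.isDerivationOver_deriv _ _ _).map_prod_zpow (siteFun bc m N α)
    (x := fun c => if c = r.1.2 then siteWeight α r else 0)
    (fun c => by rw [deriv_siteFun, ite_mul, zero_mul]), Finset.sum_ite_eq',
    if_pos (Finset.mem_univ _)]
  push_cast
  ring

theorem traceRes_bandUnit_mul_label (r : Label bc m N) (x : ℝ) (X : LaxMatrix N) :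
    traceRes ℝ N (bandUnit bc e r.1.2 r.fieldNo x * X) =
      x * band bc e X (r.site + r.fieldNo) r.site :=
  traceRes_bandUnit_mul _ _ _ _ r.isSite_site_add

end SmoothLaxMatrices

/-! ### Hamiltonian functions -/

/-! The matrices `X = M L⁻¹ (U L⁻¹)ⁿ` and `X = M U⁻¹ (L U⁻¹)ⁿ` with a central `M` satisfy
`L X U = U X L`. -/

section CovariantMatrices

variable {S : Type*} [Ring S] {M L U L' U' : S}

/-- Powers of the two products of `x` and `y` are intertwined by `x`. -/
theorem mul_pow_mul_comm (x y : S) (n : ℕ) : (x * y) ^ n * x = x * (y * x) ^ n :=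
  ((show SemiconjBy x (y * x) (x * y) from (mul_assoc x y x).symm).pow_right n).symm

theorem mul_covariant_zero (hM : ∀ x, M * x = x * M) (h1 : L * L' = 1) (n : ℕ) :
    L * (M * (L' * (U * L') ^ n)) = M * (U * L') ^ n := by
  rw [← mul_assoc, ← hM, mul_assoc, ← mul_assoc L, h1, one_mul]

theorem covariant_zero_mul (h2 : L' * L = 1) (n : ℕ) :
    M * (L' * (U * L') ^ n) * L = M * (L' * U) ^ n := by
  rw [← mul_pow_mul_comm, mul_assoc, mul_assoc, h2, mul_one]

theorem covariant_zero_triad (hM : ∀ x, M * x = x * M) (h1 : L * L' = 1) (h2 : L' * L = 1)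
    (n : ℕ) : L * (M * (L' * (U * L') ^ n)) * U = U * (M * (L' * (U * L') ^ n)) * L := by
  rw [mul_covariant_zero hM h1, mul_assoc U, covariant_zero_mul h2, mul_assoc, mul_pow_mul_comm,
    ← mul_assoc, hM, mul_assoc]

theorem mul_covariant_infinity (hM : ∀ x, M * x = x * M) (n : ℕ) :
    L * (M * (U' * (L * U') ^ n)) = M * (L * U') ^ (n + 1) := by
  rw [← mul_assoc, ← hM, mul_assoc, ← mul_assoc L, ← pow_succ']

theorem covariant_infinity_mul (n : ℕ) :
    M * (U' * (L * U') ^ n) * L = M * (U' * L) ^ (n + 1) := by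
  rw [← mul_pow_mul_comm, mul_assoc, mul_assoc, ← pow_succ]

theorem covariant_infinity_triad (hM : ∀ x, M * x = x * M) (h1 : U * U' = 1) (h2 : U' * U = 1)
    (n : ℕ) : L * (M * (U' * (L * U') ^ n)) * U = U * (M * (U' * (L * U') ^ n)) * L := by
  have h3 : U * (M * (U' * (L * U') ^ n)) = M * (L * U') ^ n := by
    rw [← mul_assoc, ← hM, mul_assoc, ← mul_assoc U, h1, one_mul]
  rw [h3, mul_covariant_infinity hM, pow_succ, mul_assoc, mul_assoc, mul_assoc L, h2, mul_one,
    mul_assoc]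

end CovariantMatrices

section Hamiltonians

variable {bc : Boundary} {m N : ℕ} {α : ℝ} {e : Expansion}

theorem isUnit_smoothL : IsUnit (smoothL bc m N .atZero α) :=
  isUnit_genL _ fun k => (siteFun bc m N α k).isUnit

theorem isUnit_smoothU : IsUnit (smoothU bc m N .atInfinity α) :=
  isUnit_genU_atInfinity _

/-- The flows at zero belong to the matrices `X = μ^q L⁻¹ (U L⁻¹)ⁿ`, with
`μ = λᴺ / ∏ (1 + α d_k)`. -/
theorem satisfiesLaxTriads_atZero (hα : α ≠ 0) (n : ℕ) {q : ℤ}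
    (hq : bc = Boundary.openEnd → q = 0) (y : domPlus bc m N α)
    {L' : Matrix (Fin N) (Fin N) (LaurentSeries (SmoothFun bc m N α))}
    (h1 : smoothL bc m N .atZero α * L' = 1) {H : Phase bc m N → ℝ}
    (hH : ∀ r : Label bc m N,
      fderiv ℝ H (y : Phase bc m N) (fun p => frame α (y : Phase bc m N) p r) =
        band bc .atZero (evalMatrix y (smoothScalar bc m N .atZero α q) * (evalMatrix y L' *
          (evalMatrix y (smoothU bc m N .atZero α) * evalMatrix y L') ^ n))
          (r.site + r.fieldNo) r.site) :
    SatisfiesLaxTriads .atZero α n q (y : Phase bc m N)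
      (hamField (cubicBracket bc m N α) H y) := by
  have hM : ∀ x, evalMatrix y (smoothScalar bc m N .atZero α q) * x =
      x * evalMatrix y (smoothScalar bc m N .atZero α q) := fun x => by
    rw [evalMatrix_smoothScalar, genScalar_mul_comm]
  have h2 : laxL .atZero α (y : Phase bc m N) * evalMatrix y L' = 1 := by
    rw [← evalMatrix_smoothL, ← map_mul, h1, map_one]
  have h3 := mul_eq_one_comm.1 h2
  have hU : (laxU .atZero α (y : Phase bc m N))⁻¹⁻¹ = laxU .atZero α (y : Phase bc m N) := by
    refine Matrix.nonsing_inv_nonsing_inv _ ((Matrix.isUnit_iff_isUnit_det _).1 ?_)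
    exact isUnit_genU_atZero _
  rw [evalMatrix_smoothU] at hH
  have hg : IsGraded bc .atZero (evalMatrix y (smoothScalar bc m N .atZero α q) * (evalMatrix y L' *
          (laxU .atZero α (y : Phase bc m N) * evalMatrix y L') ^ n)) := by
    have hL' := (isGraded_laxL (e := .atZero) (y : Phase bc m N)).of_mul_eq_one h2
    rw [evalMatrix_smoothScalar, genScalar_mul]
    exact isGraded_lamMono_smul (hL'.mul (((isGraded_laxU _).mul hL').pow n)) hq _
  refine satisfiesLaxTriads_of_fderiv hα hg (covariant_zero_triad hM h2 h3 n) ?_ ?_ hH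
  · rw [mul_covariant_zero hM h2, covFun, laxT₁, Matrix.mul_inv_rev, hU,
      Matrix.inv_eq_right_inv h2, evalMatrix_smoothScalar, genScalar_mul]
  · rw [covariant_zero_mul h3, covFun, laxT₂, Matrix.mul_inv_rev, hU,
      Matrix.inv_eq_right_inv h2, evalMatrix_smoothScalar, genScalar_mul]

/-- The flows at infinity with a positive exponent belong to the matrices `X = μ^q U⁻¹ (L U⁻¹)ⁿ`,
with `μ = λᴺ / ∏ (1 + α d_k)`. -/
theorem satisfiesLaxTriads_atInfinity (hα : α ≠ 0) (n : ℕ) {q : ℤ}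
    (hq : bc = Boundary.openEnd → q = 0) (y : domPlus bc m N α)
    {U' : Matrix (Fin N) (Fin N) (LaurentSeries (SmoothFun bc m N α))}
    (h1 : smoothU bc m N .atInfinity α * U' = 1) {H : Phase bc m N → ℝ}
    (hH : ∀ r : Label bc m N,
      fderiv ℝ H (y : Phase bc m N) (fun p => frame α (y : Phase bc m N) p r) =
        band bc .atInfinity (evalMatrix y (smoothScalar bc m N .atInfinity α q) *
          (evalMatrix y U' *
            (evalMatrix y (smoothL bc m N .atInfinity α) * evalMatrix y U') ^ n))
          (r.site + r.fieldNo) r.site) :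
    SatisfiesLaxTriads .atInfinity α (n + 1) q (y : Phase bc m N)
      (hamField (cubicBracket bc m N α) H y) := by
  have hM : ∀ x, evalMatrix y (smoothScalar bc m N .atInfinity α q) * x =
      x * evalMatrix y (smoothScalar bc m N .atInfinity α q) := fun x => by
    rw [evalMatrix_smoothScalar, genScalar_mul_comm]
  have h2 : laxU .atInfinity α (y : Phase bc m N) * evalMatrix y U' = 1 := by
    rw [← evalMatrix_smoothU, ← map_mul, h1, map_one]
  have h3 := mul_eq_one_comm.1 h2
  rw [evalMatrix_smoothL] at hH
  have hg : IsGraded bc .atInfinity (evalMatrix y (smoothScalar bc m N .atInfinity α q) *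
      (evalMatrix y U' * (laxL .atInfinity α (y : Phase bc m N) * evalMatrix y U') ^ n)) := by
    have hU' := (isGraded_laxU (e := .atInfinity) (y : Phase bc m N)).of_mul_eq_one h2
    rw [evalMatrix_smoothScalar, genScalar_mul]
    exact isGraded_lamMono_smul (hU'.mul (((isGraded_laxL _).mul hU').pow n)) hq _
  refine satisfiesLaxTriads_of_fderiv hα hg (covariant_infinity_triad hM h2 h3 n) ?_ ?_ hH
  · rw [mul_covariant_infinity hM, covFun, laxT₁, Matrix.inv_eq_right_inv h2,
      evalMatrix_smoothScalar, genScalar_mul]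
  · rw [covariant_infinity_mul, covFun, laxT₂, Matrix.inv_eq_right_inv h2,
      evalMatrix_smoothScalar, genScalar_mul]

theorem contDiffOn_const_mul_extendZero (c : ℝ) (f : SmoothFun bc m N α) :
    ContDiffOn ℝ ∞ (fun y => c * extendZero f.1 y) (domPlus bc m N α) :=
  contDiffOn_const.mul f.2

theorem fderiv_const_mul_extendZero (c : ℝ) (f : SmoothFun bc m N α) (y : domPlus bc m N α)
    (w : Phase bc m N) :
    fderiv ℝ (fun y => c * extendZero f.1 y) (y : Phase bc m N) w =
      c * fderiv ℝ (extendZero f.1) (y : Phase bc m N) w := by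
  rw [fderiv_const_mul (smoothRing.differentiableAt isOpen_domPlus f y), _root_.smul_apply,
    smul_eq_mul]

/-- The Hamiltonian functions of the flows at zero are the residues of the traces of
`(λᴺ / ∏ (1 + α d_k))^q (U L⁻¹)^(n + 1)`. -/
theorem exists_hamiltonian_atZero (hα : α ≠ 0) (n : ℕ) {q : ℤ}
    (hq : bc = Boundary.openEnd → q = 0) :
    ∃ H : Phase bc m N → ℝ, ContDiffOn ℝ ∞ H (domPlus bc m N α) ∧
      ∀ y ∈ domPlus bc m N α,
        SatisfiesLaxTriads .atZero α n q y (hamField (cubicBracket bc m N α) H y) := by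
  obtain ⟨L', h1⟩ := (isUnit_smoothL (bc := bc) (m := m) (N := N) (α := α)).exists_right_inv
  have h2 := mul_eq_one_comm.1 h1
  -- The factor compensates for the exponent and for the factor `α` of the additional entry in the
  -- derivative of `U`.
  refine ⟨_, contDiffOn_const_mul_extendZero (-1 / (α * (n + 1))) (traceRes _ N
    (smoothScalar bc m N .atZero α q * (smoothU bc m N .atZero α * L') ^ (n + 1))), fun y hy => ?_⟩
  refine satisfiesLaxTriads_atZero hα n hq ⟨y, hy⟩ h1 fun r => ?_
  rw [fderiv_const_mul_extendZero, ← traceRes_labelDeriv,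
    (isDerivationOver_labelDeriv ⟨y, hy⟩ r).trace_mul_inv_pow traceRes_mul_comm
      (fun x => by rw [evalMatrix_smoothScalar, genScalar_mul_comm])
      (labelDeriv_smoothScalar _ r q) h1 h2 (labelDeriv_smoothL _ r) (labelDeriv_smoothU _ r),
    traceRes_bandUnit_mul_label]
  have hn : (n : ℝ) + 1 ≠ 0 := by positivity
  field_simp

/-- The Hamiltonian functions of the flows at infinity with an exponent greater than one are the
residues of the traces of `(λᴺ / ∏ (1 + α d_k))^q (L U⁻¹)^(n + 1)`. -/
theorem exists_hamiltonian_atInfinity (hα : α ≠ 0) (n : ℕ) {q : ℤ}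
    (hq : bc = Boundary.openEnd → q = 0) :
    ∃ H : Phase bc m N → ℝ, ContDiffOn ℝ ∞ H (domPlus bc m N α) ∧
      ∀ y ∈ domPlus bc m N α,
        SatisfiesLaxTriads .atInfinity α (n + 2) q y (hamField (cubicBracket bc m N α) H y) := by
  obtain ⟨U', h1⟩ := (isUnit_smoothU (bc := bc) (m := m) (N := N) (α := α)).exists_right_inv
  have h2 := mul_eq_one_comm.1 h1
  refine ⟨_, contDiffOn_const_mul_extendZero (1 / (α * (n + 1))) (traceRes _ N
    (smoothScalar bc m N .atInfinity α q * (smoothL bc m N .atInfinity α * U') ^ (n + 1))),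
    fun y hy => ?_⟩
  refine satisfiesLaxTriads_atInfinity hα (n + 1) hq ⟨y, hy⟩ h1 fun r => ?_
  rw [fderiv_const_mul_extendZero, ← traceRes_labelDeriv,
    (isDerivationOver_labelDeriv ⟨y, hy⟩ r).trace_mul_inv_pow' traceRes_mul_comm
      (fun x => by rw [evalMatrix_smoothScalar, genScalar_mul_comm])
      (labelDeriv_smoothScalar _ r q) h1 h2 (labelDeriv_smoothL _ r) (labelDeriv_smoothU _ r),
    traceRes_bandUnit_mul_label]
  have hn : (n : ℝ) + 1 ≠ 0 := by positivity
  field_simp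

/-- The scalar matrix `u λ^(N q)` is an eigenvector of `λ d/dλ`. -/
theorem traceRes_eulerOp_genScalar_mul (q : ℤ) (u : ℝ) (X : LaxMatrix N) :
    traceRes ℝ N ((eulerOp ℝ e.sign).mapMatrix (genScalar N e q u) * X) =
      (N * q : ℤ) * traceRes ℝ N (genScalar N e q u * X) := by
  have h : (eulerOp ℝ e.sign).mapMatrix (genScalar N e q u) =
      genScalar N e q ((N * q : ℤ) * u) := by
    refine Matrix.ext fun r c => ?_
    rw [AddMonoidHom.mapMatrix_apply, Matrix.map_apply, genScalar, genScalar,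
      Matrix.diagonal_apply, Matrix.diagonal_apply]
    split_ifs
    · rw [eulerOp, termwise_single, e.sign_mul_sign_mul]
      rfl
    · exact map_zero _
  rw [h, traceRes_eq_sum, traceRes_eq_sum, Finset.mul_sum]
  refine Finset.sum_congr rfl fun r _ => ?_
  rw [genScalar, genScalar, Matrix.diagonal_mul, Matrix.diagonal_mul, HahnSeries.coeff_single_mul,
    HahnSeries.coeff_single_mul, mul_assoc]

theorem traceRes_genScalar_mul_siteUnit {q : ℤ} (hq : (N * q : ℤ) ≠ 0) (u : ℝ) (k : Fin N) (x : ℝ) :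
    traceRes ℝ N (genScalar N e q u * siteUnit e k x) = 0 := by
  rw [traceRes_eq_sum]
  refine Finset.sum_eq_zero fun r _ => ?_
  rw [genScalar, Matrix.diagonal_mul, siteUnit, Matrix.diagonal_apply_eq]
  split_ifs
  · rw [lamMono, HahnSeries.single_mul_single, HahnSeries.coeff_single_of_ne]
    intro h
    rw [mul_zero, add_zero, ← mul_zero e.sign, e.sign_mul_inj] at h
    exact hq h.symm
  · rw [mul_zero, HahnSeries.coeff_zero]

/-- For the exponent one at infinity and `q ≠ 0`, the Hamiltonian function is the logarithmic
residue of `U`, weighted with `(λᴺ / ∏ (1 + α d_k))^q`: the spectral invariant of the exponent zero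
is constant. -/
theorem exists_hamiltonian_atInfinity_one (hα : α ≠ 0) (hN : N ≠ 0) {q : ℤ} (hq0 : q ≠ 0)
    (hq : bc = Boundary.openEnd → q = 0) :
    ∃ H : Phase bc m N → ℝ, ContDiffOn ℝ ∞ H (domPlus bc m N α) ∧
      ∀ y ∈ domPlus bc m N α,
        SatisfiesLaxTriads .atInfinity α 1 q y (hamField (cubicBracket bc m N α) H y) := by
  obtain ⟨U', h1⟩ := (isUnit_smoothU (bc := bc) (m := m) (N := N) (α := α)).exists_right_inv
  have h2 := mul_eq_one_comm.1 h1
  have hNq : (N * q : ℤ) ≠ 0 := mul_ne_zero (by exact_mod_cast hN) hq0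
  -- The degree of `λ^(N q)` takes the place of the exponent.
  refine ⟨_, contDiffOn_const_mul_extendZero (1 / (α * (N * q : ℤ))) (traceRes _ N
    (smoothScalar bc m N .atInfinity α q * (U' * (eulerOp (SmoothFun bc m N α)
      (Expansion.sign .atInfinity)).mapMatrix (smoothU bc m N .atInfinity α)))), fun y hy => ?_⟩
  refine satisfiesLaxTriads_atInfinity hα 0 hq ⟨y, hy⟩ h1 fun r => ?_
  rw [fderiv_const_mul_extendZero, ← traceRes_labelDeriv (e := .atInfinity),
    (isDerivationOver_labelDeriv ⟨y, hy⟩ r).trace_log traceRes_mul_comm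
      (θ := (eulerOp (SmoothFun bc m N α) (Expansion.sign .atInfinity)).mapMatrix)
      (ϑ := (eulerOp ℝ (Expansion.sign .atInfinity)).mapMatrix) (k := ((N * q : ℤ) : ℝ))
      (isDerivationOver_eulerOp _).mapMatrix
      (fun x => mapMatrix_eulerOp _ x) (fun x => twistedDeriv_eulerOp _ _ _ _ x)
      traceRes_eulerOp (fun x => by rw [evalMatrix_smoothScalar, genScalar_mul_comm])
      (labelDeriv_smoothScalar _ r q)
      (fun x => by rw [evalMatrix_smoothScalar, traceRes_eulerOp_genScalar_mul])
      h1 h2 (labelDeriv_smoothU _ r)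
      (by rw [evalMatrix_smoothScalar, traceRes_genScalar_mul_siteUnit hNq]),
    traceRes_bandUnit_mul_label, pow_zero, mul_one]
  have h3 : ((N * q : ℤ) : ℝ) ≠ 0 := by exact_mod_cast hNq
  field_simp

/-- For the exponent one at infinity and `q = 0`, the Hamiltonian function is the logarithm of the
product of all `|1 + α d_k|`, since on and below the diagonal `U⁻¹` coincides with the unit
matrix. -/
theorem exists_hamiltonian_atInfinity_one_zero (hα : α ≠ 0) :
    ∃ H : Phase bc m N → ℝ, ContDiffOn ℝ ∞ H (domPlus bc m N α) ∧
      ∀ y ∈ domPlus bc m N α,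
        SatisfiesLaxTriads .atInfinity α 1 0 y (hamField (cubicBracket bc m N α) H y) := by
  obtain ⟨U', h1⟩ := (isUnit_smoothU (bc := bc) (m := m) (N := N) (α := α)).exists_right_inv
  refine ⟨fun y => α⁻¹ * logSiteProd α y, contDiffOn_const.mul contDiffOn_logSiteProd,
    fun y hy => ?_⟩
  refine satisfiesLaxTriads_atInfinity hα 0 (fun _ => rfl) ⟨y, hy⟩ h1 fun r => ?_
  have h2 : laxU .atInfinity α y * evalMatrix ⟨y, hy⟩ U' = 1 := by
    rw [← evalMatrix_smoothU ⟨y, hy⟩, ← map_mul, h1, map_one]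
  rw [fderiv_const_mul (contDiffOn_logSiteProd.contDiffAt (isOpen_domPlus.mem_nhds hy)
    |>.differentiableAt (by simp)), _root_.smul_apply, smul_eq_mul, fderiv_logSiteProd hy,
    pow_zero, mul_one, evalMatrix_smoothScalar, neg_zero, zpow_zero, genScalar_mul, mul_zero]
  have h3 : lamMono .atInfinity 0 1 = 1 := by
    rw [lamMono, mul_zero, HahnSeries.single_zero_one]
  rw [h3, one_smul]
  refine Eq.trans ?_ (band_of_genU_mul_eq_one h2 r.1.2 r.fieldNo r.isSite_site_add).symm
  rw [siteWeight, mul_ite, inv_mul_cancel₀ hα, mul_zero]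

/-- For the exponent zero at infinity the matrices `B₁ = B₂` are scalar, and the flow is trivial. -/
theorem satisfiesLaxTriads_zero (q : ℤ) (y : Phase bc m N) :
    SatisfiesLaxTriads .atInfinity α 0 q y 0 := by
  have h : ∀ (M : Phase bc m N → LaxMatrix N) (T₁ T₂ : LaxMatrix N),
      HasMatrixDeriv .atInfinity M y 0
      (M y * piPlus .atInfinity (covFun .atInfinity α 0 q y T₁) -
        piPlus .atInfinity (covFun .atInfinity α 0 q y T₂) * M y) := by
    intro M T₁ T₂
    have h1 : ∀ T, piPlus .atInfinity (covFun .atInfinity α 0 q y T) = Matrix.diagonal fun _ =>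
        lamNonneg .atInfinity (lamMono .atInfinity (N * q)
          ((∏ k : Fin N, (1 + α * fld y 0 (k : ℕ))) ^ (-q))) := fun T => by
      refine Matrix.ext fun r c => lamCoeff_ext (e := .atInfinity) fun p => ?_
      simp only [piPlus, covFun, pow_zero, Matrix.map_apply, lamCoeff_lamNonneg,
        Matrix.smul_one_eq_diagonal, Matrix.diagonal_apply, lamCoeff_ite, lamCoeff_zero]
      split_ifs <;> rfl
    have h2 : M y * piPlus .atInfinity (covFun .atInfinity α 0 q y T₁) -
        piPlus .atInfinity (covFun .atInfinity α 0 q y T₂) * M y = 0 := by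
      refine Matrix.ext fun r c => ?_
      rw [h1, h1, Matrix.sub_apply, Matrix.mul_diagonal, Matrix.diagonal_mul, mul_comm, sub_self]
      rfl
    intro r c p
    rw [h2]
    simp only [smul_zero, add_zero]
    exact hasDerivAt_const _ _
  exact ⟨h _ _ _, h _ _ _⟩

theorem rowSum_single (y : Phase bc m N) (x : ℝ) (n : ℕ) (a : ℤ) :
    rowSum y (fun a b => if a = b then x else 0) n a = fld y n a * x := by
  rw [rowSum, Finset.sum_eq_single 0]
  · simp
  · intro i _ hi
    rw [if_neg (by omega), mul_zero]
  · simp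

theorem colSum_single (y : Phase bc m N) (x : ℝ) (n : ℕ) (a : ℤ) :
    colSum y (fun a b => if a = b then x else 0) n a = fld y n a * x := by
  rw [colSum, Finset.sum_eq_single 0]
  · simp
  · intro i _ hi
    rw [if_neg (by omega), mul_zero]
  · simp

theorem frameField_single (hα : α ≠ 0) (y : Phase bc m N) (n : ℕ) (a : ℤ) :
    frameField α y (fun a b => if a = b then α⁻¹ else 0) n a =
      fld y n a * (fld y 0 (a + n) - fld y 0 a) + (fld y (n + 1) a - fld y (n + 1) (a - 1)) := by
  rw [frameField, rowSum_single, rowSum_single, colSum_single, colSum_single]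
  field_simp
  ring

/-- The simplest flow belongs to the logarithm of the product of all `1 + α d_k`, the derivatives of
which along the moving frame are multiples of the entries of the unit matrix. -/
theorem exists_hamiltonian_rtlPlusField (hα : α ≠ 0) :
    ∃ H : Phase bc m N → ℝ, ContDiffOn ℝ ∞ H (domPlus bc m N α) ∧
      ∀ y ∈ domPlus bc m N α, hamField (cubicBracket bc m N α) H y = rtlPlusField α y := by
  refine ⟨fun y => (α ^ 2)⁻¹ * logSiteProd α y, contDiffOn_const.mul contDiffOn_logSiteProd,
    fun y hy => ?_⟩
  have hH : ∀ r : Label bc m N, fderiv ℝ (fun y => (α ^ 2)⁻¹ * logSiteProd α y) y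
      (fun p => frame α y p r) =
        (fun a b : ℤ => if a = b then α⁻¹ else 0) (r.site + r.fieldNo) r.site := fun r => by
    rw [fderiv_const_mul (contDiffOn_logSiteProd.contDiffAt (isOpen_domPlus.mem_nhds hy)
      |>.differentiableAt (by simp)), _root_.smul_apply, smul_eq_mul, fderiv_logSiteProd hy,
      siteWeight]
    by_cases h : r.fieldNo = 0
    · rw [if_pos h, h]
      simp only [Nat.cast_zero, add_zero, if_true]
      field_simp
    · simp [h]
  have hY : ∀ a b a' b' : ℤ, SameSite bc N a a' → a - b = a' - b' →
      (fun a b : ℤ => if a = b then α⁻¹ else 0) a b =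
        (fun a b : ℤ => if a = b then α⁻¹ else 0) a' b' := fun a b a' b' _ h =>
    if_congr (by omega) rfl rfl
  funext p
  rw [hamField_cubicBracket y hY hH]
  simp only [frameField_single hα, Nat.cast_zero, add_zero, sub_self, mul_zero, zero_add]
  have hsum : ∑ i ∈ Finset.range (p.fieldNo + 1),
      (fld y 1 (p.site + i) - fld y 1 (p.site + i - 1)) =
      fld y 1 (p.site + p.fieldNo) - fld y 1 (p.site - 1) := by
    have h := Finset.sum_range_sub (fun i : ℕ => fld y 1 (p.site + i - 1)) (p.fieldNo + 1)
    rw [Nat.cast_zero, add_zero, Nat.cast_succ, ← add_assoc, add_sub_cancel_right] at h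
    rw [← h]
    refine Finset.sum_congr rfl fun i _ => ?_
    rw [Nat.cast_succ, ← add_assoc, add_sub_cancel_right]
  rw [hsum, rtlPlusField, ← fld_label y p]
  by_cases h : p.fieldNo = 0
  · simp only [h, if_true, Nat.cast_zero, add_zero, zero_add, sub_self, mul_zero]
    ring
  · simp only [h, if_false]
    ring

theorem isInvariantBracket_cubicBracket (hN : 1 ≤ N) (hα : α ≠ 0) :
    IsInvariantBracket α (cubicBracket bc m N α) := by
  refine ⟨exists_hamiltonian_rtlPlusField hα, fun e n q hq => ?_⟩
  cases e with
  | atZero => exact exists_hamiltonian_atZero hα n hq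
  | atInfinity =>
    rcases n with _ | _ | n
    · refine ⟨fun _ => 0, contDiffOn_const, fun y _ => ?_⟩
      have h : hamField (cubicBracket bc m N α) (fun _ => 0) y = 0 := by
        funext p
        simp [hamField, pb]
      rw [h]
      exact satisfiesLaxTriads_zero q y
    · by_cases hq0 : q = 0
      · subst hq0
        exact exists_hamiltonian_atInfinity_one_zero hα
      · exact exists_hamiltonian_atInfinity_one hα (by omega) hq0 hq
    · exact exists_hamiltonian_atInfinity hα n hq

end Hamiltonians

end

theorem mainTheorem8 (bc : Boundary) (m N : ℕ) (hN : 0 < N) (α : ℝ) (hα : α ≠ 0) :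
    IsChangeOfVariables bc m N α ∧
      ∃ Q : Label bc m N → Label bc m N → MvPolynomial (Label bc m N) ℝ,
        (∀ p q, (Q p q).totalDegree ≤ 3) ∧
          IsPushForward α (linearBracket bc m N (-α)) (polyBivector Q) ∧
          IsPoisson (polyBivector Q) ∧
          IsInvariantBracket α (polyBivector Q) ∧
          ArePoissonCompatible (quadraticBracket bc m N α) (polyBivector Q) := by
  choose Q hQ hQ' using fun p q : Label bc m N => polyDegLE_cubicBracket (α := α) p q
  have e : polyBivector Q = cubicBracket bc m N α := by
    funext y p q
    exact hQ' p q y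
  have hc := arePoissonCompatible_cubicBracket (bc := bc) (m := m) (N := N) hα
  refine ⟨isChangeOfVariables, Q, hQ, ?_⟩
  rw [e]
  exact ⟨isPushForward_cubicBracket, hc.2.1, isInvariantBracket_cubicBracket hN hα, hc⟩
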